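/- Consider the class of equations $$v_t=v_{xx}+F(x)v_x+\varepsilon e^{v}+H(x),\qquad \varepsilon=\pm1, \tag{$*$}$$ where $F$ and $H$ are arbitrary smooth functions on an open interval $I$. Point transformations and vector fields $\tau\partial_t+\xi\partial_x+\eta\partial_v$ are considered for $(t,x,v)\in J\times I\times V$, where $J$, $V$ are arbitrary nonempty open intervals and $I$ is nonempty. The maximal Lie invariance algebra $A^{\max}$ of an equation $(*)$ consists of all smooth vector fields on $J\times I\times V$ that satisfy the infinitesimal invariance criterion (the second prolongation annihilates the equation on the manifold that the equation defines in the second-order jet space). The kernel is the intersection of the algebras $A^{\max}$ of all equations $(*)$ over $I$. The usual equivalence group $G^\sim$ consists of the nondegenerate point transformations $(\tilde t,\tilde x,\tilde v)$ of $(t,x,v)$ that do not depend on the arbitrary elements $(\varepsilon,F,H)$, together with transformations of the values of the arbitrary elements (which may depend on $t,x,v$), that map every equation of the class to an equation of the class. (a) $G^\sim$ consists exactly of the transformations $$\tilde t=\delta_1^2t+\delta_2,\quad \tilde x=\delta_1x+\delta_3,\quad \tilde v=v-\ln\delta_1^2,\quad \tilde F=\delta_1^{-1}F,\quad \tilde H=\delta_1^{-2}H,\quad\tilde\varepsilon=\varepsilon,$$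 where $\delta_1,\delta_2,\delta_3$ are arbitrary real constants, $\delta_1\ne0$. (b) The kernel of the maximal Lie invariance algebras is $\langle\partial_t\rangle$. (c) For the following pairs $(F,H)$, on every open interval on which they are smooth, a basis of $A^{\max}$ is as listed: 1. $F=\alpha x^{-1}+\mu x$, $H=\beta x^{-2}+2\mu$: $\ \partial_t,\ e^{-2\mu t}(\partial_t-\mu x\partial_x+2\mu\partial_v)$; 2. $F=\alpha x^{-1}$, $H=\beta x^{-2}$: $\ \partial_t,\ 2t\partial_t+x\partial_x-2\partial_v$; 3. $F=\mu x$, $H=\gamma$: $\ \partial_t,\ e^{-\mu t}\partial_x$; 4. $F=\lambda$, $H=\gamma$: $\ \partial_t,\ \partial_x$; 5. $F=\mu x$, $H=2\mu$: $\ \partial_t,\ e^{-\mu t}\partial_x,\ e^{-2\mu t}(\partial_t-\mu x\partial_x+2\mu\partial_v)$; 6. $F=\lambda$, $H=0$: $\ \partial_t,\ \partial_x,\ 2t\partial_t+(x-\lambda t)\partial_x-2\partial_v$. Here $\lambda\in\{0,1\}$, $\mu\in\{1,-1\}$; $\alpha,\beta,\gamma$ are arbitrary real constants with $\alpha^2+\beta^2\ne0$;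 $\gamma\ne2\mu$ in case 3 and $\gamma\neq0$ in case 4. (d) An equation of the class has $A^{\max}\ne\langle\partial_t\rangle$ if and only if it is $G^\sim$-equivalent to an equation from the list in (c), with the same $\varepsilon$ (the interval $I$ is transformed by $x\mapsto\delta_1x+\delta_3$). (e) The cases are $G^\sim$-inequivalent: if two equations from the list are $G^\sim$-equivalent, then they belong to the same case, with the same value of $\mu$ (cases 1, 3, 5) or of $\lambda$ (cases 4, 6). -/

import Mathlib

open Set Filter Topology
open scoped ContDiff

/-- Nonempty open intervals of the real line (bounded or not). -/
def IsOpenInterval (I : Set ℝ) : Prop :=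
  IsOpen I ∧ I.Nonempty ∧ I.OrdConnected

/-- Points `(t, x, v)`: the space of the independent variables and the dependent variable. Vector
fields `τ ∂_t + ξ ∂_x + η ∂_v` and point transformations are maps `J0 → J0`. -/
abbrev J0 : Type := ℝ × ℝ × ℝ

/-- First order jets `((t, x, v), (v_t, v_x))`. -/
abbrev J1 : Type := J0 × (ℝ × ℝ)

/-- Second order jets `(((t, x, v), (v_t, v_x)), (v_tt, v_tx, v_xx))`. -/
abbrev J2 : Type := J1 × (ℝ × ℝ × ℝ)

/-- The domain of all `(t, x, v)` with `t ∈ J`, `x ∈ I`, `v ∈ V`. -/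
def box (J I V : Set ℝ) : Set J0 := J ×ˢ (I ×ˢ V)

/-! ### The class of equations -/

/-- `(ε, F, H)` are admissible arbitrary elements over `I`: `ε = ±1` and `F`, `H` are smooth
functions of `x ∈ I`. -/
def InClass (I : Set ℝ) (ε : ℝ) (F H : ℝ → ℝ) : Prop :=
  (ε = 1 ∨ ε = -1) ∧ ContDiffOn ℝ ∞ F I ∧ ContDiffOn ℝ ∞ H I

/-- The function `v_t - v_xx - F(x) v_x - ε e^v - H(x)` on second order jets; its zero set is the
equation `v_t = v_xx + F(x) v_x + ε e^v + H(x)`. -/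
noncomputable def eqn (ε : ℝ) (F H : ℝ → ℝ) (j : J2) : ℝ :=
  j.1.2.1 - j.2.2.2 - F j.1.1.2.1 * j.1.2.2 - ε * Real.exp j.1.1.2.2 - H j.1.1.2.1

/-! ### Prolongation of vector fields and Lie symmetries -/

/-- Total derivative `D_t` of a function of `(t, x, v)`. -/
noncomputable def Dt0 (f : J0 → ℝ) (j : J1) : ℝ := fderiv ℝ f j.1 (1, 0, j.2.1)

/-- Total derivative `D_x` of a function of `(t, x, v)`. -/
noncomputable def Dx0 (f : J0 → ℝ) (j : J1) : ℝ := fderiv ℝ f j.1 (0, 1, j.2.2)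

/-- Total derivative `D_t` of a function of first order jets. -/
noncomputable def Dt1 (f : J1 → ℝ) (j : J2) : ℝ :=
  fderiv ℝ f j.1 ((1, 0, j.1.2.1), (j.2.1, j.2.2.1))

/-- Total derivative `D_x` of a function of first order jets. -/
noncomputable def Dx1 (f : J1 → ℝ) (j : J2) : ℝ :=
  fderiv ℝ f j.1 ((0, 1, j.1.2.2), (j.2.2.1, j.2.2.2))

/-- `η^t = D_t η - v_t D_t τ - v_x D_t ξ` for `X = (τ, ξ, η)`. -/
noncomputable def prolT (X : J0 → J0) (j : J1) : ℝ :=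
  Dt0 (fun z => (X z).2.2) j - j.2.1 * Dt0 (fun z => (X z).1) j
    - j.2.2 * Dt0 (fun z => (X z).2.1) j

/-- `η^x = D_x η - v_t D_x τ - v_x D_x ξ` for `X = (τ, ξ, η)`. -/
noncomputable def prolX (X : J0 → J0) (j : J1) : ℝ :=
  Dx0 (fun z => (X z).2.2) j - j.2.1 * Dx0 (fun z => (X z).1) j
    - j.2.2 * Dx0 (fun z => (X z).2.1) j

/-- `η^tt = D_t η^t - v_tt D_t τ - v_tx D_t ξ`. -/
noncomputable def prolTT (X : J0 → J0) (j : J2) : ℝ :=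
  Dt1 (prolT X) j - j.2.1 * Dt0 (fun z => (X z).1) j.1 - j.2.2.1 * Dt0 (fun z => (X z).2.1) j.1

/-- `η^tx = D_x η^t - v_tt D_x τ - v_tx D_x ξ`. -/
noncomputable def prolTX (X : J0 → J0) (j : J2) : ℝ :=
  Dx1 (prolT X) j - j.2.1 * Dx0 (fun z => (X z).1) j.1 - j.2.2.1 * Dx0 (fun z => (X z).2.1) j.1

/-- `η^xx = D_x η^x - v_tx D_x τ - v_xx D_x ξ`. -/
noncomputable def prolXX (X : J0 → J0) (j : J2) : ℝ :=
  Dx1 (prolX X) j - j.2.2.1 * Dx0 (fun z => (X z).1) j.1 - j.2.2.2 * Dx0 (fun z => (X z).2.1) j.1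

/-- The second prolongation of the vector field `X`, a vector field on second order jets. -/
noncomputable def prolong (X : J0 → J0) (j : J2) : J2 :=
  ((X j.1.1, (prolT X j.1, prolX X j.1)), (prolTT X j, prolTX X j, prolXX X j))

/-- `X` is a smooth vector field on `Ω` that generates Lie symmetries of the equation given by
`(ε, F, H)`: its second prolongation annihilates the equation on the equation manifold. -/
def IsLieSymmetry (Ω : Set J0) (ε : ℝ) (F H : ℝ → ℝ) (X : J0 → J0) : Prop :=
  ContDiffOn ℝ ∞ X Ω ∧
    ∀ j : J2, j.1.1 ∈ Ω → eqn ε F H j = 0 → fderiv ℝ (eqn ε F H) j (prolong X j) = 0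

/-- The maximal Lie invariance algebra over `Ω`; its elements are vector fields on `Ω`, that is,
functions with domain `Ω`. -/
def maxAlg (Ω : Set J0) (ε : ℝ) (F H : ℝ → ℝ) : Set (Ω → J0) :=
  {Y | ∃ X : J0 → J0, IsLieSymmetry Ω ε F H X ∧ Y = Ω.domRestrict X}

/-- The kernel: the common part of the maximal Lie invariance algebras of all equations of the
class, over the domain `J × I × V`. -/
def kernelAlg (J I V : Set ℝ) : Set (box J I V → J0) :=
  {Y | ∀ (ε : ℝ) (F H : ℝ → ℝ), InClass I ε F H → Y ∈ maxAlg (box J I V) ε F H}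

/-- The linear span, over `Ω`, of a finite list of vector fields. -/
def spanOn (Ω : Set J0) (L : List (J0 → J0)) : Set (Ω → J0) :=
  (Submodule.span ℝ (Set.range fun i : Fin L.length => Ω.domRestrict (L.get i)) : Set (Ω → J0))

/-- The list `L` of vector fields is, over `Ω`, a basis of `A`. -/
def IsBasisOn (Ω : Set J0) (L : List (J0 → J0)) (A : Set (Ω → J0)) : Prop :=
  LinearIndependent ℝ (fun i : Fin L.length => Ω.domRestrict (L.get i)) ∧ spanOn Ω L = A

/-! ### Point transformations and the usual equivalence group -/

/-- `∂u/∂t`. -/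
noncomputable def pdt (u : ℝ × ℝ → ℝ) (p : ℝ × ℝ) : ℝ := fderiv ℝ u p (1, 0)

/-- `∂u/∂x`. -/
noncomputable def pdx (u : ℝ × ℝ → ℝ) (p : ℝ × ℝ) : ℝ := fderiv ℝ u p (0, 1)

/-- The second order jet of the function `u` at the point `p = (t, x)`. -/
noncomputable def jet2 (u : ℝ × ℝ → ℝ) (p : ℝ × ℝ) : J2 :=
  (((p.1, p.2, u p), (pdt u p, pdx u p)), (pdt (pdt u) p, pdx (pdt u) p, pdx (pdx u) p))

/-- The point transformation `(t̃, x̃, ṽ) = φ(t, x, v)` of `Ω` maps the equation given by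
`(ε, F, H)` to the equation given by `(ε', F', H')`: if, near `p`, it takes the graph of `u` to the
graph of `u'`, then `u` satisfies the first equation at `p` if and only if `u'` satisfies the second
one at the image `b p` of `p`. Here `b` is the induced map of the independent variables, which has
to be nonsingular at `p`. -/
def MapsEquation (Ω : Set J0) (φ : J0 → J0) (ε : ℝ) (F H : ℝ → ℝ) (ε' : ℝ) (F' H' : ℝ → ℝ) :
    Prop :=
  ∀ (u u' : ℝ × ℝ → ℝ) (b : ℝ × ℝ → ℝ × ℝ) (p : ℝ × ℝ),
    (p.1, p.2, u p) ∈ Ω → ContDiffAt ℝ ∞ u p →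
    (∀ q, b q = ((φ (q.1, q.2, u q)).1, (φ (q.1, q.2, u q)).2.1)) →
    Function.Bijective (fderiv ℝ b p) →
    ContDiffAt ℝ ∞ u' (b p) →
    (∀ᶠ q in 𝓝 p, u' (b q) = (φ (q.1, q.2, u q)).2.2) →
    (eqn ε F H (jet2 u p) = 0 ↔ eqn ε' F' H' (jet2 u' (b p)) = 0)

/-- The transformation
`(t̃, x̃, ṽ) = φ(t, x, v)`, `(ε̃, F̃, H̃) = Θ(t, x, v)(ε, F, H)`
over the domain `J × I × V` belongs to the usual equivalence group of the class: `φ` is a smooth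
nondegenerate point transformation that does not depend on the arbitrary elements, and together with
`Θ` it maps every equation of the class to an equation of the class. -/
def IsEquivalenceTransformation (J I V : Set ℝ) (φ : J0 → J0) (Θ : J0 → ℝ × ℝ × ℝ → ℝ × ℝ × ℝ) :
    Prop :=
  ContDiffOn ℝ ∞ φ (box J I V) ∧
  (∀ z ∈ box J I V, Function.Bijective (fderiv ℝ φ z)) ∧
  ∀ (ε : ℝ) (F H : ℝ → ℝ), InClass I ε F H →
    ∃ (ε' : ℝ) (F' H' : ℝ → ℝ),
      InClass ((fun z => (φ z).2.1) '' box J I V) ε' F' H' ∧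
      (∀ z ∈ box J I V,
        Θ z (ε, F z.2.1, H z.2.1) = (ε', F' (φ z).2.1, H' (φ z).2.1)) ∧
      MapsEquation (box J I V) φ ε F H ε' F' H'

/-- The pairs `(F, H)` over `I` and `(F', H')` over `I'` are equivalent with respect to the group
`t̃ = δ₁² t + δ₂`, `x̃ = δ₁ x + δ₃`, `ṽ = v - ln δ₁²`, `F̃ = δ₁⁻¹ F`, `H̃ = δ₁⁻² H`, `ε̃ = ε`. -/
def GEquiv (I : Set ℝ) (F H : ℝ → ℝ) (I' : Set ℝ) (F' H' : ℝ → ℝ) : Prop :=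
  ∃ δ₁ δ₃ : ℝ, δ₁ ≠ 0 ∧ I' = (fun x => δ₁ * x + δ₃) '' I ∧
    ∀ x ∈ I, F' (δ₁ * x + δ₃) = δ₁⁻¹ * F x ∧ H' (δ₁ * x + δ₃) = (δ₁ ^ 2)⁻¹ * H x

/-! ### The classification table -/

/-- The six cases with their parameters. -/
inductive TableRow : Type
  | case1 (α β μ : ℝ)
  | case2 (α β : ℝ)
  | case3 (μ γ : ℝ)
  | case4 (l γ : ℝ)
  | case5 (μ : ℝ)
  | case6 (l : ℝ)

namespace TableRow

/-- The constraints on the parameters: `μ = ±1`, `l ∈ {0, 1}`, and so on. -/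
def Valid : TableRow → Prop
  | case1 α β μ => (μ = 1 ∨ μ = -1) ∧ α ^ 2 + β ^ 2 ≠ 0
  | case2 α β => α ^ 2 + β ^ 2 ≠ 0
  | case3 μ γ => (μ = 1 ∨ μ = -1) ∧ γ ≠ 2 * μ
  | case4 l γ => (l = 0 ∨ l = 1) ∧ γ ≠ 0
  | case5 μ => μ = 1 ∨ μ = -1
  | case6 l => l = 0 ∨ l = 1

/-- The number of the case. -/
def number : TableRow → ℕ
  | case1 _ _ _ => 1
  | case2 _ _ => 2
  | case3 _ _ => 3
  | case4 _ _ => 4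
  | case5 _ => 5
  | case6 _ => 6

/-- The value of the normalized parameter (`μ` or `l`) of the case; there is none in case 2. -/
def normalized : TableRow → ℝ
  | case1 _ _ μ => μ
  | case2 _ _ => 0
  | case3 μ _ => μ
  | case4 l _ => l
  | case5 μ => μ
  | case6 l => l

/-- The function `F` of the case. -/
noncomputable def F : TableRow → ℝ → ℝ
  | case1 α _ μ => fun x => α * x⁻¹ + μ * x
  | case2 α _ => fun x => α * x⁻¹
  | case3 μ _ => fun x => μ * x
  | case4 l _ => fun _ => l
  | case5 μ => fun x => μ * x
  | case6 l => fun _ => l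

/-- The function `H` of the case. -/
noncomputable def H : TableRow → ℝ → ℝ
  | case1 _ β μ => fun x => β * (x ^ 2)⁻¹ + 2 * μ
  | case2 _ β => fun x => β * (x ^ 2)⁻¹
  | case3 _ γ => fun _ => γ
  | case4 _ γ => fun _ => γ
  | case5 μ => fun _ => 2 * μ
  | case6 _ => fun _ => 0

/-- `∂_t`. -/
def vecT : J0 → J0 := fun _ => (1, 0, 0)

/-- `∂_x`. -/
def vecX : J0 → J0 := fun _ => (0, 1, 0)

/-- `e^{-μt} ∂_x`. -/
noncomputable def vecExpX (μ : ℝ) : J0 → J0 := fun z => (0, Real.exp (-μ * z.1), 0)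

/-- `e^{-2μt} (∂_t - μ x ∂_x + 2 μ ∂_v)`. -/
noncomputable def vecExpS (μ : ℝ) : J0 → J0 :=
  fun z => Real.exp (-2 * μ * z.1) • ((1, -μ * z.2.1, 2 * μ) : J0)

/-- `2 t ∂_t + (x - l t) ∂_x - 2 ∂_v`. -/
def vecS (l : ℝ) : J0 → J0 := fun z => (2 * z.1, z.2.1 - l * z.1, -2)

/-- The basis of the maximal Lie invariance algebra of the case. -/
noncomputable def basis : TableRow → List (J0 → J0)
  | case1 _ _ μ => [vecT, vecExpS μ]
  | case2 _ _ => [vecT, vecS 0]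
  | case3 μ _ => [vecT, vecExpX μ]
  | case4 _ _ => [vecT, vecX]
  | case5 μ => [vecT, vecExpX μ, vecExpS μ]
  | case6 l => [vecT, vecX, vecS l]

end TableRow

/-! Symmetries. On the equation, solved for v_t, the invariance criterion is polynomial in the free
jet coordinates v_x, v_tx, v_xx. The coefficient of v_tx forces τ = τ(t), that of v_xx forces ξ =
τ'x/2 + σ(t), and that of v_x² makes η affine in v. In the remainder e^v is multiplied by an affine
function of v while all other terms are affine in v; this leaves η = -τ'. A symmetry is therefore a
pair (τ, σ) satisfying two equations free of ε and v, `DeterminingEqs`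
(`IsLieSymmetry.exists_isSol`, `mem_maxAlg_iff`).

The table. All six cases have the form F = A/x + Mx + L, H = B/x² + K. Clearing denominators and
comparing powers of x turns the determining equations into linear equations in t with constant
coefficients, together with σA = σB = 0 (`SplitEqs`). Their solutions are exponential for M ≠ 0 and
polynomial for M = 0, which yields the bases. The equation with F = x², H = 0 admits only ∂_t, so
the kernel is no larger.

Exhaustion. A nontrivial solution (τ, σ), frozen at one time, is an ordinary differential equation
for F and for H. If τ' ≠ 0 there, integrating factors give the normal form with K = 2M about a
shifted origin (`exists_normal_form`); if τ' vanishes identically, F' and H are constant.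
Translations and scalings then lead to the table (`IsSol.isClassified`). Under equivalence A and B
are invariant, M and K are multiplied by a positive factor and, when M = 0, L by a nonzero one;
these data tell the cases apart (`normal_form_invariants`).

The group. A transformation is tested on quadratic polynomials (`MapsEquation.exists_jet`). One
equation already gives much: v_tt is unrestricted by it, so t̃ depends on t only; varying v_xx gives
x̃_v = 0 and x̃_x² = t̃_t. Comparing the images of several equations gives the rest: ε = 1 against ε
= -1 yields ṽ = v - ln t̃_t, and F = 0, 1, x yield x̃_t = 0. Hence x̃_x is constant and everything
integrates. -/

/-! ### Second derivatives on open sets -/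

/-- The second derivative of `f` at `z` in the directions `a` and `b`. -/
noncomputable def D2 (f : J0 → ℝ) (z a b : J0) : ℝ := fderiv ℝ (fderiv ℝ f) z a b

theorem D2_add_left (f : J0 → ℝ) (z a a' b : J0) : D2 f z (a + a') b = D2 f z a b + D2 f z a' b := by
  simp [D2]

theorem D2_add_right (f : J0 → ℝ) (z a b b' : J0) :
    D2 f z a (b + b') = D2 f z a b + D2 f z a b' := by
  simp [D2]

theorem D2_smul_left (f : J0 → ℝ) (z a b : J0) (c : ℝ) : D2 f z (c • a) b = c * D2 f z a b := by
  simp [D2]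

theorem D2_smul_right (f : J0 → ℝ) (z a b : J0) (c : ℝ) : D2 f z a (c • b) = c * D2 f z a b := by
  simp [D2]

section OpenSet

variable {Ω : Set J0} {f : J0 → ℝ} {z : J0}

theorem ContDiffOn.contDiffAt_of_isOpen (hf : ContDiffOn ℝ ∞ f Ω) (hΩ : IsOpen Ω) (hz : z ∈ Ω) :
    ContDiffAt ℝ ∞ f z :=
  hf.contDiffAt (hΩ.mem_nhds hz)

theorem ContDiffOn.differentiableAt_of_isOpen (hf : ContDiffOn ℝ ∞ f Ω) (hΩ : IsOpen Ω)
    (hz : z ∈ Ω) : DifferentiableAt ℝ f z :=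
  (hf.contDiffAt_of_isOpen hΩ hz).differentiableAt (by simp)

theorem ContDiffOn.contDiffOn_fderiv_apply (hf : ContDiffOn ℝ ∞ f Ω) (hΩ : IsOpen Ω) (b : J0) :
    ContDiffOn ℝ ∞ (fun y => fderiv ℝ f y b) Ω :=
  (hf.fderiv_of_isOpen hΩ (m := ∞) (by simp)).clm_apply contDiffOn_const

theorem ContDiffAt.hasFDerivAt_fderiv (hf : ContDiffAt ℝ ∞ f z) :
    HasFDerivAt (fderiv ℝ f) (fderiv ℝ (fderiv ℝ f) z) z :=
  ((hf.fderiv_right (m := ∞) (by simp)).differentiableAt (by simp)).hasFDerivAt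

theorem fderiv_fderiv_apply (hf : ContDiffAt ℝ ∞ f z) (a b : J0) :
    fderiv ℝ (fun y => fderiv ℝ f y b) z a = D2 f z a b := by
  have := hf.hasFDerivAt_fderiv.clm_apply (hasFDerivAt_const b z)
  rw [this.fderiv]
  simp [D2]

/-- A first derivative known on the whole open set may be differentiated once more. It is applied
with g constant or depending on t alone, mostly to make second derivatives vanish. -/
theorem D2_eq_fderiv (hΩ : IsOpen Ω) (hf : ContDiffOn ℝ ∞ f Ω) (hz : z ∈ Ω) {g : J0 → ℝ} {b : J0}
    (h : ∀ y ∈ Ω, fderiv ℝ f y b = g y) (a : J0) : D2 f z a b = fderiv ℝ g z a := by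
  rw [← fderiv_fderiv_apply (hf.contDiffAt_of_isOpen hΩ hz)]
  have : (fun y => fderiv ℝ f y b) =ᶠ[𝓝 z] g := by
    filter_upwards [hΩ.mem_nhds hz] with y hy using h y hy
  rw [this.fderiv_eq]

end OpenSet

theorem fderiv_apply_triple (f : J0 → ℝ) (z : J0) (a b c : ℝ) :
    fderiv ℝ f z (a, b, c) = a * fderiv ℝ f z (1, 0, 0) + b * fderiv ℝ f z (0, 1, 0)
      + c * fderiv ℝ f z (0, 0, 1) := by
  have : ((a, b, c) : J0) = a • (1, 0, 0) + b • (0, 1, 0) + c • (0, 0, 1) := by simp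
  rw [this]; simp only [map_add, map_smul, smul_eq_mul]

theorem D2_horizontal (f : J0 → ℝ) (z : J0) (c : ℝ) :
    D2 f z (0, 1, c) (0, 1, c) = D2 f z (0, 1, 0) (0, 1, 0)
      + c * (D2 f z (0, 1, 0) (0, 0, 1) + D2 f z (0, 0, 1) (0, 1, 0))
      + c ^ 2 * D2 f z (0, 0, 1) (0, 0, 1) := by
  have : ((0, 1, c) : J0) = (0, 1, 0) + c • (0, 0, 1) := by simp
  rw [this]
  simp only [D2_add_left, D2_add_right, D2_smul_left, D2_smul_right]
  ring

/-! ### Functions on boxes -/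

section Box

variable {J I V : Set ℝ}

theorem IsOpenInterval.convex {I : Set ℝ} (hI : IsOpenInterval I) : Convex ℝ I := hI.2.2.convex

theorem isOpen_box (hJ : IsOpenInterval J) (hI : IsOpenInterval I) (hV : IsOpenInterval V) :
    IsOpen (box J I V) := hJ.1.prod (hI.1.prod hV.1)

theorem convex_box (hJ : IsOpenInterval J) (hI : IsOpenInterval I) (hV : IsOpenInterval V) :
    Convex ℝ (box J I V) := hJ.convex.prod (hI.convex.prod hV.convex)

theorem mem_box {t x v : ℝ} (ht : t ∈ J) (hx : x ∈ I) (hv : v ∈ V) : (t, x, v) ∈ box J I V :=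
  ⟨ht, hx, hv⟩

/-- A function with vanishing derivative in the last variable does not depend on it. -/
theorem eq_of_fderiv_v_eq_zero (hV : IsOpenInterval V) {f : J0 → ℝ}
    (hf : ∀ z ∈ box J I V, DifferentiableAt ℝ f z)
    (h : ∀ z ∈ box J I V, fderiv ℝ f z (0, 0, 1) = 0) {t x v v' : ℝ} (ht : t ∈ J) (hx : x ∈ I)
    (hv : v ∈ V) (hv' : v' ∈ V) : f (t, x, v) = f (t, x, v') := by
  have key : ∀ w ∈ V, HasDerivAt (fun w => f (t, x, w)) 0 w := by
    intro w hw
    have h1 : HasDerivAt (fun w : ℝ => ((t, x, w) : J0)) (0, 0, 1) w :=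
      (hasDerivAt_const w t).prodMk ((hasDerivAt_const w x).prodMk (hasDerivAt_id w))
    have := (hf _ (mem_box ht hx hw)).hasFDerivAt.comp_hasDerivAt w h1
    rwa [h _ (mem_box ht hx hw)] at this
  exact hV.1.is_const_of_deriv_eq_zero hV.convex.isPreconnected
    (fun w hw => (key w hw).differentiableAt.differentiableWithinAt) (fun w hw => (key w hw).deriv)
    hv hv'

/-- A function with vanishing derivative in the second variable does not depend on it. -/
theorem eq_of_fderiv_x_eq_zero (hI : IsOpenInterval I) {f : J0 → ℝ}
    (hf : ∀ z ∈ box J I V, DifferentiableAt ℝ f z)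
    (h : ∀ z ∈ box J I V, fderiv ℝ f z (0, 1, 0) = 0) {t x x' v : ℝ} (ht : t ∈ J) (hx : x ∈ I)
    (hx' : x' ∈ I) (hv : v ∈ V) : f (t, x, v) = f (t, x', v) := by
  have key : ∀ w ∈ I, HasDerivAt (fun w => f (t, w, v)) 0 w := by
    intro w hw
    have h1 : HasDerivAt (fun w : ℝ => ((t, w, v) : J0)) (0, 1, 0) w :=
      (hasDerivAt_const w t).prodMk ((hasDerivAt_id w).prodMk (hasDerivAt_const w v))
    have := (hf _ (mem_box ht hw hv)).hasFDerivAt.comp_hasDerivAt w h1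
    rwa [h _ (mem_box ht hw hv)] at this
  exact hI.1.is_const_of_deriv_eq_zero hI.convex.isPreconnected
    (fun w hw => (key w hw).differentiableAt.differentiableWithinAt) (fun w hw => (key w hw).deriv)
    hx hx'

/-- A function with vanishing derivatives in the last two variables depends only on the first. -/
theorem eq_of_fderiv_xv_eq_zero (hI : IsOpenInterval I) (hV : IsOpenInterval V) {f : J0 → ℝ}
    (hf : ∀ z ∈ box J I V, DifferentiableAt ℝ f z)
    (hx : ∀ z ∈ box J I V, fderiv ℝ f z (0, 1, 0) = 0)
    (hv : ∀ z ∈ box J I V, fderiv ℝ f z (0, 0, 1) = 0) {x₀ v₀ : ℝ} (hx₀ : x₀ ∈ I) (hv₀ : v₀ ∈ V)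
    {z : J0} (hz : z ∈ box J I V) : f z = f (z.1, x₀, v₀) := by
  obtain ⟨t, x, v⟩ := z
  obtain ⟨ht, hx', hv'⟩ := hz
  exact (eq_of_fderiv_x_eq_zero hI hf hx ht hx' hx₀ hv').trans
    (eq_of_fderiv_v_eq_zero hV hf hv ht hx₀ hv' hv₀)

/-- The derivative of a function that only depends on the first variable. -/
theorem fderiv_comp_fst (g : ℝ → ℝ) {z : J0} (hg : DifferentiableAt ℝ g z.1) (a : J0) :
    fderiv ℝ (fun y : J0 => g y.1) z a = a.1 * deriv g z.1 := by
  have h1 : HasFDerivAt (fun y : J0 => y.1) (ContinuousLinearMap.fst ℝ ℝ (ℝ × ℝ)) z := hasFDerivAt_fst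
  have := hg.hasDerivAt.comp_hasFDerivAt z h1
  have h2 : fderiv ℝ (fun y : J0 => g y.1) z = _ := this.fderiv
  rw [h2]
  simp [mul_comm]

theorem contDiffOn_slice {f : J0 → ℝ} (hf : ContDiffOn ℝ ∞ f (box J I V)) {x₀ v₀ : ℝ}
    (hx₀ : x₀ ∈ I) (hv₀ : v₀ ∈ V) : ContDiffOn ℝ ∞ (fun t => f (t, x₀, v₀)) J :=
  hf.comp (contDiff_id.prodMk contDiff_const).contDiffOn fun _ ht => mem_box ht hx₀ hv₀

end Box

theorem ContDiffOn.deriv_isOpen {f : ℝ → ℝ} {J : Set ℝ} (hf : ContDiffOn ℝ ∞ f J) (hJ : IsOpen J) :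
    ContDiffOn ℝ ∞ (deriv f) J := hf.deriv_of_isOpen hJ (by simp)

theorem ContDiffOn.differentiableAt_isOpen {f : ℝ → ℝ} {J : Set ℝ} (hf : ContDiffOn ℝ ∞ f J)
    (hJ : IsOpen J) {t : ℝ} (ht : t ∈ J) : DifferentiableAt ℝ f t :=
  (hf.contDiffAt (hJ.mem_nhds ht)).differentiableAt (by simp)

/-! ### The infinitesimal invariance criterion in coordinates -/

theorem fderiv_eqn (ε : ℝ) {F H : ℝ → ℝ} {j : J2} (hF : DifferentiableAt ℝ F j.1.1.2.1)
    (hH : DifferentiableAt ℝ H j.1.1.2.1) (d : J2) :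
    fderiv ℝ (eqn ε F H) j d = d.1.2.1 - d.2.2.2 - F j.1.1.2.1 * d.1.2.2
      - deriv F j.1.1.2.1 * d.1.1.2.1 * j.1.2.2 - ε * Real.exp j.1.1.2.2 * d.1.1.2.2
      - deriv H j.1.1.2.1 * d.1.1.2.1 := by
  have i1 : HasFDerivAt (fun y : J2 => y) (ContinuousLinearMap.id ℝ J2) j := hasFDerivAt_id j
  have hx := i1.fst.fst.snd.fst
  have h := (((i1.fst.snd.fst.sub i1.snd.snd.snd).sub
    ((hF.hasDerivAt.comp_hasFDerivAt j hx).mul i1.fst.snd.snd)).sub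
    ((i1.fst.fst.snd.snd.exp).const_mul ε)).sub (hH.hasDerivAt.comp_hasFDerivAt j hx)
  have h' : fderiv ℝ (eqn ε F H) j = _ := h.fderiv
  rw [h']
  simp
  ring

/-- The direction (0, 1, v_x) itself varies with the jet: moving the base point produces the second
derivative, moving v_x produces f_v. -/
theorem hasFDerivAt_fderiv_horizontal {f : J0 → ℝ} {j : J1} (hf : ContDiffAt ℝ ∞ f j.1) :
    ∃ L : J1 →L[ℝ] ℝ, HasFDerivAt (Dx0 f) L j ∧
      ∀ d, L d = D2 f j.1 d.1 (0, 1, j.2.2) + fderiv ℝ f j.1 (0, 0, d.2.2) := by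
  have i1 : HasFDerivAt (fun y : J1 => y) (ContinuousLinearMap.id ℝ J1) j := hasFDerivAt_id j
  have hc : HasFDerivAt (fun y : J1 => fderiv ℝ f y.1) _ j :=
    hf.hasFDerivAt_fderiv.comp j i1.fst
  have hu : HasFDerivAt (fun y : J1 => ((0, 1, y.2.2) : J0)) _ j :=
    (hasFDerivAt_const (0 : ℝ) j).prodMk ((hasFDerivAt_const (1 : ℝ) j).prodMk i1.snd.snd)
  refine ⟨_, hc.clm_apply hu, fun d => ?_⟩
  simp [D2, add_comm]

/-- By the Leibniz rule, η^xx = D_x²η - v_t D_x²τ - v_x D_x²ξ - 2 v_tx D_xτ - 2 v_xx D_xξ, and D_x²f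
is the second derivative of f along (0, 1, v_x) plus v_xx f_v. No v_tt occurs. -/
theorem prolXX_eq {X : J0 → J0} {j : J2} (hX : ContDiffAt ℝ ∞ X j.1.1) :
    let h : J0 := (0, 1, j.1.2.2)
    let τ : J0 → ℝ := fun z => (X z).1
    let ξ : J0 → ℝ := fun z => (X z).2.1
    let η : J0 → ℝ := fun z => (X z).2.2
    let z := j.1.1
    prolXX X j = D2 η z h h + j.2.2.2 * fderiv ℝ η z (0, 0, 1)
      - 2 * j.2.2.1 * fderiv ℝ τ z h
      - j.1.2.1 * (D2 τ z h h + j.2.2.2 * fderiv ℝ τ z (0, 0, 1))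
      - 2 * j.2.2.2 * fderiv ℝ ξ z h
      - j.1.2.2 * (D2 ξ z h h + j.2.2.2 * fderiv ℝ ξ z (0, 0, 1)) := by
  intro h τ ξ η z
  obtain ⟨Lτ, hτ, eτ⟩ := hasFDerivAt_fderiv_horizontal (j := j.1) (f := τ) hX.fst
  obtain ⟨Lξ, hξ, eξ⟩ := hasFDerivAt_fderiv_horizontal (j := j.1) (f := ξ) hX.snd.fst
  obtain ⟨Lη, hη, eη⟩ := hasFDerivAt_fderiv_horizontal (j := j.1) (f := η) hX.snd.snd
  have i1 : HasFDerivAt (fun y : J1 => y) (ContinuousLinearMap.id ℝ J1) j.1 := hasFDerivAt_id j.1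
  have hp : fderiv ℝ (prolX X) j.1 = _ :=
    ((hη.sub (i1.snd.fst.mul hτ)).sub (i1.snd.snd.mul hξ)).fderiv
  have e : ∀ f : J0 → ℝ, fderiv ℝ f j.1.1 (0, 0, j.2.2.2)
      = j.2.2.2 * fderiv ℝ f j.1.1 (0, 0, 1) := fun f => by
    rw [fderiv_apply_triple]; ring
  unfold prolXX Dx1
  rw [hp]
  simp [eτ, eξ, eη, Dx0, h, z, e]
  ring

/-- The infinitesimal invariance criterion, with the equation solved for `v_t`. -/
theorem invariance_iff {ε : ℝ} {F H : ℝ → ℝ} {X : J0 → J0} {z : J0} (hX : ContDiffAt ℝ ∞ X z)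
    (hF : DifferentiableAt ℝ F z.2.1) (hH : DifferentiableAt ℝ H z.2.1) :
    (∀ j : J2, j.1.1 = z → eqn ε F H j = 0 → fderiv ℝ (eqn ε F H) j (prolong X j) = 0) ↔
    ∀ c m g : ℝ,
      let h : J0 := (0, 1, c)
      let τ : J0 → ℝ := fun z => (X z).1
      let ξ : J0 → ℝ := fun z => (X z).2.1
      let η : J0 → ℝ := fun z => (X z).2.2
      let a := g + F z.2.1 * c + ε * Real.exp z.2.2 + H z.2.1
      fderiv ℝ η z (1, 0, a) - a * fderiv ℝ τ z (1, 0, a) - c * fderiv ℝ ξ z (1, 0, a)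
        - (D2 η z h h + g * fderiv ℝ η z (0, 0, 1) - 2 * m * fderiv ℝ τ z h
          - a * (D2 τ z h h + g * fderiv ℝ τ z (0, 0, 1)) - 2 * g * fderiv ℝ ξ z h
          - c * (D2 ξ z h h + g * fderiv ℝ ξ z (0, 0, 1)))
        - F z.2.1 * (fderiv ℝ η z h - a * fderiv ℝ τ z h - c * fderiv ℝ ξ z h)
        - deriv F z.2.1 * ξ z * c - ε * Real.exp z.2.2 * η z - deriv H z.2.1 * ξ z = 0 := by
  constructor
  · intro hj c m g
    -- The value 0 for v_tt is arbitrary: neither the equation nor η^t, η^x, η^xx contains v_tt.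
    have := hj ((z, (g + F z.2.1 * c + ε * Real.exp z.2.2 + H z.2.1, c)), (0, m, g)) rfl
      (by simp only [eqn]; ring)
    rw [fderiv_eqn ε hF hH] at this
    simp only [prolong] at this
    rw [prolXX_eq (by exact hX)] at this
    simpa only [prolT, prolX, Dt0, Dx0] using this
  · rintro hj ⟨⟨z', a, c⟩, n, m, g⟩ rfl he
    have ha : a = g + F z'.2.1 * c + ε * Real.exp z'.2.2 + H z'.2.1 := by
      simp only [eqn] at he; linarith
    have := hj c m g
    rw [fderiv_eqn ε hF hH]
    simp only [prolong]
    rw [prolXX_eq (by exact hX)]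
    simp only [prolT, prolX, Dt0, Dx0, ha]
    exact this

/-! ### Solving the determining equations -/

/-- The determining equations for the symmetries `τ ∂_t + (τ' x / 2 + σ) ∂_x - τ' ∂_v`. -/
def DeterminingEqs (F H τ σ : ℝ → ℝ) (t x : ℝ) : Prop :=
  deriv (deriv τ) t / 2 * x + deriv σ t + deriv τ t / 2 * F x
      + (deriv τ t / 2 * x + σ t) * deriv F x = 0 ∧
    deriv (deriv τ) t + deriv τ t * H x + (deriv τ t / 2 * x + σ t) * deriv H x = 0

/-- Smooth solutions of the determining equations over `J × I`. -/
def IsSol (J I : Set ℝ) (F H τ σ : ℝ → ℝ) : Prop :=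
  ContDiffOn ℝ ∞ τ J ∧ ContDiffOn ℝ ∞ σ J ∧ ∀ t ∈ J, ∀ x ∈ I, DeterminingEqs F H τ σ t x

/-- The vector field `τ ∂_t + (τ' x / 2 + σ) ∂_x - τ' ∂_v`. -/
noncomputable def symField (τ σ : ℝ → ℝ) (z : J0) : J0 :=
  (τ z.1, deriv τ z.1 / 2 * z.2.1 + σ z.1, -deriv τ z.1)

section Ansatz

variable {J I V : Set ℝ} {τ σ : ℝ → ℝ} {X : J0 → J0}

theorem contDiffOn_symField (hJ : IsOpen J) (hτ : ContDiffOn ℝ ∞ τ J) (hσ : ContDiffOn ℝ ∞ σ J) :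
    ContDiffOn ℝ ∞ (symField τ σ) (box J I V) := by
  have hm : MapsTo (fun z : J0 => z.1) (box J I V) J := fun z hz => hz.1
  have h1 := hτ.comp contDiff_fst.contDiffOn hm
  have h2 := (hτ.deriv_isOpen hJ).comp contDiff_fst.contDiffOn hm
  have h3 := hσ.comp contDiff_fst.contDiffOn hm
  exact h1.prodMk ((((h2.div_const 2).mul contDiff_snd.fst.contDiffOn).add h3).prodMk h2.neg)

/-- For these fields the terms with v_tx and v_xx cancel identically, and so do those with ε e^v
because η = -τ'. What is left is affine in v_x, and its two coefficients are, up to sign, the two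
determining equations. -/
theorem invariance_symField_iff (hJ : IsOpenInterval J) (hI : IsOpenInterval I)
    (hV : IsOpenInterval V) (hτ : ContDiffOn ℝ ∞ τ J) (hσ : ContDiffOn ℝ ∞ σ J)
    (hX : ∀ z ∈ box J I V, X z = symField τ σ z) {ε : ℝ} {F H : ℝ → ℝ} {z : J0}
    (hz : z ∈ box J I V) (hF : DifferentiableAt ℝ F z.2.1) (hH : DifferentiableAt ℝ H z.2.1) :
    (∀ j : J2, j.1.1 = z → eqn ε F H j = 0 → fderiv ℝ (eqn ε F H) j (prolong X j) = 0) ↔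
      DeterminingEqs F H τ σ z.1 z.2.1 := by
  have hΩ := isOpen_box hJ hI hV
  have hX' : ContDiffOn ℝ ∞ X (box J I V) := (contDiffOn_symField hJ.1 hτ hσ).congr hX
  have hτ' := hτ.deriv_isOpen hJ.1
  have e1 : ∀ y ∈ box J I V, ∀ a, fderiv ℝ (fun z => (X z).1) y a = a.1 * deriv τ y.1 := by
    intro y hy a
    have : (fun z => (X z).1) =ᶠ[𝓝 y] fun z => τ z.1 := by
      filter_upwards [hΩ.mem_nhds hy] with w hw
      rw [hX w hw]; rfl
    rw [this.fderiv_eq, fderiv_comp_fst _ (hτ.differentiableAt_isOpen hJ.1 hy.1)]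
  have e3 : ∀ y ∈ box J I V, ∀ a,
      fderiv ℝ (fun z => (X z).2.2) y a = a.1 * -deriv (deriv τ) y.1 := by
    intro y hy a
    have : (fun z => (X z).2.2) =ᶠ[𝓝 y] fun z => (fun t => -deriv τ t) z.1 := by
      filter_upwards [hΩ.mem_nhds hy] with w hw
      rw [hX w hw]; rfl
    rw [this.fderiv_eq, fderiv_comp_fst (fun t => -deriv τ t)
      (hτ'.differentiableAt_isOpen hJ.1 hy.1).neg, deriv.fun_neg]
  have e2 : ∀ y ∈ box J I V, ∀ a, fderiv ℝ (fun z => (X z).2.1) y a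
      = a.1 * (deriv (deriv τ) y.1 / 2 * y.2.1 + deriv σ y.1) + a.2.1 * (deriv τ y.1 / 2) := by
    intro y hy a
    have : (fun z => (X z).2.1) =ᶠ[𝓝 y] fun z => deriv τ z.1 / 2 * z.2.1 + σ z.1 := by
      filter_upwards [hΩ.mem_nhds hy] with w hw
      rw [hX w hw]; rfl
    rw [this.fderiv_eq]
    have i1 : HasFDerivAt (fun y : J0 => y) (ContinuousLinearMap.id ℝ J0) y := hasFDerivAt_id y
    have h1 := (hτ'.differentiableAt_isOpen hJ.1 hy.1).hasDerivAt.div_const 2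
    have h2 := (hσ.differentiableAt_isOpen hJ.1 hy.1).hasDerivAt
    have h3 : fderiv ℝ (fun z : J0 => deriv τ z.1 / 2 * z.2.1 + σ z.1) y = _ :=
      (((h1.comp_hasFDerivAt y i1.fst).mul i1.snd.fst).add (h2.comp_hasFDerivAt y i1.fst)).fderiv
    rw [h3]
    simp
    ring
  have d1 : ∀ c : ℝ, D2 (fun z => (X z).1) z (0, 1, c) (0, 1, c) = 0 := fun c => by
    rw [D2_eq_fderiv hΩ hX'.fst hz (g := fun _ => 0) (fun y hy => by rw [e1 y hy]; simp)]
    simp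
  have d3 : ∀ c : ℝ, D2 (fun z => (X z).2.2) z (0, 1, c) (0, 1, c) = 0 := fun c => by
    rw [D2_eq_fderiv hΩ hX'.snd.snd hz (g := fun _ => 0) (fun y hy => by rw [e3 y hy]; simp)]
    simp
  have d2 : ∀ c : ℝ, D2 (fun z => (X z).2.1) z (0, 1, c) (0, 1, c) = 0 := fun c => by
    rw [D2_eq_fderiv hΩ hX'.snd.fst hz (g := fun y => (fun t => deriv τ t / 2) y.1)
      (fun y hy => by rw [e2 y hy]; simp), fderiv_comp_fst (fun t => deriv τ t / 2)
      ((hτ'.differentiableAt_isOpen hJ.1 hz.1).div_const 2)]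
    simp
  rw [invariance_iff (hX'.contDiffAt (hΩ.mem_nhds hz)) hF hH]
  simp only [d1, d2, d3, e1 z hz, e2 z hz, e3 z hz, hX z hz, symField, DeterminingEqs]
  constructor
  · intro h
    have h0 := h 0 0 0
    have h1 := h 1 0 0
    constructor <;> linarith
  · rintro ⟨hA, hB⟩ c m g
    linear_combination -c * hA - hB

theorem IsSol.isLieSymmetry (hJ : IsOpenInterval J) (hI : IsOpenInterval I)
    (hV : IsOpenInterval V) {ε : ℝ} {F H : ℝ → ℝ} (hc : InClass I ε F H)
    (hs : IsSol J I F H τ σ) : IsLieSymmetry (box J I V) ε F H (symField τ σ) := by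
  refine ⟨contDiffOn_symField hJ.1 hs.1 hs.2.1, fun j hj => ?_⟩
  exact (invariance_symField_iff hJ hI hV hs.1 hs.2.1 (fun _ _ => rfl) hj
    (hc.2.1.differentiableAt_isOpen hI.1 hj.2.1) (hc.2.2.differentiableAt_isOpen hI.1 hj.2.1)).2
    (hs.2.2 _ hj.1 _ hj.2.1) j rfl

end Ansatz

/-! ### Necessity: the form of an arbitrary symmetry -/

section Necessity

variable {J I V : Set ℝ}

/-- Second differences in `v` vanish. -/
def AffineInV (J I V : Set ℝ) (f : J0 → ℝ) : Prop :=
  ∀ t ∈ J, ∀ x ∈ I, ∀ v d : ℝ, v ∈ V → v + d ∈ V → v + 2 * d ∈ V →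
    f (t, x, v + 2 * d) - 2 * f (t, x, v + d) + f (t, x, v) = 0

/-- The second difference relation persists at all nearby base points, so it can be differentiated
in any direction. Being affine in v thus passes to η_t, η_x and η_xx without derivatives of order
three or four. -/
theorem AffineInV.fderiv_apply (hJ : IsOpenInterval J) (hI : IsOpenInterval I)
    (hV : IsOpenInterval V) {f : J0 → ℝ} (hf : ContDiffOn ℝ ∞ f (box J I V))
    (h : AffineInV J I V f) (e : J0) : AffineInV J I V fun y => fderiv ℝ f y e := by
  intro t ht x hx v d hv hv1 hv2
  have hΩ := isOpen_box hJ hI hV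
  have z2 := mem_box ht hx hv2
  have z1 := mem_box ht hx hv1
  have z0 := mem_box ht hx hv
  have a2 : ((t, x, v + 2 * d) : J0) = (t, x, v) + (0, 0, 2 * d) := by simp
  have a1 : ((t, x, v + d) : J0) = (t, x, v) + (0, 0, d) := by simp
  have key : (fun y : J0 => f (y + (0, 0, 2 * d)) - 2 * f (y + (0, 0, d)) + f y)
      =ᶠ[𝓝 (t, x, v)] fun _ => 0 := by
    have c2 : ∀ᶠ y : J0 in 𝓝 (t, x, v), y + (0, 0, 2 * d) ∈ box J I V :=
      (continuous_id.add continuous_const).continuousAt.eventually_mem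
        (hΩ.mem_nhds (by simpa using z2))
    have c1 : ∀ᶠ y : J0 in 𝓝 (t, x, v), y + (0, 0, d) ∈ box J I V :=
      (continuous_id.add continuous_const).continuousAt.eventually_mem
        (hΩ.mem_nhds (by simpa using z1))
    filter_upwards [c2, c1, hΩ.mem_nhds z0] with y h2 h1 h0
    have := h y.1 h0.1 y.2.1 h0.2.1 y.2.2 d h0.2.2 h1.2.2 h2.2.2
    have e2 : y + (0, 0, 2 * d) = (y.1, y.2.1, y.2.2 + 2 * d) := by
      obtain ⟨y1, y2, y3⟩ := y; simp
    have e1 : y + (0, 0, d) = (y.1, y.2.1, y.2.2 + d) := by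
      obtain ⟨y1, y2, y3⟩ := y; simp
    rw [e2, e1]
    exact this
  have hd := key.fderiv_eq (𝕜 := ℝ)
  have b2 : HasFDerivAt f (fderiv ℝ f (t, x, v + 2 * d)) ((t, x, v) + (0, 0, 2 * d)) := by
    rw [← a2]; exact (hf.differentiableAt_of_isOpen hΩ z2).hasFDerivAt
  have b1 : HasFDerivAt f (fderiv ℝ f (t, x, v + d)) ((t, x, v) + (0, 0, d)) := by
    rw [← a1]; exact (hf.differentiableAt_of_isOpen hΩ z1).hasFDerivAt
  have b0 := (hf.differentiableAt_of_isOpen hΩ z0).hasFDerivAt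
  have b3 : HasFDerivAt (fun y : J0 => f (y + (0, 0, 2 * d)) - 2 * f (y + (0, 0, d)) + f y) _
      (t, x, v) :=
    ((b2.comp (t, x, v) ((hasFDerivAt_id _).add_const _)).sub
      ((b1.comp (t, x, v) ((hasFDerivAt_id _).add_const _)).const_mul 2)).add b0
  have := b3.fderiv.symm.trans hd
  have := DFunLike.congr_fun this e
  simpa using this

/-- With E = e^d the second difference factors as e^w (E - 1)((E - 1)(mw + k) + 2mdE). The last
factor is affine in w, and its vanishing at two points w kills m, then k. -/
theorem eq_zero_of_exp_mul_affine (hV : IsOpenInterval V) {m k : ℝ}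
    (h : ∀ v d : ℝ, v ∈ V → v + d ∈ V → v + 2 * d ∈ V →
      Real.exp (v + 2 * d) * (m * (v + 2 * d) + k) - 2 * (Real.exp (v + d) * (m * (v + d) + k))
        + Real.exp v * (m * v + k) = 0) : m = 0 ∧ k = 0 := by
  obtain ⟨v, hv⟩ := hV.2.1
  obtain ⟨r, hr, hb⟩ := Metric.isOpen_iff.1 hV.1 v hv
  have mem : ∀ s : ℝ, 0 ≤ s → s < r → v + s ∈ V := fun s hs hs' =>
    hb (by simp [abs_of_nonneg hs, hs'])
  have key : ∀ w d : ℝ, 0 < d → w ∈ V → w + d ∈ V → w + 2 * d ∈ V →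
      (Real.exp d - 1) * (m * w + k) + 2 * m * d * Real.exp d = 0 := by
    intro w d hd h0 h1 h2
    have h3 := h w d h0 h1 h2
    have e2 : Real.exp (w + 2 * d) = Real.exp w * Real.exp d * Real.exp d := by
      rw [← Real.exp_add, ← Real.exp_add]; congr 1; ring
    rw [e2, Real.exp_add] at h3
    have hE : Real.exp d - 1 ≠ 0 := by
      have := Real.add_one_lt_exp hd.ne'
      linarith
    have h4 : Real.exp w * (Real.exp d - 1) *
        ((Real.exp d - 1) * (m * w + k) + 2 * m * d * Real.exp d) = 0 := by
      linear_combination h3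
    exact (mul_eq_zero.1 h4).resolve_left (mul_ne_zero (Real.exp_ne_zero _) hE)
  -- The step r / 4 keeps the three points starting from v + r / 4 inside the ball of radius r.
  have k1 := key v (r / 4) (by positivity) hv (mem _ (by positivity) (by linarith))
    (mem _ (by positivity) (by linarith))
  have k2 := key (v + r / 4) (r / 4) (by positivity) (mem _ (by positivity) (by linarith))
    (by rw [add_assoc]; exact mem _ (by positivity) (by linarith))
    (by rw [add_assoc]; exact mem _ (by positivity) (by linarith))
  have hE : Real.exp (r / 4) - 1 ≠ 0 := by
    have := Real.add_one_lt_exp (x := r / 4) (by positivity)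
    linarith
  have hm : m = 0 := by
    have : (Real.exp (r / 4) - 1) * (r / 4) * m = 0 := by linear_combination k2 - k1
    exact (mul_eq_zero.1 this).resolve_left (mul_ne_zero hE (by positivity))
  subst hm
  refine ⟨rfl, ?_⟩
  have : (Real.exp (r / 4) - 1) * k = 0 := by linear_combination k1
  exact (mul_eq_zero.1 this).resolve_left hE

/-- A function with vanishing second derivative in `v` is affine in `v`. -/
theorem affine_of_D2_vv_eq_zero (hJ : IsOpenInterval J) (hI : IsOpenInterval I)
    (hV : IsOpenInterval V) {f : J0 → ℝ} (hf : ContDiffOn ℝ ∞ f (box J I V))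
    (h : ∀ z ∈ box J I V, D2 f z (0, 0, 1) (0, 0, 1) = 0) {t x : ℝ} (ht : t ∈ J) (hx : x ∈ I) :
    ∃ m n : ℝ, ∀ v ∈ V, f (t, x, v) = m * v + n ∧ fderiv ℝ f (t, x, v) (0, 0, 1) = m := by
  have hΩ := isOpen_box hJ hI hV
  obtain ⟨v₀, hv₀⟩ := hV.2.1
  have hm : ∀ v ∈ V, fderiv ℝ f (t, x, v) (0, 0, 1) = fderiv ℝ f (t, x, v₀) (0, 0, 1) := by
    intro v hv
    refine eq_of_fderiv_v_eq_zero (J := J) (I := I) (f := fun z => fderiv ℝ f z (0, 0, 1)) hV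
      (fun z hz => ?_) (fun z hz => ?_) ht hx hv hv₀
    · exact (hf.contDiffOn_fderiv_apply hΩ _).differentiableAt_of_isOpen hΩ hz
    · rw [fderiv_fderiv_apply (hf.contDiffAt_of_isOpen hΩ hz), h z hz]
  set m := fderiv ℝ f (t, x, v₀) (0, 0, 1) with hm'
  refine ⟨m, f (t, x, v₀) - m * v₀, fun v hv => ⟨?_, hm v hv⟩⟩
  have key : ∀ w ∈ V, HasDerivAt (fun w => f (t, x, w) - m * w) 0 w := by
    intro w hw
    have h1 : HasDerivAt (fun w : ℝ => ((t, x, w) : J0)) (0, 0, 1) w :=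
      (hasDerivAt_const w t).prodMk ((hasDerivAt_const w x).prodMk (hasDerivAt_id w))
    have h2 := (hf.differentiableAt_of_isOpen hΩ (mem_box ht hx hw)).hasFDerivAt.comp_hasDerivAt w h1
    rw [hm w hw] at h2
    have h3 : HasDerivAt (fun w => f (t, x, w) - m * w) _ w :=
      h2.sub ((hasDerivAt_id w).const_mul m)
    exact h3.congr_deriv (by simp)
  have := hV.1.is_const_of_deriv_eq_zero hV.convex.isPreconnected
    (fun w hw => (key w hw).differentiableAt.differentiableWithinAt) (fun w hw => (key w hw).deriv)
    hv hv₀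
  linarith

theorem IsLieSymmetry.exists_isSol (hJ : IsOpenInterval J) (hI : IsOpenInterval I)
    (hV : IsOpenInterval V) {ε : ℝ} {F H : ℝ → ℝ} (hc : InClass I ε F H) {X : J0 → J0}
    (hX : IsLieSymmetry (box J I V) ε F H X) :
    ∃ τ σ, IsSol J I F H τ σ ∧ ∀ z ∈ box J I V, X z = symField τ σ z := by
  have hΩ := isOpen_box hJ hI hV
  obtain ⟨x₀, hx₀⟩ := hI.2.1
  obtain ⟨v₀, hv₀⟩ := hV.2.1
  obtain ⟨hXs, hXi⟩ := hX
  have hε : ε ≠ 0 := by rcases hc.1 with h | h <;> rw [h] <;> norm_num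
  have hXc : ∀ z ∈ box J I V, ContDiffAt ℝ ∞ X z := fun z hz => hXs.contDiffAt (hΩ.mem_nhds hz)
  have hF : ∀ z ∈ box J I V, DifferentiableAt ℝ F z.2.1 := fun z hz =>
    hc.2.1.differentiableAt_isOpen hI.1 hz.2.1
  have hH : ∀ z ∈ box J I V, DifferentiableAt ℝ H z.2.1 := fun z hz =>
    hc.2.2.differentiableAt_isOpen hI.1 hz.2.1
  have inv := fun z hz => (invariance_iff (ε := ε) (hXc z hz) (hF z hz) (hH z hz)).1
    (fun j hj => hXi j (by rw [hj]; exact hz))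
  dsimp only at inv
  set τ₁ : J0 → ℝ := fun z => (X z).1 with hτ₁
  set ξ₁ : J0 → ℝ := fun z => (X z).2.1 with hξ₁
  set η₁ : J0 → ℝ := fun z => (X z).2.2 with hη₁
  have sτ : ContDiffOn ℝ ∞ τ₁ (box J I V) := hXs.fst
  have sξ : ContDiffOn ℝ ∞ ξ₁ (box J I V) := hXs.snd.fst
  have sη : ContDiffOn ℝ ∞ η₁ (box J I V) := hXs.snd.snd
  have τh : ∀ z ∈ box J I V, ∀ c, fderiv ℝ τ₁ z (0, 1, c) = 0 := by
    intro z hz c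
    -- The criterion is affine in v_tx, with coefficient 2 D_xτ.
    linarith [inv z hz c 0 0, inv z hz c 1 0]
  have τx : ∀ z ∈ box J I V, fderiv ℝ τ₁ z (0, 1, 0) = 0 := fun z hz => τh z hz 0
  have τv : ∀ z ∈ box J I V, fderiv ℝ τ₁ z (0, 0, 1) = 0 := fun z hz => by
    have := τh z hz 1
    rw [fderiv_apply_triple, τx z hz] at this
    linarith
  set τ : ℝ → ℝ := fun t => τ₁ (t, x₀, v₀) with hτ
  have cτ : ContDiffOn ℝ ∞ τ J := contDiffOn_slice sτ hx₀ hv₀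
  have eτ : ∀ z ∈ box J I V, τ₁ z = τ z.1 := fun z hz => eq_of_fderiv_xv_eq_zero hI hV
    (fun y hy => sτ.differentiableAt_of_isOpen hΩ hy) τx τv hx₀ hv₀ hz
  have dτ : ∀ z ∈ box J I V, ∀ a, fderiv ℝ τ₁ z a = a.1 * deriv τ z.1 := by
    intro z hz a
    have : τ₁ =ᶠ[𝓝 z] fun z => τ z.1 := by
      filter_upwards [hΩ.mem_nhds hz] with w hw using eτ w hw
    rw [this.fderiv_eq, fderiv_comp_fst _ (cτ.differentiableAt_isOpen hJ.1 hz.1)]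
  have ddτ : ∀ z ∈ box J I V, ∀ c, D2 τ₁ z (0, 1, c) (0, 1, c) = 0 := by
    intro z hz c
    rw [D2_eq_fderiv hΩ sτ hz (g := fun _ => 0) (fun y hy => τh y hy c)]
    simp
  -- This is the coefficient of v_xx: once τ = τ(t), the contributions of η_v and ξ_v cancel and 2
  -- D_xξ = τ' remains. Since it holds for every v_x, it gives both ξ_x and ξ_v.
  have ξh : ∀ z ∈ box J I V, ∀ c, fderiv ℝ ξ₁ z (0, 1, c) = deriv τ z.1 / 2 := by
    intro z hz c
    have h0 := inv z hz c 0 0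
    have h1 := inv z hz c 0 1
    rw [fderiv_apply_triple η₁, fderiv_apply_triple ξ₁ z 1] at h0 h1
    simp only [dτ z hz, ddτ z hz] at h0 h1
    linarith
  have ξx : ∀ z ∈ box J I V, fderiv ℝ ξ₁ z (0, 1, 0) = deriv τ z.1 / 2 := fun z hz => ξh z hz 0
  have ξv : ∀ z ∈ box J I V, fderiv ℝ ξ₁ z (0, 0, 1) = 0 := fun z hz => by
    have := ξh z hz 1
    rw [fderiv_apply_triple, ξx z hz] at this
    linarith
  have cτ' := cτ.deriv_isOpen hJ.1
  have ddξ : ∀ z ∈ box J I V, ∀ c, D2 ξ₁ z (0, 1, c) (0, 1, c) = 0 := by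
    intro z hz c
    rw [D2_eq_fderiv hΩ sξ hz (g := fun y => (fun t => deriv τ t / 2) y.1)
      (fun y hy => ξh y hy c), fderiv_comp_fst (fun t => deriv τ t / 2)
      ((cτ'.differentiableAt_isOpen hJ.1 hz.1).div_const 2)]
    simp
  set σ : ℝ → ℝ := fun t => ξ₁ (t, x₀, v₀) - deriv τ t / 2 * x₀ with hσ
  have cσ : ContDiffOn ℝ ∞ σ J :=
    (contDiffOn_slice sξ hx₀ hv₀).sub ((cτ'.div_const 2).mul contDiffOn_const)
  have eξ : ∀ z ∈ box J I V, ξ₁ z = deriv τ z.1 / 2 * z.2.1 + σ z.1 := by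
    have hd : ∀ z ∈ box J I V, ∀ a, HasFDerivAt (fun z : J0 => ξ₁ z - deriv τ z.1 / 2 * z.2.1)
        (fderiv ℝ (fun z : J0 => ξ₁ z - deriv τ z.1 / 2 * z.2.1) z) z ∧
        fderiv ℝ (fun z : J0 => ξ₁ z - deriv τ z.1 / 2 * z.2.1) z a
        = fderiv ℝ ξ₁ z a - a.1 * (deriv (deriv τ) z.1 / 2 * z.2.1)
          - a.2.1 * (deriv τ z.1 / 2) := by
      intro z hz a
      have i1 : HasFDerivAt (fun y : J0 => y) (ContinuousLinearMap.id ℝ J0) z := hasFDerivAt_id z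
      have h1 := (cτ'.differentiableAt_isOpen hJ.1 hz.1).hasDerivAt.div_const 2
      have h3 : HasFDerivAt (fun z : J0 => ξ₁ z - deriv τ z.1 / 2 * z.2.1) _ z :=
        (sξ.differentiableAt_of_isOpen hΩ hz).hasFDerivAt.sub
          ((h1.comp_hasFDerivAt z i1.fst).mul i1.snd.fst)
      refine ⟨h3.differentiableAt.hasFDerivAt, ?_⟩
      rw [h3.fderiv]
      simp
      ring
    intro z hz
    have := eq_of_fderiv_xv_eq_zero (f := fun z : J0 => ξ₁ z - deriv τ z.1 / 2 * z.2.1) hI hV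
      (fun y hy => (hd y hy 0).1.differentiableAt)
      (fun y hy => by rw [(hd y hy _).2, ξx y hy]; simp)
      (fun y hy => by rw [(hd y hy _).2, ξv y hy]; simp) hx₀ hv₀ hz
    simp only [hσ]
    linarith
  have ηeq : ∀ z ∈ box J I V, ∀ c, fderiv ℝ η₁ z (1, 0, 0)
      + (F z.2.1 * c + ε * Real.exp z.2.2 + H z.2.1) * (fderiv ℝ η₁ z (0, 0, 1) - deriv τ z.1)
      - c * fderiv ℝ ξ₁ z (1, 0, 0)
      - (D2 η₁ z (0, 1, 0) (0, 1, 0)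
          + c * (D2 η₁ z (0, 1, 0) (0, 0, 1) + D2 η₁ z (0, 0, 1) (0, 1, 0))
          + c ^ 2 * D2 η₁ z (0, 0, 1) (0, 0, 1))
      - F z.2.1 * (fderiv ℝ η₁ z (0, 1, 0) + c * fderiv ℝ η₁ z (0, 0, 1)
          - c * (deriv τ z.1 / 2))
      - deriv F z.2.1 * ξ₁ z * c - ε * Real.exp z.2.2 * η₁ z - deriv H z.2.1 * ξ₁ z = 0 := by
    intro z hz c
    have h0 := inv z hz c 0 0
    rw [fderiv_apply_triple η₁ z 1, fderiv_apply_triple η₁ z 0 1 c, fderiv_apply_triple ξ₁ z 1,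
      D2_horizontal η₁] at h0
    simp only [dτ z hz, ddτ z hz, ξh z hz, ξv z hz, ddξ z hz] at h0
    linear_combination h0
  -- The criterion is now quadratic in v_x; its values at 0, 1, -1 isolate the leading coefficient.
  have ηvv : ∀ z ∈ box J I V, D2 η₁ z (0, 0, 1) (0, 0, 1) = 0 := by
    intro z hz
    linarith [ηeq z hz 0, ηeq z hz 1, ηeq z hz (-1)]
  have haff := fun t ht x hx =>
    affine_of_D2_vv_eq_zero hJ hI hV sη ηvv (t := t) (x := x) ht hx
  have A0 : AffineInV J I V η₁ := by
    intro t ht x hx v d h0 h1 h2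
    obtain ⟨m, n, h⟩ := haff t ht x hx
    rw [(h _ h0).1, (h _ h1).1, (h _ h2).1]
    ring
  have At := A0.fderiv_apply hJ hI hV sη (1, 0, 0)
  have Ax := A0.fderiv_apply hJ hI hV sη (0, 1, 0)
  have Axx := Ax.fderiv_apply hJ hI hV (sη.contDiffOn_fderiv_apply hΩ _) (0, 1, 0)
  have eη : ∀ z ∈ box J I V, η₁ z = -deriv τ z.1 := by
    rintro ⟨t, x, v⟩ ⟨ht, hx, hv⟩
    obtain ⟨m, n, hmn⟩ := haff t ht x hx
    -- At v_x = 0 every term except ε e^v (η_v - τ' - η) is affine in v. With η = mv + n, second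
    -- differences therefore annihilate e^v (mv + n - m + τ'), whence m = 0 and n = -τ'.
    have key := eq_zero_of_exp_mul_affine hV (m := m) (k := n - m + deriv τ t) (by
      intro w d h0 h1 h2
      have q0 := ηeq _ (mem_box ht hx h0) 0
      have q1 := ηeq _ (mem_box ht hx h1) 0
      have q2 := ηeq _ (mem_box ht hx h2) 0
      have a1 := At t ht x hx w d h0 h1 h2
      have a2 := Ax t ht x hx w d h0 h1 h2
      have a3 := Axx t ht x hx w d h0 h1 h2
      simp only [fderiv_fderiv_apply (sη.contDiffAt_of_isOpen hΩ (mem_box ht hx h0)),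
        fderiv_fderiv_apply (sη.contDiffAt_of_isOpen hΩ (mem_box ht hx h1)),
        fderiv_fderiv_apply (sη.contDiffAt_of_isOpen hΩ (mem_box ht hx h2))] at a1 a2 a3
      rw [(hmn _ h0).1, (hmn _ h0).2, eξ _ (mem_box ht hx h0)] at q0
      rw [(hmn _ h1).1, (hmn _ h1).2, eξ _ (mem_box ht hx h1)] at q1
      rw [(hmn _ h2).1, (hmn _ h2).2, eξ _ (mem_box ht hx h2)] at q2
      dsimp only at q0 q1 q2
      apply mul_left_cancel₀ hε
      linear_combination -q0 + 2 * q1 - q2 + a1 - F x * a2 - a3)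
    dsimp only
    rw [(hmn v hv).1]
    obtain ⟨rfl, hk⟩ := key
    linarith
  have hXeq : ∀ z ∈ box J I V, X z = symField τ σ z := fun z hz =>
    Prod.ext (eτ z hz) (Prod.ext (eξ z hz) (eη z hz))
  refine ⟨τ, σ, ⟨cτ, cσ, fun t ht x hx => ?_⟩, hXeq⟩
  have hz := mem_box ht hx hv₀
  exact (invariance_symField_iff hJ hI hV cτ cσ hXeq hz (hF _ hz) (hH _ hz)).1
    (fun j hj => hXi j (by rw [hj]; exact hz))

/-- The maximal Lie invariance algebra in terms of the determining equations. -/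
theorem mem_maxAlg_iff (hJ : IsOpenInterval J) (hI : IsOpenInterval I)
    (hV : IsOpenInterval V) {ε : ℝ} {F H : ℝ → ℝ} (hc : InClass I ε F H)
    {Y : box J I V → J0} :
    Y ∈ maxAlg (box J I V) ε F H ↔
      ∃ τ σ, IsSol J I F H τ σ ∧ Y = (box J I V).domRestrict (symField τ σ) := by
  constructor
  · rintro ⟨X, hX, rfl⟩
    obtain ⟨τ, σ, hs, h⟩ := hX.exists_isSol hJ hI hV hc
    exact ⟨τ, σ, hs, funext fun z => h z z.2⟩
  · rintro ⟨τ, σ, hs, rfl⟩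
    exact ⟨_, hs.isLieSymmetry hJ hI hV hc, rfl⟩

end Necessity

/-! ### A common normal form of the six cases -/

/-- The function `A / x + M x + L`. -/
noncomputable def normalF (A M L : ℝ) (x : ℝ) : ℝ := A * x⁻¹ + M * x + L

/-- The function `B / x ^ 2 + K`. -/
noncomputable def normalH (B K : ℝ) (x : ℝ) : ℝ := B * (x ^ 2)⁻¹ + K

theorem hasDerivAt_normalF {A M L x : ℝ} (h : x = 0 → A = 0) :
    HasDerivAt (normalF A M L) (-A * (x ^ 2)⁻¹ + M) x := by
  have h2 : HasDerivAt (fun x : ℝ => M * x) M x := by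
    simpa using (hasDerivAt_id x).const_mul M
  rcases eq_or_ne x 0 with hx | hx
  · have : normalF A M L = fun x => M * x + L := by funext y; simp [normalF, h hx]
    rw [this, h hx]
    simpa using h2.add_const L
  · have h1 := (hasDerivAt_inv hx).const_mul A
    have h3 : HasDerivAt (normalF A M L) _ x := (h1.add h2).add_const L
    exact h3.congr_deriv (by ring)

theorem hasDerivAt_normalH {B K x : ℝ} (h : x = 0 → B = 0) :
    HasDerivAt (normalH B K) (-2 * B * (x ^ 3)⁻¹) x := by
  rcases eq_or_ne x 0 with hx | hx
  · have : normalH B K = fun _ => K := by funext y; simp [normalH, h hx]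
    rw [this, h hx]
    simpa using hasDerivAt_const x K
  · have h1 : HasDerivAt (fun x : ℝ => (x ^ 2)⁻¹) _ x := (hasDerivAt_pow 2 x).fun_inv (pow_ne_zero 2 hx)
    have h3 : HasDerivAt (normalH B K) _ x := (h1.const_mul B).add_const K
    refine h3.congr_deriv ?_
    field_simp
    simp
    ring

/-- Multiplied by x, the function tends to A along x ≠ 0, but to 0 by continuity. The limit has to
be punctured, because the convention 0⁻¹ = 0 hides the pole at the point itself. -/
theorem eq_zero_of_continuousAt_normalF {A M L : ℝ} (h : ContinuousAt (normalF A M L) 0) :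
    A = 0 := by
  have h1 : Tendsto (fun x => x * normalF A M L x) (𝓝[≠] 0) (𝓝 (0 * normalF A M L 0)) :=
    ((continuousAt_id.mul h).tendsto).mono_left nhdsWithin_le_nhds
  have h2 : Tendsto (fun x : ℝ => A + M * x ^ 2 + L * x) (𝓝[≠] 0)
      (𝓝 (A + M * 0 ^ 2 + L * 0)) :=
    (Continuous.tendsto (by fun_prop) 0).mono_left nhdsWithin_le_nhds
  have h3 : (fun x => x * normalF A M L x) =ᶠ[𝓝[≠] 0] fun x : ℝ => A + M * x ^ 2 + L * x := by
    filter_upwards [self_mem_nhdsWithin] with x hx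
    have : x ≠ 0 := hx
    simp only [normalF]
    field_simp
  have := tendsto_nhds_unique h1 (h2.congr' h3.symm)
  simpa using this.symm

theorem eq_zero_of_continuousAt_normalH {B K : ℝ} (h : ContinuousAt (normalH B K) 0) :
    B = 0 := by
  have h1 : Tendsto (fun x => x ^ 2 * normalH B K x) (𝓝[≠] 0) (𝓝 (0 ^ 2 * normalH B K 0)) :=
    (((continuousAt_id.pow 2).mul h).tendsto).mono_left nhdsWithin_le_nhds
  have h2 : Tendsto (fun x : ℝ => B + K * x ^ 2) (𝓝[≠] 0) (𝓝 (B + K * 0 ^ 2)) :=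
    (Continuous.tendsto (by fun_prop) 0).mono_left nhdsWithin_le_nhds
  have h3 : (fun x => x ^ 2 * normalH B K x) =ᶠ[𝓝[≠] 0] fun x : ℝ => B + K * x ^ 2 := by
    filter_upwards [self_mem_nhdsWithin] with x hx
    have : x ≠ 0 := hx
    simp only [normalH]
    field_simp
  have := tendsto_nhds_unique h1 (h2.congr' h3.symm)
  simpa using this.symm

theorem IsOpenInterval.image_affine {I : Set ℝ} (hI : IsOpenInterval I) {δ : ℝ} (hδ : δ ≠ 0)
    (d : ℝ) : IsOpenInterval ((fun x => δ * x + d) '' I) :=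
  ⟨((Homeomorph.mulLeft₀ δ hδ).trans (Homeomorph.addRight d)).isOpenMap I hI.1, hI.2.1.image _,
    (hI.convex.isPreconnected.image _ (by fun_prop)).ordConnected⟩

/-- A polynomial of degree at most four that vanishes at all but finitely many points of an open
interval is zero. -/
theorem coeffs_eq_zero {I : Set ℝ} (hI : IsOpenInterval I) {S : Set ℝ} (hS : S.Finite)
    {a b c d e : ℝ}
    (h : ∀ x ∈ I, x ∉ S → a + b * x + c * x ^ 2 + d * x ^ 3 + e * x ^ 4 = 0) :
    a = 0 ∧ b = 0 ∧ c = 0 ∧ d = 0 ∧ e = 0 := by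
  obtain ⟨x, hx⟩ := hI.2.1
  have hinf : (I \ S).Infinite := (infinite_of_mem_nhds x (hI.1.mem_nhds hx)).sdiff hS
  open Polynomial in
  set P : ℝ[X] := C a + C b * X + C c * X ^ 2 + C d * X ^ 3 + C e * X ^ 4 with hP
  have h0 : P = 0 := Polynomial.eq_zero_of_infinite_isRoot P
    (hinf.mono fun y hy => by simpa [P] using h y hy.1 hy.2)
  have hc : ∀ n, P.coeff n = 0 := fun n => by rw [h0]; simp
  have c0 := hc 0
  have c1 := hc 1
  have c2 := hc 2
  have c3 := hc 3
  have c4 := hc 4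
  simp [hP, Polynomial.coeff_X, Polynomial.coeff_C] at c0 c1 c2 c3 c4
  exact ⟨c0, c1, c2, c3, c4⟩

/-- The determining equations for the normal form, split with respect to `x`. -/
theorem split_determiningEqs {I : Set ℝ} (hI : IsOpenInterval I) {A M L B K s p p' q q' : ℝ}
    (h1 : ∀ x ∈ I, x + s ≠ 0 → p' * (x + s) + q' + p * normalF A M L (x + s)
      + (p * (x + s) + q) * (-A * ((x + s) ^ 2)⁻¹ + M) = 0)
    (h2 : ∀ x ∈ I, x + s ≠ 0 → p' + p * normalH B K (x + s)
      + (p * (x + s) + q) * (-B * ((x + s) ^ 3)⁻¹) = 0) :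
    p' + 2 * M * p = 0 ∧ q' + M * q + p * L = 0 ∧ q * A = 0 ∧ p' + p * K = 0 ∧ q * B = 0 := by
  have hI' : IsOpenInterval ((fun x => x + s) '' I) := by
    simpa using hI.image_affine one_ne_zero s
  -- In y = x + s, multiplication by y² makes the first equation a cubic in which the two terms ±pAy
  -- cancel; y³ does the same for the second with ±pBy.
  have g1 := coeffs_eq_zero hI' (finite_singleton (0 : ℝ)) (a := -q * A) (b := 0)
    (c := q' + M * q + p * L) (d := p' + 2 * M * p) (e := 0) (by
      rintro _ ⟨x, hx, rfl⟩ hy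
      have hy' : x + s ≠ 0 := hy
      have := h1 x hx hy'
      simp only [normalF] at this
      field_simp at this
      linear_combination this)
  have g2 := coeffs_eq_zero hI' (finite_singleton (0 : ℝ)) (a := -q * B) (b := 0)
    (c := 0) (d := p' + p * K) (e := 0) (by
      rintro _ ⟨x, hx, rfl⟩ hy
      have hy' : x + s ≠ 0 := hy
      have := h2 x hx hy'
      simp only [normalH] at this
      field_simp at this
      linear_combination this)
  obtain ⟨a1, -, a3, a4, -⟩ := g1
  obtain ⟨b1, -, -, b4, -⟩ := g2
  exact ⟨a4, a3, by linarith, b4, by linarith⟩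

/-- The determining equations for the normal form. -/
def SplitEqs (A M L B K : ℝ) (τ σ : ℝ → ℝ) (t : ℝ) : Prop :=
  deriv (deriv τ) t + 2 * M * deriv τ t = 0 ∧ deriv σ t + M * σ t + deriv τ t / 2 * L = 0 ∧
    σ t * A = 0 ∧ deriv (deriv τ) t + deriv τ t * K = 0 ∧ σ t * B = 0

theorem isSol_normal_iff {J I : Set ℝ} (hI : IsOpenInterval I) {A M L B K : ℝ}
    (hreg : 0 ∈ I → A = 0 ∧ B = 0) {τ σ : ℝ → ℝ} :
    IsSol J I (normalF A M L) (normalH B K) τ σ ↔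
      ContDiffOn ℝ ∞ τ J ∧ ContDiffOn ℝ ∞ σ J ∧ ∀ t ∈ J, SplitEqs A M L B K τ σ t := by
  have dF : ∀ x ∈ I, deriv (normalF A M L) x = -A * (x ^ 2)⁻¹ + M := fun x hx =>
    (hasDerivAt_normalF fun h => (hreg (h ▸ hx)).1).deriv
  have dH : ∀ x ∈ I, deriv (normalH B K) x = -2 * B * (x ^ 3)⁻¹ := fun x hx =>
    (hasDerivAt_normalH fun h => (hreg (h ▸ hx)).2).deriv
  refine and_congr_right fun hτ => and_congr_right fun hσ => forall₂_congr fun t ht => ?_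
  constructor
  · intro h
    have := split_determiningEqs hI (A := A) (M := M) (L := L) (B := B) (K := K) (s := 0)
      (p := deriv τ t / 2) (p' := deriv (deriv τ) t / 2) (q := σ t) (q' := deriv σ t)
      (fun x hx _ => by
        have := (h x hx).1
        rw [dF x hx] at this
        simpa using this)
      (fun x hx _ => by
        have := (h x hx).2
        rw [dH x hx] at this
        rw [add_zero]
        linear_combination this / 2)
    obtain ⟨h1, h2, h3, h4, h5⟩ := this
    exact ⟨by linarith, by linarith, h3, by linarith, h5⟩
  · rintro ⟨h1, h2, h3, h4, h5⟩ x hx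
    rw [DeterminingEqs, dF x hx, dH x hx]
    simp only [normalF, normalH]
    -- At the origin the singular coefficients are zero by `hreg`; elsewhere denominators can be
    -- cleared.
    by_cases h0 : x = 0
    · obtain ⟨rfl, rfl⟩ := hreg (h0 ▸ hx)
      constructor
      · linear_combination h2 + x * h1 / 2
      · linear_combination h4
    · constructor
      · field_simp
        linear_combination 2 * x ^ 2 * h2 + x ^ 3 * h1 - 2 * h3
      · field_simp
        linear_combination x ^ 3 * h4 - 2 * h5

/-! ### Integration of the split equations in t -/

theorem exists_eq_exp {J : Set ℝ} (hJ : IsOpenInterval J) {f : ℝ → ℝ} {k : ℝ}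
    (hf : ∀ t ∈ J, DifferentiableAt ℝ f t) (h : ∀ t ∈ J, deriv f t + k * f t = 0) :
    ∃ c, ∀ t ∈ J, f t = c * Real.exp (-k * t) := by
  obtain ⟨t₀, ht₀⟩ := hJ.2.1
  have key : ∀ w ∈ J, HasDerivAt (fun w => f w * Real.exp (k * w)) 0 w := by
    intro w hw
    have h1 : HasDerivAt (fun w : ℝ => k * w) k w := by simpa using (hasDerivAt_id w).const_mul k
    refine ((hf w hw).hasDerivAt.mul h1.exp).congr_deriv ?_
    linear_combination Real.exp (k * w) * h w hw
  refine ⟨f t₀ * Real.exp (k * t₀), fun t ht => ?_⟩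
  have := hJ.1.is_const_of_deriv_eq_zero hJ.convex.isPreconnected
    (fun w hw => (key w hw).differentiableAt.differentiableWithinAt) (fun w hw => (key w hw).deriv)
    ht ht₀
  rw [← this, mul_assoc, ← Real.exp_add]
  simp

theorem exists_eq_add_const {J : Set ℝ} (hJ : IsOpenInterval J) {f g : ℝ → ℝ}
    (hf : ∀ t ∈ J, DifferentiableAt ℝ f t) (hg : ∀ t ∈ J, HasDerivAt g (deriv f t) t) :
    ∃ c, ∀ t ∈ J, f t = c + g t := by
  obtain ⟨t₀, ht₀⟩ := hJ.2.1
  refine ⟨f t₀ - g t₀, fun t ht => ?_⟩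
  have := hJ.1.is_const_of_deriv_eq_zero (f := fun t => f t - g t) hJ.convex.isPreconnected
    (fun w hw => ((hf w hw).sub (hg w hw).differentiableAt).differentiableWithinAt)
    (fun w hw => ((hf w hw).hasDerivAt.sub (hg w hw)).deriv.trans (sub_self _)) ht ht₀
  linarith

theorem hasDerivAt_exp_mul (c k t : ℝ) :
    HasDerivAt (fun t => c * Real.exp (k * t)) (c * k * Real.exp (k * t)) t := by
  have h1 : HasDerivAt (fun w : ℝ => k * w) k t := by simpa using (hasDerivAt_id t).const_mul k
  exact (h1.exp.const_mul c).congr_deriv (by ring)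

/-- Only τ'' + 2Mτ' = 0 and σ' + Mσ = 0 are integrated; the other split equations later become
constraints on the constants. Dividing by -2M makes c₂ the coefficient of `TableRow.vecExpS`. The
derivative of τ is recorded because it enters `symField`. -/
theorem SplitEqs.exists_exp {J : Set ℝ} (hJ : IsOpenInterval J) {A M B K : ℝ} (hM : M ≠ 0)
    {τ σ : ℝ → ℝ} (hτ : ContDiffOn ℝ ∞ τ J) (hσ : ContDiffOn ℝ ∞ σ J)
    (h : ∀ t ∈ J, SplitEqs A M 0 B K τ σ t) :
    ∃ c₀ c₁ c₂ : ℝ, ∀ t ∈ J, τ t = c₀ + c₂ * Real.exp (-2 * M * t) ∧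
      deriv τ t = c₂ * (-2 * M) * Real.exp (-2 * M * t) ∧ σ t = c₁ * Real.exp (-M * t) := by
  obtain ⟨c₁, h1⟩ := exists_eq_exp hJ (k := M) (fun t ht => hσ.differentiableAt_isOpen hJ.1 ht)
    (fun t ht => by linear_combination (h t ht).2.1)
  obtain ⟨c, h2⟩ := exists_eq_exp hJ (k := 2 * M)
    (fun t ht => (hτ.deriv_isOpen hJ.1).differentiableAt_isOpen hJ.1 ht) (fun t ht => (h t ht).1)
  have hc : ∀ t ∈ J, deriv τ t = c / (-2 * M) * (-2 * M) * Real.exp (-2 * M * t) := by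
    intro t ht
    rw [h2 t ht, div_mul_cancel₀ _ (by simpa using hM)]
    ring_nf
  obtain ⟨c₀, h3⟩ := exists_eq_add_const hJ (fun t ht => hτ.differentiableAt_isOpen hJ.1 ht)
    (g := fun t => c / (-2 * M) * Real.exp (-2 * M * t))
    (fun t ht => (hc t ht) ▸ hasDerivAt_exp_mul _ _ t)
  exact ⟨c₀, c₁, c / (-2 * M), fun t ht => ⟨h3 t ht, hc t ht, h1 t ht⟩⟩

/-- Here τ'' = 0 and σ' = -Lτ'/2. The factor 2 in c₂ * (2 * t) makes c₂ the coefficient of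
`TableRow.vecS`. -/
theorem SplitEqs.exists_poly {J : Set ℝ} (hJ : IsOpenInterval J) {A L B K : ℝ}
    {τ σ : ℝ → ℝ} (hτ : ContDiffOn ℝ ∞ τ J) (hσ : ContDiffOn ℝ ∞ σ J)
    (h : ∀ t ∈ J, SplitEqs A 0 L B K τ σ t) :
    ∃ c₀ c₁ c₂ : ℝ, ∀ t ∈ J, τ t = c₀ + c₂ * (2 * t) ∧ deriv τ t = c₂ * 2 ∧
      σ t = c₁ - c₂ * L * t := by
  obtain ⟨c, h2⟩ := exists_eq_exp hJ (k := 0)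
    (fun t ht => (hτ.deriv_isOpen hJ.1).differentiableAt_isOpen hJ.1 ht)
    (fun t ht => by linear_combination (h t ht).1)
  have hc : ∀ t ∈ J, deriv τ t = c / 2 * 2 := fun t ht => by rw [h2 t ht]; simp
  have hl : ∀ k t : ℝ, HasDerivAt (fun t : ℝ => k * t) k t := fun k t => by
    simpa using (hasDerivAt_id t).const_mul k
  obtain ⟨c₀, h3⟩ := exists_eq_add_const hJ (fun t ht => hτ.differentiableAt_isOpen hJ.1 ht)
    (g := fun t => c / 2 * 2 * t) (fun t ht => (hc t ht) ▸ hl _ t)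
  obtain ⟨c₁, h4⟩ := exists_eq_add_const hJ (fun t ht => hσ.differentiableAt_isOpen hJ.1 ht)
    (g := fun t => -(c / 2 * L) * t)
    (fun t ht => by
      have : deriv σ t = -(c / 2 * L) := by
        have := (h t ht).2.1
        rw [hc t ht] at this
        linear_combination this
      rw [this]
      exact hl _ t)
  exact ⟨c₀, c₁, c / 2, fun t ht =>
    ⟨by rw [h3 t ht]; ring, hc t ht, by rw [h4 t ht]; ring⟩⟩

theorem splitEqs_exp (M c₀ c₁ c₂ t : ℝ) {A B K : ℝ} (h1 : c₁ * A = 0) (h2 : c₁ * B = 0)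
    (h3 : c₂ * (K - 2 * M) = 0) :
    SplitEqs A M 0 B K (fun t => c₀ + c₂ * Real.exp (-2 * M * t))
      (fun t => c₁ * Real.exp (-M * t)) t := by
  have d1 : deriv (fun t => c₀ + c₂ * Real.exp (-2 * M * t)) =
      fun t => c₂ * (-2 * M) * Real.exp (-2 * M * t) :=
    funext fun t => ((hasDerivAt_exp_mul c₂ (-2 * M) t).const_add c₀).deriv
  have d2 : deriv (fun t => c₁ * Real.exp (-M * t)) t = c₁ * -M * Real.exp (-M * t) :=
    (hasDerivAt_exp_mul c₁ (-M) t).deriv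
  refine ⟨?_, ?_, ?_, ?_, ?_⟩
  · rw [d1, (hasDerivAt_exp_mul _ _ t).deriv]; ring
  · rw [d2]; ring
  · linear_combination Real.exp (-M * t) * h1
  · rw [d1, (hasDerivAt_exp_mul _ _ t).deriv]
    linear_combination (-2 * M) * Real.exp (-2 * M * t) * h3
  · linear_combination Real.exp (-M * t) * h2

theorem splitEqs_poly (L c₀ c₁ c₂ t : ℝ) {A B K : ℝ} (h1 : (c₁ - c₂ * L * t) * A = 0)
    (h2 : (c₁ - c₂ * L * t) * B = 0) (h3 : c₂ * K = 0) :
    SplitEqs A 0 L B K (fun t => c₀ + c₂ * (2 * t)) (fun t => c₁ - c₂ * L * t) t := by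
  have d1 : deriv (fun t : ℝ => c₀ + c₂ * (2 * t)) = fun _ => c₂ * 2 :=
    funext fun t => ((((hasDerivAt_id t).const_mul 2).const_mul c₂).const_add c₀).deriv.trans
      (by simp)
  have d2 : deriv (fun t => c₁ - c₂ * L * t) t = -(c₂ * L) :=
    (((hasDerivAt_id t).const_mul (c₂ * L)).const_sub c₁).deriv.trans (by simp)
  refine ⟨?_, ?_, h1, ?_, h2⟩
  · rw [d1]; simp
  · rw [d1, d2]; ring
  · rw [d1, deriv_const]; linear_combination 2 * h3

theorem contDiff_exp_family (k c₀ c : ℝ) :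
    ContDiff ℝ ∞ fun t : ℝ => c₀ + c * Real.exp (k * t) :=
  contDiff_const.add (contDiff_const.mul (contDiff_const.mul contDiff_id).exp)

/-! ### The table: normal forms and bases -/

namespace TableRow

/-- The coefficient of `1 / x` in `F`. -/
def coefA : TableRow → ℝ
  | case1 α _ _ => α
  | case2 α _ => α
  | _ => 0

/-- The coefficient of `1 / x ^ 2` in `H`. -/
def coefB : TableRow → ℝ
  | case1 _ β _ => β
  | case2 _ β => β
  | _ => 0

/-- The coefficient of `x` in `F`. -/
def coefM : TableRow → ℝ
  | case1 _ _ μ => μ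
  | case3 μ _ => μ
  | case5 μ => μ
  | _ => 0

/-- The constant term of `F`. -/
def coefL : TableRow → ℝ
  | case4 l _ => l
  | case6 l => l
  | _ => 0

/-- The constant term of `H`. -/
def coefK : TableRow → ℝ
  | case1 _ _ μ => 2 * μ
  | case3 _ γ => γ
  | case4 _ γ => γ
  | case5 μ => 2 * μ
  | _ => 0

theorem F_eq_normalF (r : TableRow) : r.F = normalF r.coefA r.coefM r.coefL := by
  cases r <;> funext x <;> simp [F, normalF, coefA, coefM, coefL]

theorem H_eq_normalH (r : TableRow) : r.H = normalH r.coefB r.coefK := by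
  cases r <;> funext x <;> simp [H, normalH, coefB, coefK]

/-- Smoothness on I already keeps the pole out of I, so the table needs no separate condition 0 ∉ I.
-/
theorem regular_of_inClass {I : Set ℝ} (hI : IsOpenInterval I) {r : TableRow} {ε : ℝ}
    (hc : InClass I ε r.F r.H) : 0 ∈ I → r.coefA = 0 ∧ r.coefB = 0 := by
  intro h0
  have hF := (hc.2.1.differentiableAt_isOpen hI.1 h0).continuousAt
  have hH := (hc.2.2.differentiableAt_isOpen hI.1 h0).continuousAt
  rw [F_eq_normalF] at hF
  rw [H_eq_normalH] at hH
  exact ⟨eq_zero_of_continuousAt_normalF hF, eq_zero_of_continuousAt_normalH hH⟩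

theorem isSol_iff {J I : Set ℝ} (hI : IsOpenInterval I) {r : TableRow} {ε : ℝ}
    (hc : InClass I ε r.F r.H) {τ σ : ℝ → ℝ} :
    IsSol J I r.F r.H τ σ ↔ ContDiffOn ℝ ∞ τ J ∧ ContDiffOn ℝ ∞ σ J ∧
      ∀ t ∈ J, SplitEqs r.coefA r.coefM r.coefL r.coefB r.coefK τ σ t := by
  rw [F_eq_normalF, H_eq_normalH]
  exact isSol_normal_iff hI (regular_of_inClass hI hc)

end TableRow

/-! ### Spans and independence for short lists of vector fields -/

theorem mem_spanOn_iff {Ω : Set J0} {L : List (J0 → J0)} {Y : Ω → J0} :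
    Y ∈ spanOn Ω L ↔ ∃ c : Fin L.length → ℝ, ∀ z : Ω, Y z = ∑ i, c i • L.get i z := by
  unfold spanOn
  rw [SetLike.mem_coe, Submodule.mem_span_range_iff_exists_fun]
  refine exists_congr fun c => ?_
  rw [funext_iff]
  refine forall_congr' fun z => ?_
  rw [eq_comm, Finset.sum_apply]
  rfl

theorem mem_spanOn_one {Ω : Set J0} {a : J0 → J0} {Y : Ω → J0} :
    Y ∈ spanOn Ω [a] ↔ ∃ c : ℝ, ∀ z : Ω, Y z = c • a z := by
  rw [mem_spanOn_iff]
  constructor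
  · rintro ⟨c, h⟩
    exact ⟨c 0, fun z => by rw [h z]; exact Fin.sum_univ_one _⟩
  · rintro ⟨c, h⟩
    exact ⟨![c], fun z => by rw [h z]; symm; exact Fin.sum_univ_one _⟩

theorem mem_spanOn_two {Ω : Set J0} {a b : J0 → J0} {Y : Ω → J0} :
    Y ∈ spanOn Ω [a, b] ↔ ∃ c d : ℝ, ∀ z : Ω, Y z = c • a z + d • b z := by
  rw [mem_spanOn_iff]
  constructor
  · rintro ⟨c, h⟩
    exact ⟨c 0, c 1, fun z => by rw [h z]; exact Fin.sum_univ_two _⟩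
  · rintro ⟨c, d, h⟩
    exact ⟨![c, d], fun z => by rw [h z]; symm; exact Fin.sum_univ_two _⟩

theorem mem_spanOn_three {Ω : Set J0} {a b e : J0 → J0} {Y : Ω → J0} :
    Y ∈ spanOn Ω [a, b, e] ↔ ∃ c d f : ℝ, ∀ z : Ω, Y z = c • a z + d • b z + f • e z := by
  rw [mem_spanOn_iff]
  constructor
  · rintro ⟨c, h⟩
    exact ⟨c 0, c 1, c 2, fun z => by rw [h z]; exact Fin.sum_univ_three _⟩
  · rintro ⟨c, d, f, h⟩
    exact ⟨![c, d, f], fun z => by rw [h z]; symm; exact Fin.sum_univ_three _⟩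

/-- Independence of the values at one point suffices, and the bases of the table are independent at
every point. -/
theorem linearIndependent_two {Ω : Set J0} {a b : J0 → J0} {z : J0} (hz : z ∈ Ω)
    (h : ∀ c d : ℝ, c • a z + d • b z = 0 → c = 0 ∧ d = 0) :
    LinearIndependent ℝ fun i : Fin [a, b].length => Ω.domRestrict ([a, b].get i) := by
  rw [Fintype.linearIndependent_iff]
  intro g hg
  have h1 := congrFun hg ⟨z, hz⟩
  rw [Finset.sum_apply] at h1
  obtain ⟨h2, h3⟩ := h (g 0) (g 1) ((Fin.sum_univ_two _).symm.trans h1)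
  intro i
  match i with
  | ⟨0, _⟩ => exact h2
  | ⟨1, _⟩ => exact h3

theorem linearIndependent_three {Ω : Set J0} {a b e : J0 → J0} {z : J0} (hz : z ∈ Ω)
    (h : ∀ c d f : ℝ, c • a z + d • b z + f • e z = 0 → c = 0 ∧ d = 0 ∧ f = 0) :
    LinearIndependent ℝ fun i : Fin [a, b, e].length => Ω.domRestrict ([a, b, e].get i) := by
  rw [Fintype.linearIndependent_iff]
  intro g hg
  have h1 := congrFun hg ⟨z, hz⟩
  rw [Finset.sum_apply] at h1
  obtain ⟨h2, h3, h4⟩ := h (g 0) (g 1) (g 2) ((Fin.sum_univ_three _).symm.trans h1)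
  intro i
  match i with
  | ⟨0, _⟩ => exact h2
  | ⟨1, _⟩ => exact h3
  | ⟨2, _⟩ => exact h4

/-! ### The algebras of the six cases -/

namespace TableRow

variable {J I V : Set ℝ}

/-- Linear combinations of the fields with exponential coefficients. -/
theorem symField_exp (M c₀ c₁ c₂ : ℝ) (z : J0) :
    symField (fun t => c₀ + c₂ * Real.exp (-2 * M * t)) (fun t => c₁ * Real.exp (-M * t)) z
      = c₀ • vecT z + c₁ • vecExpX M z + c₂ • vecExpS M z := by
  have d1 : deriv (fun t => c₀ + c₂ * Real.exp (-2 * M * t)) z.1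
      = c₂ * (-2 * M) * Real.exp (-2 * M * z.1) :=
    ((hasDerivAt_exp_mul c₂ (-2 * M) z.1).const_add c₀).deriv
  simp only [symField, d1, vecT, vecExpX, vecExpS]
  ext <;> simp <;> ring

/-- Linear combinations of the fields with polynomial coefficients. -/
theorem symField_poly (L c₀ c₁ c₂ : ℝ) (z : J0) :
    symField (fun t => c₀ + c₂ * (2 * t)) (fun t => c₁ - c₂ * L * t) z
      = c₀ • vecT z + c₁ • vecX z + c₂ • vecS L z := by
  have d1 : deriv (fun t : ℝ => c₀ + c₂ * (2 * t)) z.1 = c₂ * 2 :=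
    ((((hasDerivAt_id z.1).const_mul 2).const_mul c₂).const_add c₀).deriv.trans (by simp)
  simp only [symField, d1, vecT, vecX, vecS]
  ext <;> simp
  ring

/-- The algebra of an equation whose `F` has a nonzero linear term. -/
theorem mem_maxAlg_exp (hJ : IsOpenInterval J) (hI : IsOpenInterval I) (hV : IsOpenInterval V)
    {r : TableRow} {ε : ℝ} (hc : InClass I ε r.F r.H) (hM : r.coefM ≠ 0) (hL : r.coefL = 0)
    {Y : box J I V → J0} :
    Y ∈ maxAlg (box J I V) ε r.F r.H ↔
      ∃ c₀ c₁ c₂ : ℝ, (c₁ * r.coefA = 0 ∧ c₁ * r.coefB = 0 ∧ c₂ * (r.coefK - 2 * r.coefM) = 0) ∧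
        ∀ z : box J I V,
          Y z = c₀ • vecT z + c₁ • vecExpX r.coefM z + c₂ • vecExpS r.coefM z := by
  rw [mem_maxAlg_iff hJ hI hV hc]
  constructor
  · rintro ⟨τ, σ, hs, rfl⟩
    rw [isSol_iff hI hc, hL] at hs
    obtain ⟨hτ, hσ, hs⟩ := hs
    obtain ⟨c₀, c₁, c₂, h⟩ := SplitEqs.exists_exp hJ hM hτ hσ hs
    refine ⟨c₀, c₁, c₂, ?_, fun z => ?_⟩
    -- The split equations not used for the integration, read at a single time, are the constraints
    -- on the constants, since the exponentials do not vanish.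
    · obtain ⟨t, ht⟩ := hJ.2.1
      obtain ⟨s1, -, s3, s4, s5⟩ := hs t ht
      obtain ⟨-, h2, h3⟩ := h t ht
      have e1 := Real.exp_ne_zero (-r.coefM * t)
      have e2 := Real.exp_ne_zero (-2 * r.coefM * t)
      rw [h3] at s3 s5
      refine ⟨mul_left_cancel₀ e1 ?_, mul_left_cancel₀ e1 ?_, mul_left_cancel₀ hM
        (mul_left_cancel₀ e2 ?_)⟩
      · linear_combination s3
      · linear_combination s5
      · rw [h2] at s1 s4
        linear_combination (s1 - s4) / 2
    · rw [← symField_exp]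
      have d1 : deriv (fun t => c₀ + c₂ * Real.exp (-2 * r.coefM * t)) z.1.1
          = c₂ * (-2 * r.coefM) * Real.exp (-2 * r.coefM * z.1.1) :=
        ((hasDerivAt_exp_mul c₂ (-2 * r.coefM) z.1.1).const_add c₀).deriv
      obtain ⟨h1, h2, h3⟩ := h z.1.1 z.2.1
      simp only [Set.domRestrict_apply, symField, d1, h1, h2, h3]
  · rintro ⟨c₀, c₁, c₂, ⟨h1, h2, h3⟩, h⟩
    refine ⟨fun t => c₀ + c₂ * Real.exp (-2 * r.coefM * t),
      fun t => c₁ * Real.exp (-r.coefM * t), ?_, funext fun z => ?_⟩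
    · rw [isSol_iff hI hc, hL]
      refine ⟨(contDiff_exp_family _ _ _).contDiffOn, ?_, fun t _ => splitEqs_exp _ _ _ _ t h1 h2 h3⟩
      simpa using (contDiff_exp_family (-r.coefM) 0 c₁).contDiffOn
    · rw [h z, ← symField_exp]; rfl

/-- The algebra of an equation whose `F` has no linear term. -/
theorem mem_maxAlg_poly (hJ : IsOpenInterval J) (hI : IsOpenInterval I) (hV : IsOpenInterval V)
    {r : TableRow} {ε : ℝ} (hc : InClass I ε r.F r.H) (hM : r.coefM = 0)
    {Y : box J I V → J0} :
    Y ∈ maxAlg (box J I V) ε r.F r.H ↔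
      ∃ c₀ c₁ c₂ : ℝ, ((∀ t ∈ J, (c₁ - c₂ * r.coefL * t) * r.coefA = 0) ∧
          (∀ t ∈ J, (c₁ - c₂ * r.coefL * t) * r.coefB = 0) ∧ c₂ * r.coefK = 0) ∧
        ∀ z : box J I V, Y z = c₀ • vecT z + c₁ • vecX z + c₂ • vecS r.coefL z := by
  rw [mem_maxAlg_iff hJ hI hV hc]
  constructor
  · rintro ⟨τ, σ, hs, rfl⟩
    rw [isSol_iff hI hc, hM] at hs
    obtain ⟨hτ, hσ, hs⟩ := hs
    obtain ⟨c₀, c₁, c₂, h⟩ := SplitEqs.exists_poly hJ hτ hσ hs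
    refine ⟨c₀, c₁, c₂, ⟨fun t ht => ?_, fun t ht => ?_, ?_⟩, fun z => ?_⟩
    · rw [← (h t ht).2.2]; exact (hs t ht).2.2.1
    · rw [← (h t ht).2.2]; exact (hs t ht).2.2.2.2
    · obtain ⟨t, ht⟩ := hJ.2.1
      obtain ⟨s1, -, -, s4, -⟩ := hs t ht
      rw [(h t ht).2.1] at s1 s4
      linear_combination (s4 - s1) / 2
    · rw [← symField_poly]
      have d1 : deriv (fun t : ℝ => c₀ + c₂ * (2 * t)) z.1.1 = c₂ * 2 :=
        ((((hasDerivAt_id z.1.1).const_mul 2).const_mul c₂).const_add c₀).deriv.trans (by simp)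
      obtain ⟨h1, h2, h3⟩ := h z.1.1 z.2.1
      simp only [Set.domRestrict_apply, symField, d1, h1, h2, h3]
  · rintro ⟨c₀, c₁, c₂, ⟨h1, h2, h3⟩, h⟩
    refine ⟨fun t => c₀ + c₂ * (2 * t), fun t => c₁ - c₂ * r.coefL * t, ?_, funext fun z => ?_⟩
    · rw [isSol_iff hI hc, hM]
      exact ⟨ContDiff.contDiffOn (by fun_prop), ContDiff.contDiffOn (by fun_prop),
        fun t ht => splitEqs_poly _ _ _ _ t (h1 t ht) (h2 t ht) h3⟩
    · rw [h z, ← symField_poly]; rfl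

/-- The general solution combines three fields. A nonzero A or B removes the translation field (c₁ =
0), and K ≠ 2M removes the scaling field (c₂ = 0); the rows are the surviving combinations. -/
theorem isBasisOn_maxAlg (hJ : IsOpenInterval J) (hI : IsOpenInterval I) (hV : IsOpenInterval V)
    (r : TableRow) (ε : ℝ) (hr : r.Valid) (hc : InClass I ε r.F r.H) :
    IsBasisOn (box J I V) r.basis (maxAlg (box J I V) ε r.F r.H) := by
  obtain ⟨t, ht⟩ := hJ.2.1
  obtain ⟨x, hx⟩ := hI.2.1
  obtain ⟨v, hv⟩ := hV.2.1
  have hz := mem_box ht hx hv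
  have hμ : ∀ μ : ℝ, μ = 1 ∨ μ = -1 → μ ≠ 0 := by
    rintro μ (rfl | rfl) <;> norm_num
  have hAB : ∀ {c α β : ℝ}, α ^ 2 + β ^ 2 ≠ 0 → c * α = 0 → c * β = 0 → c = 0 := by
    intro c α β h h1 h2
    by_contra hc
    apply h
    rw [(mul_eq_zero.1 h1).resolve_left hc, (mul_eq_zero.1 h2).resolve_left hc]
    norm_num
  cases r with
  | case1 α β μ =>
    obtain ⟨h1, h2⟩ := hr
    have h3 := hμ μ h1
    refine ⟨linearIndependent_two hz fun c d h => ?_, Set.ext fun Y => ?_⟩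
    · simp [vecT, vecExpS, Prod.ext_iff, h3] at h
      obtain ⟨h, -, rfl⟩ := h
      simpa using h
    · rw [mem_maxAlg_exp hJ hI hV hc h3 rfl]
      refine mem_spanOn_two.trans ⟨?_, ?_⟩
      · rintro ⟨c, d, h⟩
        exact ⟨c, 0, d, by simp [coefK, coefM], fun z => by simpa [coefM] using h z⟩
      · rintro ⟨c, e, d, ⟨k1, k2, -⟩, h⟩
        obtain rfl := hAB h2 k1 k2
        exact ⟨c, d, fun z => by simpa [coefM] using h z⟩
  | case2 α β =>
    refine ⟨linearIndependent_two hz fun c d h => ?_, Set.ext fun Y => ?_⟩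
    · simp [vecT, vecS, Prod.ext_iff] at h
      obtain ⟨h, -, rfl⟩ := h
      simpa using h
    · rw [mem_maxAlg_poly hJ hI hV hc rfl]
      refine mem_spanOn_two.trans ⟨?_, ?_⟩
      · rintro ⟨c, d, h⟩
        exact ⟨c, 0, d, by simp [coefK, coefL], fun z => by simpa [coefL] using h z⟩
      · rintro ⟨c, e, d, ⟨k1, k2, -⟩, h⟩
        obtain rfl := hAB (c := e) hr (by simpa [coefL, coefA] using k1 t ht)
          (by simpa [coefL, coefB] using k2 t ht)
        exact ⟨c, d, fun z => by simpa [coefL] using h z⟩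
  | case3 μ γ =>
    obtain ⟨h1, h2⟩ := hr
    have h3 := hμ μ h1
    refine ⟨linearIndependent_two hz fun c d h => ?_, Set.ext fun Y => ?_⟩
    · simpa [vecT, vecExpX, Prod.ext_iff] using h
    · rw [mem_maxAlg_exp hJ hI hV hc h3 rfl]
      refine mem_spanOn_two.trans ⟨?_, ?_⟩
      · rintro ⟨c, d, h⟩
        exact ⟨c, d, 0, by simp [coefA, coefB], fun z => by simpa [coefM] using h z⟩
      · rintro ⟨c, d, e, ⟨-, -, k3⟩, h⟩
        obtain rfl := (mul_eq_zero.1 k3).resolve_right (sub_ne_zero.2 h2)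
        exact ⟨c, d, fun z => by simpa [coefM] using h z⟩
  | case4 l γ =>
    refine ⟨linearIndependent_two hz fun c d h => ?_, Set.ext fun Y => ?_⟩
    · simpa [vecT, vecX, Prod.ext_iff] using h
    · rw [mem_maxAlg_poly hJ hI hV hc rfl]
      refine mem_spanOn_two.trans ⟨?_, ?_⟩
      · rintro ⟨c, d, h⟩
        exact ⟨c, d, 0, by simp [coefA, coefB], fun z => by simpa [coefL] using h z⟩
      · rintro ⟨c, d, e, ⟨-, -, k3⟩, h⟩
        obtain rfl := (mul_eq_zero.1 k3).resolve_right hr.2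
        exact ⟨c, d, fun z => by simpa [coefL] using h z⟩
  | case5 μ =>
    have h3 := hμ μ hr
    refine ⟨linearIndependent_three hz fun c d e h => ?_, Set.ext fun Y => ?_⟩
    · simp [vecT, vecExpX, vecExpS, Prod.ext_iff, h3] at h
      obtain ⟨h, h', rfl⟩ := h
      exact ⟨by simpa using h, by simpa using h', rfl⟩
    · rw [mem_maxAlg_exp hJ hI hV hc h3 rfl]
      refine mem_spanOn_three.trans ⟨?_, ?_⟩
      · rintro ⟨c, d, e, h⟩
        exact ⟨c, d, e, by simp [coefA, coefB, coefK, coefM], h⟩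
      · rintro ⟨c, d, e, -, h⟩
        exact ⟨c, d, e, h⟩
  | case6 l =>
    refine ⟨linearIndependent_three hz fun c d e h => ?_, Set.ext fun Y => ?_⟩
    · simp [vecT, vecX, vecS, Prod.ext_iff] at h
      obtain ⟨h, h', rfl⟩ := h
      exact ⟨by simpa using h, by simpa using h', rfl⟩
    · rw [mem_maxAlg_poly hJ hI hV hc rfl]
      refine mem_spanOn_three.trans ⟨?_, ?_⟩
      · rintro ⟨c, d, e, h⟩
        exact ⟨c, d, e, by simp [coefA, coefB, coefK], h⟩
      · rintro ⟨c, d, e, -, h⟩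
        exact ⟨c, d, e, h⟩

end TableRow

/-! ### The kernel -/

section Kernel

variable {J I V : Set ℝ}

theorem isSol_const (F H : ℝ → ℝ) (c : ℝ) : IsSol J I F H (fun _ => c) (fun _ => 0) := by
  refine ⟨contDiffOn_const, contDiffOn_const, fun t _ x _ => ?_⟩
  simp [DeterminingEqs]

theorem domRestrict_symField_of_trivial (hJ : IsOpenInterval J) {τ σ : ℝ → ℝ}
    (hτ : ContDiffOn ℝ ∞ τ J) (h : ∀ t ∈ J, deriv τ t = 0 ∧ σ t = 0) :
    (box J I V).domRestrict (symField τ σ) ∈ spanOn (box J I V) [TableRow.vecT] := by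
  obtain ⟨t₀, ht₀⟩ := hJ.2.1
  refine mem_spanOn_one.2 ⟨τ t₀, fun z => ?_⟩
  have h1 : τ z.1.1 = τ t₀ := hJ.1.is_const_of_deriv_eq_zero hJ.convex.isPreconnected
    (hτ.differentiableOn (by simp)) (fun t ht => (h t ht).1) z.2.1 ht₀
  obtain ⟨h2, h3⟩ := h z.1.1 z.2.1
  simp [symField, TableRow.vecT, h1, h2, h3]

theorem spanOn_vecT_subset (hJ : IsOpenInterval J) (hI : IsOpenInterval I) (hV : IsOpenInterval V)
    {ε : ℝ} {F H : ℝ → ℝ} (hc : InClass I ε F H) :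
    spanOn (box J I V) [TableRow.vecT] ⊆ maxAlg (box J I V) ε F H := by
  intro Y hY
  obtain ⟨c, h⟩ := mem_spanOn_one.1 hY
  rw [mem_maxAlg_iff hJ hI hV hc]
  exact ⟨_, _, isSol_const F H c, funext fun z => by simp [h z, symField, TableRow.vecT]⟩

/-- One generic equation suffices: for F = x², H = 0 the first determining equation is quadratic in
x with leading coefficient 3τ'/2 and linear coefficient τ''/2 + 2σ, and the second is τ'' = 0. -/
theorem kernelAlg_eq (hJ : IsOpenInterval J) (hI : IsOpenInterval I) (hV : IsOpenInterval V) :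
    kernelAlg J I V = spanOn (box J I V) [TableRow.vecT] := by
  refine Subset.antisymm (fun Y hY => ?_) fun Y hY ε F H hc => spanOn_vecT_subset hJ hI hV hc hY
  have hc : InClass I 1 (fun x => x ^ 2) (fun _ => 0) :=
    ⟨Or.inl rfl, ContDiff.contDiffOn (by fun_prop), contDiffOn_const⟩
  obtain ⟨τ, σ, ⟨hτ, hσ, hs⟩, rfl⟩ := (mem_maxAlg_iff hJ hI hV hc).1 (hY _ _ _ hc)
  refine domRestrict_symField_of_trivial hJ hτ fun t ht => ?_
  obtain ⟨-, h1, h2, -⟩ := coeffs_eq_zero hI finite_empty (a := deriv σ t)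
    (b := deriv (deriv τ) t / 2 + 2 * σ t) (c := 3 * (deriv τ t / 2)) (d := 0) (e := 0) (by
      intro x hx _
      have := (hs t ht x hx).1
      have hd : deriv (fun x : ℝ => x ^ 2) x = 2 * x := by simp
      rw [hd] at this
      linear_combination this)
  obtain ⟨x, hx⟩ := hI.2.1
  have h3 := (hs t ht x hx).2
  have h4 : deriv τ t = 0 := by linarith
  simp only [deriv_const, h4] at h3
  exact ⟨h4, by linarith⟩

/-- The v-component of `symField τ σ` is -τ' and, once τ' = 0, its x-component is σ; so the field is
a constant multiple of ∂_t exactly when τ' and σ vanish on J. -/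
theorem maxAlg_ne_kernelAlg_iff (hJ : IsOpenInterval J) (hI : IsOpenInterval I)
    (hV : IsOpenInterval V) {ε : ℝ} {F H : ℝ → ℝ} (hc : InClass I ε F H) :
    maxAlg (box J I V) ε F H ≠ kernelAlg J I V ↔
      ∃ τ σ, IsSol J I F H τ σ ∧ ∃ t ∈ J, deriv τ t ≠ 0 ∨ σ t ≠ 0 := by
  rw [kernelAlg_eq hJ hI hV]
  constructor
  · intro h
    by_contra! hn
    refine h (Subset.antisymm (fun Y hY => ?_) (spanOn_vecT_subset hJ hI hV hc))
    obtain ⟨τ, σ, hs, rfl⟩ := (mem_maxAlg_iff hJ hI hV hc).1 hY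
    exact domRestrict_symField_of_trivial hJ hs.1 (hn τ σ hs)
  · rintro ⟨τ, σ, hs, t, ht, h⟩ he
    have : (box J I V).domRestrict (symField τ σ) ∈ spanOn (box J I V) [TableRow.vecT] :=
      he ▸ (mem_maxAlg_iff hJ hI hV hc).2 ⟨τ, σ, hs, rfl⟩
    obtain ⟨c, h'⟩ := mem_spanOn_one.1 this
    obtain ⟨x, hx⟩ := hI.2.1
    obtain ⟨v, hv⟩ := hV.2.1
    have := h' ⟨_, mem_box ht hx hv⟩
    simp [symField, TableRow.vecT, Prod.ext_iff] at this
    obtain ⟨-, h1, h2⟩ := this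
    rw [h2] at h1
    rcases h with h | h
    · exact h h2
    · exact h (by simpa using h1)

end Kernel

/-! ### Extensions of the kernel -/

section Classification

variable {J I : Set ℝ}

/-- Solutions of the determining equations are transported by equivalence. -/
theorem IsSol.of_gEquiv {I' : Set ℝ} (hI : IsOpenInterval I) {F H F' H' τ σ : ℝ → ℝ} {ε : ℝ}
    {δ d : ℝ} (hδ : δ ≠ 0) (hI' : I' = (fun x => δ * x + d) '' I)
    (hFH : ∀ x ∈ I, F' (δ * x + d) = δ⁻¹ * F x ∧ H' (δ * x + d) = (δ ^ 2)⁻¹ * H x)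
    (hc : InClass I' ε F' H') (hs : IsSol univ I' F' H' τ σ) :
    IsSol J I F H (fun t => τ (δ ^ 2 * t) / δ ^ 2)
      fun t => (deriv τ (δ ^ 2 * t) / 2 * d + σ (δ ^ 2 * t)) / δ := by
  have hI'o : IsOpenInterval I' := hI' ▸ hI.image_affine hδ d
  obtain ⟨hτ, hσ, hs⟩ := hs
  rw [contDiffOn_univ] at hτ hσ
  have hτ' : ContDiff ℝ ∞ (deriv τ) := contDiffOn_univ.1 (hτ.contDiffOn.deriv_isOpen isOpen_univ)
  have hl : ContDiff ℝ ∞ fun t : ℝ => δ ^ 2 * t := by fun_prop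
  have comp : ∀ f : ℝ → ℝ, ContDiff ℝ ∞ f → ∀ t,
      HasDerivAt (fun t => f (δ ^ 2 * t)) (deriv f (δ ^ 2 * t) * δ ^ 2) t := fun f hf t =>
    ((hf.differentiable (by simp) _).hasDerivAt).comp t
      (by simpa using (hasDerivAt_id t).const_mul (δ ^ 2))
  have d1 : deriv (fun t => τ (δ ^ 2 * t) / δ ^ 2) = fun t => deriv τ (δ ^ 2 * t) := by
    funext t
    rw [((comp τ hτ t).div_const _).deriv]
    field_simp
  refine ⟨((hτ.comp hl).div_const _).contDiffOn,
    ((((hτ'.comp hl).div_const 2).mul contDiff_const).add (hσ.comp hl)).div_const _ |>.contDiffOn,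
    fun t _ x hx => ?_⟩
  have hy : δ * x + d ∈ I' := hI' ▸ mem_image_of_mem _ hx
  obtain ⟨h1, h2⟩ := hs (δ ^ 2 * t) trivial _ hy
  have d2 : deriv (fun t => (deriv τ (δ ^ 2 * t) / 2 * d + σ (δ ^ 2 * t)) / δ) t
      = (deriv (deriv τ) (δ ^ 2 * t) * δ ^ 2 / 2 * d + deriv σ (δ ^ 2 * t) * δ ^ 2) / δ :=
    (((((comp _ hτ' t).div_const 2).mul_const d).add (comp σ hσ t)).div_const δ).deriv
  have aff : HasDerivAt (fun x : ℝ => δ * x + d) δ x := by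
    simpa using ((hasDerivAt_id x).const_mul δ).add_const d
  have dF : deriv F x = δ * (deriv F' (δ * x + d) * δ) := by
    have : F =ᶠ[𝓝 x] fun x => δ * F' (δ * x + d) := by
      filter_upwards [hI.1.mem_nhds hx] with y hy
      rw [(hFH y hy).1]; field_simp
    rw [this.deriv_eq]
    exact (((hc.2.1.differentiableAt_isOpen hI'o.1 hy).hasDerivAt.comp x aff).const_mul δ).deriv
  have dH : deriv H x = δ ^ 2 * (deriv H' (δ * x + d) * δ) := by
    have : H =ᶠ[𝓝 x] fun x => δ ^ 2 * H' (δ * x + d) := by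
      filter_upwards [hI.1.mem_nhds hx] with y hy
      rw [(hFH y hy).2]; field_simp
    rw [this.deriv_eq]
    exact (((hc.2.2.differentiableAt_isOpen hI'o.1 hy).hasDerivAt.comp x aff).const_mul _).deriv
  have eF : F x = δ * F' (δ * x + d) := by rw [(hFH x hx).1]; field_simp
  have eH : H x = δ ^ 2 * H' (δ * x + d) := by rw [(hFH x hx).2]; field_simp
  -- In the new variables the first determining equation acquires the factor δ and the second the
  -- factor δ².
  rw [DeterminingEqs, d1, (comp _ hτ' t).deriv, d2, dF, dH, eF, eH]
  constructor
  · field_simp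
    linear_combination 2 * δ * h1
  · field_simp
    linear_combination 2 * δ ^ 2 * h2

namespace TableRow

/-- Every case has a nowhere trivial symmetry over the whole time axis. -/
theorem exists_isSol {I' : Set ℝ} (hI : IsOpenInterval I') {r : TableRow} (hr : r.Valid) {ε : ℝ}
    (hc : InClass I' ε r.F r.H) :
    ∃ τ σ : ℝ → ℝ, IsSol univ I' r.F r.H τ σ ∧ ∀ t, deriv τ t ≠ 0 ∨ σ t ≠ 0 := by
  have hμ : ∀ μ : ℝ, μ = 1 ∨ μ = -1 → μ ≠ 0 := by
    rintro μ (rfl | rfl) <;> norm_num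
  have hexp : ∀ c₁ c₂ : ℝ, r.coefM ≠ 0 → r.coefL = 0 → c₁ * r.coefA = 0 → c₁ * r.coefB = 0 →
      c₂ * (r.coefK - 2 * r.coefM) = 0 → (c₁ ≠ 0 ∨ c₂ ≠ 0) →
      ∃ τ σ : ℝ → ℝ, IsSol univ I' r.F r.H τ σ ∧ ∀ t, deriv τ t ≠ 0 ∨ σ t ≠ 0 := by
    intro c₁ c₂ hM hL h1 h2 h3 hn
    refine ⟨fun t => 0 + c₂ * Real.exp (-2 * r.coefM * t),
      fun t => c₁ * Real.exp (-r.coefM * t), ?_, fun t => ?_⟩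
    · rw [isSol_iff hI hc, hL]
      refine ⟨(contDiff_exp_family _ _ _).contDiffOn, ?_, fun t _ => splitEqs_exp _ _ _ _ t h1 h2 h3⟩
      simpa using (contDiff_exp_family (-r.coefM) 0 c₁).contDiffOn
    · rcases hn with hn | hn
      · exact Or.inr (mul_ne_zero hn (Real.exp_ne_zero _))
      · rw [((hasDerivAt_exp_mul c₂ (-2 * r.coefM) t).const_add 0).deriv]
        exact Or.inl (mul_ne_zero (mul_ne_zero hn (mul_ne_zero (by norm_num) hM))
          (Real.exp_ne_zero _))
  have hpoly : ∀ c₁ c₂ : ℝ, r.coefM = 0 → (∀ t, (c₁ - c₂ * r.coefL * t) * r.coefA = 0) →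
      (∀ t, (c₁ - c₂ * r.coefL * t) * r.coefB = 0) → c₂ * r.coefK = 0 →
      (c₂ = 0 ∧ c₁ ≠ 0 ∨ c₂ ≠ 0) →
      ∃ τ σ : ℝ → ℝ, IsSol univ I' r.F r.H τ σ ∧ ∀ t, deriv τ t ≠ 0 ∨ σ t ≠ 0 := by
    intro c₁ c₂ hM h1 h2 h3 hn
    refine ⟨fun t => 0 + c₂ * (2 * t), fun t => c₁ - c₂ * r.coefL * t, ?_, fun t => ?_⟩
    · rw [isSol_iff hI hc, hM]
      exact ⟨ContDiff.contDiffOn (by fun_prop), ContDiff.contDiffOn (by fun_prop),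
        fun t ht => splitEqs_poly _ _ _ _ t (h1 t) (h2 t) h3⟩
    · rcases hn with ⟨rfl, hn⟩ | hn
      · exact Or.inr (by simpa using hn)
      · have d1 : deriv (fun t : ℝ => 0 + c₂ * (2 * t)) t = c₂ * 2 :=
          ((((hasDerivAt_id t).const_mul 2).const_mul c₂).const_add 0).deriv.trans (by simp)
        rw [d1]
        exact Or.inl (by simpa using hn)
  -- The arguments 0 1 select the scaling field and 1 0 the translation field; each case uses one
  -- that its constraints allow.
  cases r with
  | case1 α β μ =>
    exact hexp 0 1 (hμ μ hr.1) rfl (by simp) (by simp) (by simp [coefK, coefM])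
      (by simp)
  | case2 α β =>
    exact hpoly 0 1 rfl (by simp [coefL]) (by simp [coefL]) (by simp [coefK])
      (by simp)
  | case3 μ γ =>
    exact hexp 1 0 (hμ μ hr.1) rfl (by simp [coefA]) (by simp [coefB]) (by simp)
      (by simp)
  | case4 l γ =>
    exact hpoly 1 0 rfl (by simp [coefA]) (by simp [coefB]) (by simp) (by simp)
  | case5 μ =>
    exact hexp 1 0 (hμ μ hr) rfl (by simp [coefA]) (by simp [coefB]) (by simp) (by simp)
  | case6 l =>
    exact hpoly 0 1 rfl (by simp [coefA]) (by simp [coefB]) (by simp [coefK]) (by simp)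

end TableRow

/-! ### Reduction to the table by translations and scalings -/

/-- The equation given by `(ε, F, H)` over `I` is equivalent to one in the table. -/
def IsClassified (I : Set ℝ) (ε : ℝ) (F H : ℝ → ℝ) : Prop :=
  ∃ (r : TableRow) (I' : Set ℝ), r.Valid ∧ InClass I' ε r.F r.H ∧ GEquiv I F H I' r.F r.H

/-- Only the pointwise relation has to be checked: the functions of the row inherit smoothness on
the image interval from F and H, so the pole of the row avoids it automatically. -/
theorem IsClassified.intro {ε : ℝ} {F H : ℝ → ℝ} (hc : InClass I ε F H) (r : TableRow)
    (hr : r.Valid) {δ d : ℝ} (hδ : δ ≠ 0)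
    (h : ∀ x ∈ I, r.F (δ * x + d) = δ⁻¹ * F x ∧ r.H (δ * x + d) = (δ ^ 2)⁻¹ * H x) :
    IsClassified I ε F H := by
  refine ⟨r, (fun x => δ * x + d) '' I, hr, ⟨hc.1, ?_, ?_⟩, δ, d, hδ, rfl, h⟩
  all_goals
    have hinv : ∀ x, (δ * x + d - d) / δ = x := fun x => by field_simp; ring
    have hm : MapsTo (fun y => (y - d) / δ) ((fun x => δ * x + d) '' I) I := by
      rintro _ ⟨x, hx, rfl⟩
      simpa only [hinv] using hx
    have ha : ContDiff ℝ ∞ fun y : ℝ => (y - d) / δ := by fun_prop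
  · refine (contDiffOn_const (c := δ⁻¹) |>.mul (hc.2.1.comp ha.contDiffOn hm)).congr ?_
    rintro _ ⟨x, hx, rfl⟩
    simp only [Function.comp, hinv, (h x hx).1]
  · refine (contDiffOn_const (c := (δ ^ 2)⁻¹) |>.mul (hc.2.2.comp ha.contDiffOn hm)).congr ?_
    rintro _ ⟨x, hx, rfl⟩
    simp only [Function.comp, hinv, (h x hx).2]

/-- Scaling changes M by a positive factor, so only its sign remains. -/
theorem exists_scaling {M : ℝ} (hM : M ≠ 0) :
    ∃ δ μ : ℝ, δ ≠ 0 ∧ (μ = 1 ∨ μ = -1) ∧ M = μ * δ ^ 2 := by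
  rcases lt_or_gt_of_ne hM with h | h
  · exact ⟨√(-M), -1, (Real.sqrt_pos.2 (by linarith)).ne', Or.inr rfl,
      by rw [Real.sq_sqrt (by linarith)]; ring⟩
  · exact ⟨√M, 1, (Real.sqrt_pos.2 h).ne', Or.inl rfl, by rw [Real.sq_sqrt h.le]; ring⟩

/-- The shift d = δs puts the pole -s at the origin, and δ normalizes M to ±1. The relation K = 2M
is preserved and becomes the summand 2μ of case 1. -/
theorem IsClassified.of_singular {ε : ℝ} {F H : ℝ → ℝ} (hc : InClass I ε F H) {A M B s : ℝ}
    (hAB : A ^ 2 + B ^ 2 ≠ 0) (hF : ∀ x ∈ I, F x = normalF A M 0 (x + s))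
    (hH : ∀ x ∈ I, H x = normalH B (2 * M) (x + s)) : IsClassified I ε F H := by
  by_cases hM : M = 0
  · subst hM
    refine .intro hc (.case2 A B) hAB (δ := 1) (d := s) one_ne_zero fun x hx => ?_
    rw [hF x hx, hH x hx]
    simp [TableRow.F, TableRow.H, normalF, normalH]
  · obtain ⟨δ, μ, hδ, hμ, rfl⟩ := exists_scaling hM
    refine .intro hc (.case1 A B μ) ⟨hμ, hAB⟩ (δ := δ) (d := δ * s) hδ fun x hx => ?_
    rw [hF x hx, hH x hx, ← mul_add]
    simp only [TableRow.F, TableRow.H, normalF, normalH, mul_inv, mul_pow]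
    constructor
    · field_simp; ring
    · field_simp

/-- If M ≠ 0, the translation by L / (μδ) absorbs the constant term of F. If M = 0 and L ≠ 0, the
scaling δ = L, possibly negative, turns L into 1. The alternatives for K separate cases 3, 4 from 5,
6. -/
theorem IsClassified.of_regular {ε : ℝ} {F H : ℝ → ℝ} (hc : InClass I ε F H) {M L K : ℝ}
    (hF : ∀ x ∈ I, F x = M * x + L) (hH : ∀ x ∈ I, H x = K) : IsClassified I ε F H := by
  by_cases hM : M = 0
  · subst hM
    by_cases hL : L = 0
    · subst hL
      by_cases hK : K = 0
      · subst hK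
        refine .intro hc (.case6 0) (Or.inl rfl) (δ := 1) (d := 0) one_ne_zero fun x hx => ?_
        simp [hF x hx, hH x hx, TableRow.F, TableRow.H]
      · refine .intro hc (.case4 0 K) ⟨Or.inl rfl, hK⟩ (δ := 1) (d := 0) one_ne_zero
          fun x hx => ?_
        simp [hF x hx, hH x hx, TableRow.F, TableRow.H]
    · by_cases hK : K = 0
      · subst hK
        refine .intro hc (.case6 1) (Or.inr rfl) (δ := L) (d := 0) hL fun x hx => ?_
        simp [hF x hx, hH x hx, TableRow.F, TableRow.H, hL]
      · refine .intro hc (.case4 1 ((L ^ 2)⁻¹ * K)) ⟨Or.inr rfl, by simp [hL, hK]⟩ (δ := L) (d := 0)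
          hL fun x hx => ?_
        simp [hF x hx, hH x hx, TableRow.F, TableRow.H, hL]
  · obtain ⟨δ, μ, hδ, hμ, rfl⟩ := exists_scaling hM
    have hμ0 : μ ≠ 0 := by rintro rfl; simp at hM
    have hFe : ∀ x ∈ I, μ * (δ * x + L / (μ * δ)) = δ⁻¹ * F x := fun x hx => by
      rw [hF x hx]; field_simp
    by_cases hK : K = 2 * (μ * δ ^ 2)
    · subst hK
      refine .intro hc (.case5 μ) hμ (δ := δ) hδ fun x hx => ⟨hFe x hx, ?_⟩
      rw [hH x hx]
      simp only [TableRow.H]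
      field_simp
    · refine .intro hc (.case3 μ ((δ ^ 2)⁻¹ * K)) ⟨hμ, fun h => hK ?_⟩ (δ := δ) hδ
        fun x hx => ⟨hFe x hx, ?_⟩
      · field_simp at h
        linear_combination h
      · rw [hH x hx]
        rfl

/-- The first order equations that a nontrivial scaling symmetry imposes on `F` and `H`. -/
theorem exists_normal_form (hI : IsOpenInterval I) {F H : ℝ → ℝ}
    (hF : ∀ x ∈ I, DifferentiableAt ℝ F x) (hH : ∀ x ∈ I, DifferentiableAt ℝ H x) {c ρ s : ℝ}
    (h1 : ∀ x ∈ I, (x + c) * deriv F x + F x + ρ * (x + c) + s = 0)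
    (h2 : ∀ x ∈ I, (x + c) * deriv H x + 2 * H x + 2 * ρ = 0) :
    ∃ A B : ℝ, (∀ x ∈ I, F x = normalF A (-ρ / 2) (-s) (x + c)) ∧
      ∀ x ∈ I, H x = normalH B (2 * (-ρ / 2)) (x + c) := by
  obtain ⟨x₀, hx₀⟩ := hI.2.1
  have hid : ∀ x : ℝ, HasDerivAt (fun x : ℝ => x + c) 1 x := fun x => (hasDerivAt_id x).add_const c
  -- The first equation is already the derivative of the quantity below; the second becomes exact
  -- after multiplication by x + c.
  have k1 : ∀ x ∈ I, HasDerivAt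
      (fun x => (x + c) * F x + ρ / 2 * (x + c) ^ 2 + s * (x + c)) 0 x := fun x hx => by
    have := ((((hid x).mul (hF x hx).hasDerivAt)).add (((hid x).pow 2).const_mul (ρ / 2))).add
      ((hid x).const_mul s)
    refine this.congr_deriv ?_
    simp
    linear_combination h1 x hx
  have k2 : ∀ x ∈ I, HasDerivAt (fun x => (x + c) ^ 2 * H x + ρ * (x + c) ^ 2) 0 x :=
    fun x hx => by
      have := ((((hid x).pow 2).mul (hH x hx).hasDerivAt)).add (((hid x).pow 2).const_mul ρ)
      refine this.congr_deriv ?_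
      simp
      linear_combination (x + c) * h2 x hx
  obtain ⟨A, hA⟩ : ∃ A, ∀ x ∈ I, (x + c) * F x + ρ / 2 * (x + c) ^ 2 + s * (x + c) = A :=
    ⟨_, fun x hx => hI.1.is_const_of_deriv_eq_zero hI.convex.isPreconnected
      (fun w hw => (k1 w hw).differentiableAt.differentiableWithinAt)
      (fun w hw => (k1 w hw).deriv) hx hx₀⟩
  obtain ⟨B, hB⟩ : ∃ B, ∀ x ∈ I, (x + c) ^ 2 * H x + ρ * (x + c) ^ 2 = B :=
    ⟨_, fun x hx => hI.1.is_const_of_deriv_eq_zero hI.convex.isPreconnected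
      (fun w hw => (k2 w hw).differentiableAt.differentiableWithinAt)
      (fun w hw => (k2 w hw).deriv) hx hx₀⟩
  refine ⟨A, B, fun x hx => ?_, fun x hx => ?_⟩
  -- At a zero of x + c the equation itself gives the value of F, which agrees with the normal form
  -- because 0⁻¹ = 0.
  · by_cases h0 : x + c = 0
    · have := h1 x hx
      simp only [normalF, h0] at this ⊢
      simp
      linarith
    · simp only [normalF]
      rw [← hA x hx]
      field_simp
      ring
  · by_cases h0 : x + c = 0
    · have := h2 x hx
      simp only [normalH, h0] at this ⊢
      simp
      linarith
    · simp only [normalH]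
      rw [← hB x hx]
      field_simp
      ring

/-- If τ'(t₀) ≠ 0, dividing the equations at t₀ by p = τ'(t₀)/2 gives the normal form about -c with
a constant term -s. With A = B = 0 it is regular. Otherwise s must vanish, which a single time
cannot show: the equations at all times give σ = τ'c/2, and differentiating this at t₀ gives s = 0.
-/
theorem IsSol.isClassified (hJ : IsOpenInterval J) (hI : IsOpenInterval I) {ε : ℝ}
    {F H : ℝ → ℝ} (hc : InClass I ε F H) {τ σ : ℝ → ℝ} (hs : IsSol J I F H τ σ)
    (hn : ∃ t ∈ J, deriv τ t ≠ 0 ∨ σ t ≠ 0) : IsClassified I ε F H := by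
  obtain ⟨hτ, hσ, hs⟩ := hs
  have hF : ∀ x ∈ I, DifferentiableAt ℝ F x := fun x hx => hc.2.1.differentiableAt_isOpen hI.1 hx
  have hH : ∀ x ∈ I, DifferentiableAt ℝ H x := fun x hx => hc.2.2.differentiableAt_isOpen hI.1 hx
  by_cases hp : ∃ t ∈ J, deriv τ t ≠ 0
  · obtain ⟨t₀, ht₀, hp⟩ := hp
    set p := deriv τ t₀ / 2 with hp'
    have hp0 : p ≠ 0 := div_ne_zero hp two_ne_zero
    set c := σ t₀ / p with hc'
    set ρ := deriv (deriv τ) t₀ / 2 / p with hρ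
    set s := deriv σ t₀ / p - ρ * c with hs'
    have e1 : p * c = σ t₀ := by rw [hc']; field_simp
    have e2 : p * ρ = deriv (deriv τ) t₀ / 2 := by rw [hρ]; field_simp
    have e3 : p * s = deriv σ t₀ - p * ρ * c := by rw [hs']; field_simp
    obtain ⟨A, B, hA, hB⟩ := exists_normal_form hI hF hH (c := c) (ρ := ρ) (s := s)
      (fun x hx => mul_left_cancel₀ hp0 (by
        linear_combination (hs t₀ ht₀ x hx).1 + deriv F x * e1 + x * e2 + e3))
      (fun x hx => mul_left_cancel₀ hp0 (by
        linear_combination (hs t₀ ht₀ x hx).2 + deriv H x * e1 + 2 * e2))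
    by_cases hAB : A ^ 2 + B ^ 2 = 0
    · obtain rfl : A = 0 := by nlinarith [sq_nonneg A, sq_nonneg B]
      obtain rfl : B = 0 := by nlinarith
      exact .of_regular hc (M := -ρ / 2) (L := -ρ / 2 * c - s) (K := 2 * (-ρ / 2))
        (fun x hx => by rw [hA x hx, normalF]; ring) (fun x hx => by rw [hB x hx, normalH]; ring)
    · have dF : ∀ x ∈ I, x + c ≠ 0 → deriv F x = -A * ((x + c) ^ 2)⁻¹ + -ρ / 2 := by
        intro x hx h0
        have : F =ᶠ[𝓝 x] fun x => normalF A (-ρ / 2) (-s) (x + c) := by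
          filter_upwards [hI.1.mem_nhds hx] with y hy using hA y hy
        rw [this.deriv_eq, deriv_comp_add_const]
        exact (hasDerivAt_normalF fun h => absurd h h0).deriv
      have dH : ∀ x ∈ I, x + c ≠ 0 → deriv H x = -2 * B * ((x + c) ^ 3)⁻¹ := by
        intro x hx h0
        have : H =ᶠ[𝓝 x] fun x => normalH B (2 * (-ρ / 2)) (x + c) := by
          filter_upwards [hI.1.mem_nhds hx] with y hy using hB y hy
        rw [this.deriv_eq, deriv_comp_add_const]
        exact (hasDerivAt_normalH fun h => absurd h h0).deriv
      -- The form of F and H found at t₀ is substituted into the equations at every time; q = σ -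
      -- τ'c/2 is the part of ξ that does not vanish at the pole.
      have key : ∀ t ∈ J, _ := fun t ht => split_determiningEqs hI (A := A) (M := -ρ / 2)
        (L := -s) (B := B) (K := 2 * (-ρ / 2)) (s := c)
        (p := deriv τ t / 2) (p' := deriv (deriv τ) t / 2) (q := σ t - deriv τ t / 2 * c)
        (q' := deriv σ t - deriv (deriv τ) t / 2 * c)
        (fun x hx h0 => by
          have := (hs t ht x hx).1
          rw [dF x hx h0, hA x hx] at this
          linear_combination this)
        (fun x hx h0 => by
          have := (hs t ht x hx).2
          rw [dH x hx h0, hB x hx] at this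
          linear_combination this / 2)
      have hQ : ∀ t ∈ J, σ t = deriv τ t / 2 * c := by
        intro t ht
        obtain ⟨-, -, h3, -, h5⟩ := key t ht
        by_contra hne
        have hne' : σ t - deriv τ t / 2 * c ≠ 0 := sub_ne_zero.2 hne
        apply hAB
        rw [(mul_eq_zero.1 h3).resolve_left hne', (mul_eq_zero.1 h5).resolve_left hne']
        norm_num
      have hQ' : deriv σ t₀ = deriv (deriv τ) t₀ / 2 * c := by
        have : σ =ᶠ[𝓝 t₀] fun t => deriv τ t / 2 * c := by
          filter_upwards [hJ.1.mem_nhds ht₀] with t ht using hQ t ht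
        rw [this.deriv_eq]
        exact ((((hτ.deriv_isOpen hJ.1).differentiableAt_isOpen hJ.1 ht₀).hasDerivAt.div_const
          2).mul_const c).deriv
      have hs0 : s = 0 := by
        have : p * s = 0 := by rw [e3, hQ', e2]; ring
        exact (mul_eq_zero.1 this).resolve_left hp0
      refine .of_singular hc (M := -ρ / 2) (s := c) hAB (fun x hx => ?_) hB
      rw [hA x hx, hs0, neg_zero]
  · push Not at hp
    obtain ⟨t₀, ht₀, hq⟩ := hn
    replace hq := hq.resolve_left (fun h => h (hp t₀ ht₀))
    -- With τ' identically zero the equations at t₀ reduce to σ' + σF' = 0 and σH' = 0, so F is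
    -- affine and H constant.
    have hpp : deriv (deriv τ) t₀ = 0 := by
      have : deriv τ =ᶠ[𝓝 t₀] fun _ => 0 := by
        filter_upwards [hJ.1.mem_nhds ht₀] with t ht using hp t ht
      rw [this.deriv_eq]
      simp
    have dF : ∀ x ∈ I, deriv F x = -deriv σ t₀ / σ t₀ := by
      intro x hx
      have := (hs t₀ ht₀ x hx).1
      rw [hp t₀ ht₀, hpp] at this
      field_simp
      linear_combination this
    have dH : ∀ x ∈ I, deriv H x = 0 := by
      intro x hx
      have := (hs t₀ ht₀ x hx).2
      rw [hp t₀ ht₀, hpp] at this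
      apply mul_left_cancel₀ hq
      linear_combination this
    obtain ⟨L, hL⟩ := exists_eq_add_const hI hF (g := fun x => -deriv σ t₀ / σ t₀ * x)
      (fun x hx => by rw [dF x hx]; simpa using (hasDerivAt_id x).const_mul (-deriv σ t₀ / σ t₀))
    obtain ⟨K, hK⟩ := exists_eq_add_const hI hH (g := fun _ => 0)
      (fun x hx => by rw [dH x hx]; exact hasDerivAt_const x 0)
    exact .of_regular hc (M := -deriv σ t₀ / σ t₀) (L := L) (K := K)
      (fun x hx => by rw [hL x hx]; ring)
      (fun x hx => by rw [hK x hx, add_zero])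

theorem maxAlg_ne_kernelAlg_iff_isClassified {V : Set ℝ} (hJ : IsOpenInterval J)
    (hI : IsOpenInterval I) (hV : IsOpenInterval V) {ε : ℝ} {F H : ℝ → ℝ}
    (hc : InClass I ε F H) :
    maxAlg (box J I V) ε F H ≠ kernelAlg J I V ↔ IsClassified I ε F H := by
  rw [maxAlg_ne_kernelAlg_iff hJ hI hV hc]
  constructor
  · rintro ⟨τ, σ, hs, hn⟩
    exact hs.isClassified hJ hI hc hn
  · rintro ⟨r, I', hr, hc', δ, d, hδ, hI', hFH⟩
    obtain ⟨τ, σ, hs, hn⟩ := TableRow.exists_isSol (hI' ▸ hI.image_affine hδ d) hr hc'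
    have hs' := hs.of_gEquiv (J := J) hI hδ hI' hFH hc'
    refine ⟨_, _, hs', ?_⟩
    obtain ⟨t, ht⟩ := hJ.2.1
    have d1 : deriv (fun t => τ (δ ^ 2 * t) / δ ^ 2) t = deriv τ (δ ^ 2 * t) := by
      have h1 : HasDerivAt (fun t => τ (δ ^ 2 * t)) (deriv τ (δ ^ 2 * t) * δ ^ 2) t :=
        (hs.1.differentiableAt_isOpen isOpen_univ trivial).hasDerivAt.comp t
          (by simpa using (hasDerivAt_id t).const_mul (δ ^ 2))
      rw [(h1.div_const _).deriv]
      field_simp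
    refine ⟨t, ht, ?_⟩
    rw [d1]
    by_cases h0 : deriv τ (δ ^ 2 * t) = 0
    · refine Or.inr (div_ne_zero ?_ hδ)
      rw [h0]
      simpa using (hn (δ ^ 2 * t)).resolve_left (fun h => h h0)
    · exact Or.inl h0

end Classification

/-! ### Inequivalence of the cases -/

/-- After clearing denominators both relations are polynomial identities in x. A translation can mix
L only with M, hence the condition M' = 0 for the law of L. -/
theorem normal_form_invariants {I : Set ℝ} (hI : IsOpenInterval I)
    {A M L B K A' M' L' B' K' δ d : ℝ} (hδ : δ ≠ 0)
    (h1 : ∀ x ∈ I, normalF A' M' L' (δ * x + d) = δ⁻¹ * normalF A M L x)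
    (h2 : ∀ x ∈ I, normalH B' K' (δ * x + d) = (δ ^ 2)⁻¹ * normalH B K x) :
    M = δ ^ 2 * M' ∧ K = δ ^ 2 * K' ∧ A = A' ∧ B = B' ∧ (M' = 0 → L = δ * L') := by
  -- The two excluded points are the zeros of x and of δx + d.
  have hS : ({0, -d / δ} : Set ℝ).Finite := by simp
  have hne : ∀ x : ℝ, x ∉ ({0, -d / δ} : Set ℝ) → x ≠ 0 ∧ δ * x + d ≠ 0 := by
    intro x hx
    simp only [mem_insert_iff, mem_singleton_iff, not_or] at hx
    refine ⟨hx.1, fun h => hx.2 ?_⟩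
    field_simp
    linarith
  obtain ⟨f0, f1, f2, f3, -⟩ := coeffs_eq_zero hI hS (a := -A * d)
    (b := A' * δ + M' * d ^ 2 * δ + L' * d * δ - A * δ - L * d)
    (c := M' * 2 * δ * d * δ + L' * δ * δ - M * d - L * δ) (d := M' * δ ^ 3 - M * δ) (e := 0) (by
      intro x hx hxS
      obtain ⟨n1, n2⟩ := hne x hxS
      have := h1 x hx
      simp only [normalF] at this
      field_simp at this
      linear_combination this)
  obtain ⟨g0, g1, g2, g3, g4⟩ := coeffs_eq_zero hI hS (a := -B * d ^ 2) (b := -2 * B * δ * d)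
    (c := B' * δ ^ 2 + K' * d ^ 2 * δ ^ 2 - B * δ ^ 2 - K * d ^ 2)
    (d := 2 * δ * d * (K' * δ ^ 2 - K)) (e := K' * δ ^ 4 - K * δ ^ 2) (by
      intro x hx hxS
      obtain ⟨n1, n2⟩ := hne x hxS
      have := h2 x hx
      simp only [normalH] at this
      field_simp at this
      linear_combination this)
  have hM : M = δ ^ 2 * M' := mul_left_cancel₀ hδ (by linear_combination -f3)
  have hK : K = δ ^ 2 * K' := mul_left_cancel₀ (pow_ne_zero 2 hδ) (by linear_combination -g4)
  have hL : L = 2 * M' * d * δ + L' * δ - δ * M' * d :=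
    mul_left_cancel₀ hδ (by linear_combination -f2 - d * hM)
  refine ⟨hM, hK, mul_left_cancel₀ hδ ?_, mul_left_cancel₀ (pow_ne_zero 2 hδ) ?_, fun h => ?_⟩
  · linear_combination -f1 - d * hL
  · linear_combination -g2 - d ^ 2 * hK
  · rw [hL, h]; ring

namespace TableRow

/-- The number of a row depends only on conditions that equivalence preserves: the vanishing of A² +
B², of M, of K and of K - 2M. -/
theorem number_eq_ite (r : TableRow) (hr : r.Valid) :
    r.number = if r.coefA ^ 2 + r.coefB ^ 2 ≠ 0 then (if r.coefM ≠ 0 then 1 else 2)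
      else if r.coefM ≠ 0 then (if r.coefK = 2 * r.coefM then 5 else 3)
      else if r.coefK ≠ 0 then 4 else 6 := by
  have hμ : ∀ μ : ℝ, μ = 1 ∨ μ = -1 → μ ≠ 0 := by
    rintro μ (rfl | rfl) <;> norm_num
  cases r with
  | case1 α β μ => simp [number, coefA, coefB, coefM, hr.2, hμ μ hr.1]
  | case2 α β => simp [number, coefA, coefB, coefM, show α ^ 2 + β ^ 2 ≠ 0 from hr]
  | case3 μ γ => simp [number, coefA, coefB, coefM, coefK, hr.2, hμ μ hr.1]
  | case4 l γ => simp [number, coefA, coefB, coefM, coefK, hr.2]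
  | case5 μ => simp [number, coefA, coefB, coefM, coefK, hμ μ hr]
  | case6 l => simp [number, coefA, coefB, coefM, coefK]

theorem normalized_eq (r : TableRow) : r.normalized = r.coefM + r.coefL := by
  cases r <;> simp [normalized, coefM, coefL]

theorem coef_values (r : TableRow) (hr : r.Valid) :
    (r.coefM = 1 ∨ r.coefM = -1) ∧ r.coefL = 0 ∨ r.coefM = 0 ∧ (r.coefL = 0 ∨ r.coefL = 1) := by
  cases r with
  | case1 α β μ => exact Or.inl ⟨hr.1, rfl⟩
  | case2 α β => exact Or.inr ⟨rfl, Or.inl rfl⟩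
  | case3 μ γ => exact Or.inl ⟨hr.1, rfl⟩
  | case4 l γ => exact Or.inr ⟨rfl, hr.1⟩
  | case5 μ => exact Or.inl ⟨hr, rfl⟩
  | case6 l => exact Or.inr ⟨rfl, hr⟩

/-- Since δ² > 0, the sign M = ±1 is preserved; since δ ≠ 0, the values L = 0 and L = 1 cannot be
exchanged when M = 0. -/
theorem number_eq_of_gEquiv {I I' : Set ℝ} (hI : IsOpenInterval I) {r r' : TableRow}
    (hr : r.Valid) (hr' : r'.Valid) (h : GEquiv I r.F r.H I' r'.F r'.H) :
    r.number = r'.number ∧ r.normalized = r'.normalized := by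
  obtain ⟨δ, d, hδ, -, hFH⟩ := h
  rw [F_eq_normalF, H_eq_normalH, F_eq_normalF, H_eq_normalH] at hFH
  obtain ⟨hM, hK, hA, hB, hL⟩ := normal_form_invariants hI hδ (fun x hx => (hFH x hx).1)
    fun x hx => (hFH x hx).2
  have hδ2 : δ ^ 2 ≠ 0 := pow_ne_zero 2 hδ
  constructor
  · have h1 : r.coefM ≠ 0 ↔ r'.coefM ≠ 0 := by rw [hM]; simp [hδ]
    have h2 : r.coefK ≠ 0 ↔ r'.coefK ≠ 0 := by rw [hK]; simp [hδ]
    have h3 : r.coefK = 2 * r.coefM ↔ r'.coefK = 2 * r'.coefM := by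
      rw [hM, hK]
      constructor
      · intro h
        exact mul_left_cancel₀ hδ2 (by linear_combination h)
      · intro h
        linear_combination δ ^ 2 * h
    rw [number_eq_ite r hr, number_eq_ite r' hr', hA, hB]
    simp only [h1, h2, h3]
  · have hpos : 0 < δ ^ 2 := by positivity
    rw [normalized_eq, normalized_eq]
    rcases coef_values r hr with ⟨h1, h2⟩ | ⟨h1, h2⟩ <;>
      rcases coef_values r' hr' with ⟨h1', h2'⟩ | ⟨h1', h2'⟩
    · rw [h2, h2']
      rcases h1 with h1 | h1 <;> rcases h1' with h1' | h1' <;> rw [h1, h1'] at hM ⊢ <;> linarith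
    · rw [h1'] at hM
      rcases h1 with h1 | h1 <;> rw [h1] at hM <;> linarith
    · rw [h1] at hM
      rcases h1' with h1' | h1' <;> rw [h1'] at hM <;> linarith
    · have hL' := hL h1'
      rw [h1, h1']
      rcases h2 with h2 | h2 <;> rcases h2' with h2' | h2' <;> rw [h2, h2'] at hL' ⊢
      · exact absurd (by linarith) hδ
      · linarith

end TableRow

/-! ### Second order jets of transformed functions -/

theorem fderiv_pair (W : ℝ × ℝ → ℝ) (y : ℝ × ℝ) (a b : ℝ) :
    fderiv ℝ W y (a, b) = pdt W y * a + pdx W y * b := by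
  have : ((a, b) : ℝ × ℝ) = a • (1, 0) + b • (0, 1) := by simp
  rw [this, map_add, map_smul, map_smul, pdt, pdx, smul_eq_mul, smul_eq_mul]
  ring

theorem ContDiffAt.pdt {W : ℝ × ℝ → ℝ} {y : ℝ × ℝ} (h : ContDiffAt ℝ ∞ W y) :
    ContDiffAt ℝ ∞ (pdt W) y := (h.fderiv_right (m := ∞) (by simp)).clm_apply contDiffAt_const

theorem ContDiffAt.pdx {W : ℝ × ℝ → ℝ} {y : ℝ × ℝ} (h : ContDiffAt ℝ ∞ W y) :
    ContDiffAt ℝ ∞ (pdx W) y := (h.fderiv_right (m := ∞) (by simp)).clm_apply contDiffAt_const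

theorem ContDiffAt.eventually_differentiableAt {E : Type*} [NormedAddCommGroup E]
    [NormedSpace ℝ E] {W : E → ℝ} {y : E} (h : ContDiffAt ℝ ∞ W y) :
    ∀ᶠ w in 𝓝 y, DifferentiableAt ℝ W w := by
  filter_upwards [(h.of_le (m := 1) (by norm_num)).eventually (by simp)] with w hw
  exact hw.differentiableAt (by simp)

/-- The chain rule, to second order, for a function of two variables along a curve. -/
theorem chain_rule_two {W : ℝ × ℝ → ℝ} {α β γ α' β' γ' : ℝ → ℝ} {α₂ β₂ γ₂ : ℝ}
    (hW : ContDiffAt ℝ ∞ W (α 0, β 0)) (hα : ∀ᶠ s in 𝓝 0, HasDerivAt α (α' s) s)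
    (hβ : ∀ᶠ s in 𝓝 0, HasDerivAt β (β' s) s) (hγ : ∀ᶠ s in 𝓝 0, HasDerivAt γ (γ' s) s)
    (hα' : HasDerivAt α' α₂ 0) (hβ' : HasDerivAt β' β₂ 0) (hγ' : HasDerivAt γ' γ₂ 0)
    (h : ∀ᶠ s in 𝓝 0, W (α s, β s) = γ s) :
    pdt W (α 0, β 0) * α' 0 + pdx W (α 0, β 0) * β' 0 = γ' 0 ∧
      (α' 0 = 0 → pdt W (α 0, β 0) * α₂ + pdx (pdx W) (α 0, β 0) * β' 0 ^ 2
        + pdx W (α 0, β 0) * β₂ = γ₂) := by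
  have hc : HasDerivAt (fun s => (α s, β s)) (α' 0, β' 0) 0 :=
    hα.self_of_nhds.prodMk hβ.self_of_nhds
  have hWd : ∀ᶠ s in 𝓝 0, DifferentiableAt ℝ W (α s, β s) :=
    hc.continuousAt.eventually hW.eventually_differentiableAt
  have h1 : (fun s => pdt W (α s, β s) * α' s + pdx W (α s, β s) * β' s) =ᶠ[𝓝 0] γ' := by
    filter_upwards [hα, hβ, hγ, hWd, h.eventually_nhds] with s h1 h2 h3 h4 h5
    have := h4.hasFDerivAt.comp_hasDerivAt s (h1.prodMk h2)
    rw [fderiv_pair] at this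
    exact this.unique (h3.congr_of_eventuallyEq h5)
  -- When the curve starts in a purely spatial direction, W_tt and the mixed derivatives drop out of
  -- its second derivative and only W_xx remains.
  refine ⟨h1.self_of_nhds, fun h0 => ?_⟩
  have d1 := (hW.pdt.differentiableAt (by simp)).hasFDerivAt.comp_hasDerivAt 0 hc
  have d2 := (hW.pdx.differentiableAt (by simp)).hasFDerivAt.comp_hasDerivAt 0 hc
  have d3 := ((d1.mul hα').add (d2.mul hβ')).unique (hγ'.congr_of_eventuallyEq h1)
  simp only [fderiv_pair, h0, Function.comp] at d3
  linear_combination d3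

/-- First and second derivatives of a function along a quadratic curve. -/
theorem hasDerivAt_along_curve {f : J0 → ℝ} {z : J0} (hf : ContDiffAt ℝ ∞ f z) (w κ : J0) :
    (∀ᶠ s in 𝓝 (0 : ℝ), HasDerivAt (fun s : ℝ => f (z + s • w + s ^ 2 • κ))
        (fderiv ℝ f (z + s • w + s ^ 2 • κ) (w + (2 * s) • κ)) s) ∧
      HasDerivAt (fun s : ℝ => fderiv ℝ f (z + s • w + s ^ 2 • κ) (w + (2 * s) • κ))
        (D2 f z w w + 2 * fderiv ℝ f z κ) 0 := by
  have hc : ∀ s : ℝ, HasDerivAt (fun s : ℝ => z + s • w + s ^ 2 • κ) (w + (2 * s) • κ) s := by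
    intro s
    have h1 := ((hasDerivAt_id s).smul_const w).const_add z
    have h2 := (hasDerivAt_pow 2 s).smul_const κ
    exact (h1.add h2).congr_deriv (by simp)
  have hc0 : z + (0 : ℝ) • w + (0 : ℝ) ^ 2 • κ = z := by simp
  constructor
  · have : ∀ᶠ s in 𝓝 (0 : ℝ), DifferentiableAt ℝ f (z + s • w + s ^ 2 • κ) :=
      (hc 0).continuousAt.eventually (by simpa using hf.eventually_differentiableAt)
    filter_upwards [this] with s hs
    exact hs.hasFDerivAt.comp_hasDerivAt s (hc s)
  · have h1 : HasFDerivAt (fderiv ℝ f) (fderiv ℝ (fderiv ℝ f) z)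
        (z + (0 : ℝ) • w + (0 : ℝ) ^ 2 • κ) := by rw [hc0]; exact hf.hasFDerivAt_fderiv
    have h2 := h1.comp_hasDerivAt 0 (hc 0)
    have h3 : HasDerivAt (fun s : ℝ => w + (2 * s) • κ) ((2 : ℝ) • κ) 0 := by
      have := (((hasDerivAt_id (0 : ℝ)).const_mul 2).smul_const κ).const_add w
      simpa using this
    refine (h2.clm_apply h3).congr_deriv ?_
    simp [D2]

/-- How a transformation that maps one equation to another acts on the second order jets of
quadratic polynomials. -/
theorem MapsEquation.exists_jet {Ω : Set J0} (hΩ : IsOpen Ω) {φ : J0 → J0}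
    (hφ : ContDiffOn ℝ ∞ φ Ω) {ε : ℝ} {F H : ℝ → ℝ} {ε' : ℝ} {F' H' : ℝ → ℝ}
    (hm : MapsEquation Ω φ ε F H ε' F' H') {z : J0} (hz : z ∈ Ω) (a c e g : ℝ) :
    let T : J0 → ℝ := fun z => (φ z).1
    let X : J0 → ℝ := fun z => (φ z).2.1
    let U : J0 → ℝ := fun z => (φ z).2.2
    let Tt := fderiv ℝ T z (1, 0, a)
    let Tx := fderiv ℝ T z (0, 1, c)
    let Δ := Tt * fderiv ℝ X z (0, 1, c) - Tx * fderiv ℝ X z (1, 0, a)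
    let w : J0 := (-Tx, Tt, a * -Tx + c * Tt)
    let k := e * Tx ^ 2 + g * Tt ^ 2
    Δ ≠ 0 → ∃ A B C : ℝ,
      fderiv ℝ U z (1, 0, a) = A * Tt + B * fderiv ℝ X z (1, 0, a) ∧
      fderiv ℝ U z (0, 1, c) = A * Tx + B * fderiv ℝ X z (0, 1, c) ∧
      D2 U z w w + 2 * k * fderiv ℝ U z (0, 0, 1) = C * Δ ^ 2
        + A * (D2 T z w w + 2 * k * fderiv ℝ T z (0, 0, 1))
        + B * (D2 X z w w + 2 * k * fderiv ℝ X z (0, 0, 1)) ∧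
      (a = 2 * g + F z.2.1 * c + ε * Real.exp z.2.2 + H z.2.1 ↔
        A = C + F' (X z) * B + ε' * Real.exp (U z) + H' (X z)) := by
  intro T X U Tt Tx Δ w k hΔ
  have hφz := hφ.contDiffAt (hΩ.mem_nhds hz)
  have hT : ContDiffAt ℝ ∞ T z := hφz.fst
  have hX : ContDiffAt ℝ ∞ X z := hφz.snd.fst
  have hU : ContDiffAt ℝ ∞ U z := hφz.snd.snd
  -- The test function has v_t = a, v_x = c, v_tt = 2e, v_tx = 0 and v_xx = 2g at the base point.
  set u : ℝ × ℝ → ℝ := fun q => z.2.2 + a * (q.1 - z.1) + c * (q.2 - z.2.1)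
    + e * (q.1 - z.1) ^ 2 + g * (q.2 - z.2.1) ^ 2 with hu
  have cu : ContDiff ℝ ∞ u := by fun_prop
  have du : ∀ q : ℝ × ℝ, ∀ d, fderiv ℝ u q d
      = (a + 2 * e * (q.1 - z.1)) * d.1 + (c + 2 * g * (q.2 - z.2.1)) * d.2 := by
    intro q d
    have i1 : HasFDerivAt (fun y : ℝ × ℝ => y) (ContinuousLinearMap.id ℝ (ℝ × ℝ)) q :=
      hasFDerivAt_id q
    have := (((((i1.fst.sub_const z.1).const_mul a).const_add z.2.2).add
      ((i1.snd.sub_const z.2.1).const_mul c)).add (((i1.fst.sub_const z.1).pow 2).const_mul e)).add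
      (((i1.snd.sub_const z.2.1).pow 2).const_mul g)
    have h' : fderiv ℝ u q = _ := this.fderiv
    rw [h']
    simp
    ring
  set p : ℝ × ℝ := (z.1, z.2.1) with hp
  have up : u p = z.2.2 := by simp [hu, hp]
  set Γ : ℝ × ℝ → J0 := fun q => (q.1, q.2, u q) with hΓ
  have Γp : Γ p = z := by simp only [hΓ, up]; rfl
  have cΓ : ContDiff ℝ ∞ Γ := contDiff_fst.prodMk (contDiff_snd.prodMk cu)
  set b : ℝ × ℝ → ℝ × ℝ := fun q => (T (Γ q), X (Γ q)) with hb
  have bp : b p = (T z, X z) := by simp only [hb, Γp]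
  have cb : ContDiffAt ℝ ∞ b p :=
    (ContDiffAt.comp p (g := T) (by rw [Γp]; exact hT) cΓ.contDiffAt).prodMk
      (ContDiffAt.comp p (g := X) (by rw [Γp]; exact hX) cΓ.contDiffAt)
  have dΓ : HasFDerivAt Γ (fderiv ℝ Γ p) p := (cΓ.differentiable (by simp) p).hasFDerivAt
  have dΓ' : ∀ d : ℝ × ℝ, fderiv ℝ Γ p d = d.1 • ((1, 0, a) : J0) + d.2 • ((0, 1, c) : J0) := by
    intro d
    have : HasFDerivAt Γ _ p :=
      hasFDerivAt_fst.prodMk (hasFDerivAt_snd.prodMk (cu.differentiable (by simp) p).hasFDerivAt)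
    rw [this.fderiv]
    simp [du, hp]
    ring
  have hbd := cb.differentiableAt (by simp) |>.hasFDerivAt
  have db : ∀ d : ℝ × ℝ, fderiv ℝ b p d = (fderiv ℝ T z (fderiv ℝ Γ p d),
      fderiv ℝ X z (fderiv ℝ Γ p d)) := by
    intro d
    have h1 : HasFDerivAt T (fderiv ℝ T z) (Γ p) := by
      rw [Γp]; exact (hT.differentiableAt (by simp)).hasFDerivAt
    have h2 : HasFDerivAt X (fderiv ℝ X z) (Γ p) := by
      rw [Γp]; exact (hX.differentiableAt (by simp)).hasFDerivAt
    have : HasFDerivAt b _ p := (h1.comp p dΓ).prodMk (h2.comp p dΓ)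
    rw [this.fderiv]
    rfl
  have hinj : Function.Injective (fderiv ℝ b p) := by
    rw [injective_iff_map_eq_zero]
    intro d hd
    rw [db, dΓ', map_add, map_smul, map_smul, map_add, map_smul, map_smul] at hd
    obtain ⟨h1, h2⟩ := Prod.ext_iff.1 hd
    simp only [smul_eq_mul, Prod.fst_zero, Prod.snd_zero] at h1 h2
    have e1 : d.1 * Δ = 0 := by
      simp only [Δ, Tt, Tx]
      linear_combination fderiv ℝ X z (0, 1, c) * h1 - fderiv ℝ T z (0, 1, c) * h2
    have e2 : d.2 * Δ = 0 := by
      simp only [Δ, Tt, Tx]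
      linear_combination fderiv ℝ T z (1, 0, a) * h2 - fderiv ℝ X z (1, 0, a) * h1
    exact Prod.ext ((mul_eq_zero.1 e1).resolve_right hΔ) ((mul_eq_zero.1 e2).resolve_right hΔ)
  have hsurj : Function.Surjective (fderiv ℝ b p) :=
    (LinearMap.injective_iff_surjective (f := (fderiv ℝ b p).toLinearMap)).1 hinj
  -- Since Δ ≠ 0, the inverse function theorem inverts the induced map b near p; composing with the
  -- local inverse yields the transformed function u'.
  set E := ContinuousLinearEquiv.ofBijective (fderiv ℝ b p) (LinearMap.ker_eq_bot.2 hinj)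
    (LinearMap.range_eq_top.2 hsurj) with hE
  have hbE : HasFDerivAt b (E : (ℝ × ℝ) →L[ℝ] ℝ × ℝ) p := by
    rw [hE, ContinuousLinearEquiv.coe_ofBijective]; exact hbd
  set R := cb.localInverse hbE (by simp) with hR
  have hRp : R (b p) = p := cb.localInverse_apply_image hbE (by simp)
  have cR : ContDiffAt ℝ ∞ R (b p) := cb.to_localInverse hbE (by simp)
  have evR : ∀ᶠ q in 𝓝 p, R (b q) = q :=
    (cb.hasStrictFDerivAt' hbE (by simp)).eventually_left_inverse
  set u' : ℝ × ℝ → ℝ := fun y => U (Γ (R y)) with hu'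
  have cu' : ContDiffAt ℝ ∞ u' (b p) := by
    have h1 : ContDiffAt ℝ ∞ (fun y => Γ (R y)) (b p) := cΓ.contDiffAt.comp _ cR
    exact ContDiffAt.comp (b p) (g := U) (by rw [hRp, Γp]; exact hU) h1
  have evu : ∀ᶠ q in 𝓝 p, u' (b q) = U (Γ q) := by
    filter_upwards [evR] with q hq
    simp only [hu', hq]
  have hiff := hm u u' b p (by rw [← Γp] at hz; exact hz) cu.contDiffAt (fun _ => rfl)
    ⟨hinj, hsurj⟩ cu' evu
  have curve : ∀ d : ℝ × ℝ, ∀ s : ℝ, Γ (p + s • d) = z + s • (d.1, d.2, a * d.1 + c * d.2)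
      + s ^ 2 • (0, 0, e * d.1 ^ 2 + g * d.2 ^ 2) := by
    intro d s
    refine Prod.ext ?_ (Prod.ext ?_ ?_)
    · simp [hΓ, hp]
    · simp [hΓ, hp]
    · simp [hΓ, hp, hu]
      ring
  have chain : ∀ d : ℝ × ℝ, ∀ θ κ : J0, θ = (d.1, d.2, a * d.1 + c * d.2) →
      κ = (0, 0, e * d.1 ^ 2 + g * d.2 ^ 2) →
      pdt u' (b p) * fderiv ℝ T z θ + pdx u' (b p) * fderiv ℝ X z θ = fderiv ℝ U z θ ∧
      (fderiv ℝ T z θ = 0 → pdt u' (b p) * (D2 T z θ θ + 2 * fderiv ℝ T z κ)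
        + pdx (pdx u') (b p) * fderiv ℝ X z θ ^ 2
        + pdx u' (b p) * (D2 X z θ θ + 2 * fderiv ℝ X z κ)
        = D2 U z θ θ + 2 * fderiv ℝ U z κ) := by
    intro d θ κ hθ hκ
    obtain ⟨t1, t2⟩ := hasDerivAt_along_curve hT θ κ
    obtain ⟨x1, x2⟩ := hasDerivAt_along_curve hX θ κ
    obtain ⟨u1, u2⟩ := hasDerivAt_along_curve hU θ κ
    have := chain_rule_two (W := u') (by simpa [bp] using cu') t1 x1 u1 t2 x2 u2 (by
      have hl : Tendsto (fun s : ℝ => p + s • d) (𝓝 0) (𝓝 p) := by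
        have : Continuous fun s : ℝ => p + s • d := by fun_prop
        simpa using this.tendsto 0
      filter_upwards [hl.eventually evu] with s hs
      rw [hθ, hκ, ← curve]
      exact hs)
    simpa [← bp] using this
  have hκ : ∀ (f : J0 → ℝ) (k : ℝ), fderiv ℝ f z (0, 0, k) = k * fderiv ℝ f z (0, 0, 1) :=
    fun f k => by rw [fderiv_apply_triple]; ring
  have hθ : ∀ f : J0 → ℝ, fderiv ℝ f z w
      = -Tx * fderiv ℝ f z (1, 0, a) + Tt * fderiv ℝ f z (0, 1, c) := fun f => by
    have : w = -Tx • ((1, 0, a) : J0) + Tt • ((0, 1, c) : J0) := by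
      simp [w]; ring
    rw [this, map_add, map_smul, map_smul, smul_eq_mul, smul_eq_mul]
  -- A, B, C are ũ_t, ũ_x, ũ_xx at the image point. The first two relations come from the curves
  -- along t and x, the third from the curve along (-Tx, Tt), on which T is stationary to first
  -- order.
  refine ⟨pdt u' (b p), pdx u' (b p), pdx (pdx u') (b p), ?_, ?_, ?_, ?_⟩
  · exact (chain (1, 0) (1, 0, a) _ (by simp) rfl).1.symm
  · exact (chain (0, 1) (0, 1, c) _ (by simp) rfl).1.symm
  · have := (chain (-Tx, Tt) w (0, 0, k) (by simp [w]) (by simp [k])).2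
      (by rw [hθ]; simp only [Tt, Tx]; ring)
    have hXw : fderiv ℝ X z w = Δ := by rw [hθ]; simp only [Δ]; ring
    rw [hκ T, hκ X, hκ U, hXw] at this
    linear_combination -this
  · have hpp : pdt u p = a := by simp [pdt, du, hp]
    have hpx : pdx u p = c := by simp [pdx, du, hp]
    have hpxx : pdx (pdx u) p = 2 * g := by
      have : pdx u = fun q => c + 2 * g * (q.2 - z.2.1) := by funext q; simp [pdx, du]
      rw [this]
      have h3 : HasFDerivAt (fun q : ℝ × ℝ => c + 2 * g * (q.2 - z.2.1)) _ p :=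
        (((hasFDerivAt_snd (𝕜 := ℝ) (p := p)).sub_const z.2.1).const_mul (2 * g)).const_add c
      rw [pdx, h3.fderiv]
      simp
    have hub : u' (T z, X z) = U z := by rw [← bp]; simp only [hu', hRp, Γp]
    simp only [eqn, jet2, hpp, hpx, hpxx, up, bp, hub] at hiff
    rw [bp]
    constructor
    · intro h
      have := hiff.1 (by rw [h]; ring)
      linarith
    · intro h
      have := hiff.2 (by rw [h]; ring)
      linarith

/-! ### The usual equivalence group: necessity -/

/-- The differentials of the components of a nondegenerate transformation are independent. -/
theorem differentials_independent {φ : J0 → J0} {z : J0} (hφ : DifferentiableAt ℝ φ z)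
    (hb : Function.Bijective (fderiv ℝ φ z)) {r₁ r₂ r₃ : ℝ}
    (h : ∀ e ∈ ({(1, 0, 0), (0, 1, 0), (0, 0, 1)} : Set J0),
      r₁ * fderiv ℝ (fun z => (φ z).1) z e + r₂ * fderiv ℝ (fun z => (φ z).2.1) z e
        + r₃ * fderiv ℝ (fun z => (φ z).2.2) z e = 0) : r₁ = 0 ∧ r₂ = 0 ∧ r₃ = 0 := by
  have i := hφ.hasFDerivAt
  have e1 : ∀ d, fderiv ℝ (fun z => (φ z).1) z d = (fderiv ℝ φ z d).1 := fun d => by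
    rw [i.fst.fderiv]; rfl
  have e2 : ∀ d, fderiv ℝ (fun z => (φ z).2.1) z d = (fderiv ℝ φ z d).2.1 := fun d => by
    rw [i.snd.fst.fderiv]; rfl
  have e3 : ∀ d, fderiv ℝ (fun z => (φ z).2.2) z d = (fderiv ℝ φ z d).2.2 := fun d => by
    rw [i.snd.snd.fderiv]; rfl
  have key : ∀ d : J0, r₁ * (fderiv ℝ φ z d).1 + r₂ * (fderiv ℝ φ z d).2.1
      + r₃ * (fderiv ℝ φ z d).2.2 = 0 := by
    rintro ⟨a, b, c⟩
    have h1 := h (1, 0, 0) (by simp)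
    have h2 := h (0, 1, 0) (by simp)
    have h3 := h (0, 0, 1) (by simp)
    rw [← e1, ← e2, ← e3, fderiv_apply_triple, fderiv_apply_triple (fun z => (φ z).2.1),
      fderiv_apply_triple (fun z => (φ z).2.2)]
    linear_combination a * h1 + b * h2 + c * h3
  obtain ⟨d1, h1⟩ := hb.2 (1, 0, 0)
  obtain ⟨d2, h2⟩ := hb.2 (0, 1, 0)
  obtain ⟨d3, h3⟩ := hb.2 (0, 0, 1)
  have k1 := key d1
  have k2 := key d2
  have k3 := key d3
  rw [h1] at k1
  rw [h2] at k2
  rw [h3] at k3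
  simp at k1 k2 k3
  exact ⟨k1, k2, k3⟩

section Necessity

variable {Ω : Set J0} {φ : J0 → J0} {ε : ℝ} {F H : ℝ → ℝ} {ε' : ℝ} {F' H' : ℝ → ℝ} {z : J0}

/-- The transformed time does not depend on `x` and `v` along the direction `(0, 1, c)`. -/
theorem MapsEquation.time_horizontal_eq_zero (hΩ : IsOpen Ω) (hφ : ContDiffOn ℝ ∞ φ Ω)
    (hm : MapsEquation Ω φ ε F H ε' F' H') (hz : z ∈ Ω)
    (hb : Function.Bijective (fderiv ℝ φ z)) (a c : ℝ)
    (hΔ : fderiv ℝ (fun z => (φ z).1) z (1, 0, a) * fderiv ℝ (fun z => (φ z).2.1) z (0, 1, c)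
      - fderiv ℝ (fun z => (φ z).1) z (0, 1, c) * fderiv ℝ (fun z => (φ z).2.1) z (1, 0, a) ≠ 0) :
    fderiv ℝ (fun z => (φ z).1) z (0, 1, c) = 0 := by
  -- This g places the jet on the source equation for every value of v_tt. The two test functions, e
  -- = 0 and e = 1, differ only in v_tt.
  set g := (a - F z.2.1 * c - ε * Real.exp z.2.2 - H z.2.1) / 2 with hg
  have ha : a = 2 * g + F z.2.1 * c + ε * Real.exp z.2.2 + H z.2.1 := by rw [hg]; ring
  obtain ⟨A, B, C, h1, h2, h3, h4⟩ := hm.exists_jet hΩ hφ hz a c 0 g hΔ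
  obtain ⟨A', B', C', h1', h2', h3', h4'⟩ := hm.exists_jet hΩ hφ hz a c 1 g hΔ
  replace h4 := h4.1 ha
  replace h4' := h4'.1 ha
  have hA : A' = A := by
    refine sub_eq_zero.1 ((mul_eq_zero.1 ?_).resolve_right hΔ)
    linear_combination fderiv ℝ (fun z => (φ z).2.1) z (0, 1, c) * (h1 - h1')
      - fderiv ℝ (fun z => (φ z).2.1) z (1, 0, a) * (h2 - h2')
  have hB : B' = B := by
    refine sub_eq_zero.1 ((mul_eq_zero.1 ?_).resolve_right hΔ)
    linear_combination fderiv ℝ (fun z => (φ z).1) z (1, 0, a) * (h2 - h2')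
      - fderiv ℝ (fun z => (φ z).1) z (0, 1, c) * (h1 - h1')
  subst hA hB
  -- Equal first derivatives and the target equation force equal ũ_xx.
  have hC : C' = C := by linarith
  subst hC
  by_contra hT
  -- The second order relations for e = 0 and e = 1 differ by 2 (D_x T)² (U_v - A T_v - B X_v). If
  -- D_x T ≠ 0, this and the first order relations give dU = A dT + B dX, against nondegeneracy.
  have hv : fderiv ℝ (fun z => (φ z).2.2) z (0, 0, 1)
      = A' * fderiv ℝ (fun z => (φ z).1) z (0, 0, 1)
        + B' * fderiv ℝ (fun z => (φ z).2.1) z (0, 0, 1) := by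
    refine mul_left_cancel₀ (pow_ne_zero 2 hT) ?_
    linear_combination (h3' - h3) / 2
  rw [fderiv_apply_triple, fderiv_apply_triple (fun z => (φ z).1),
    fderiv_apply_triple (fun z => (φ z).2.1)] at h1 h2
  have := differentials_independent ((hφ.contDiffAt (hΩ.mem_nhds hz)).differentiableAt (by simp)) hb
    (r₁ := A') (r₂ := B') (r₃ := -1) (by
      rintro e (rfl | rfl | rfl)
      · linear_combination a * hv - h1
      · linear_combination c * hv - h2
      · linear_combination -hv)
  linarith [this.2.2]

/-- The transformed time does not depend on `x` and `v`. -/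
theorem MapsEquation.time_eq_zero (hΩ : IsOpen Ω) (hφ : ContDiffOn ℝ ∞ φ Ω)
    (hm : MapsEquation Ω φ ε F H ε' F' H') (hz : z ∈ Ω)
    (hb : Function.Bijective (fderiv ℝ φ z)) :
    fderiv ℝ (fun z => (φ z).1) z (0, 1, 0) = 0 ∧ fderiv ℝ (fun z => (φ z).1) z (0, 0, 1) = 0 := by
  have key : ∀ a c : ℝ, _ := hm.time_horizontal_eq_zero hΩ hφ hz hb
  have hind := fun r₁ r₂ r₃ => differentials_independent (r₁ := r₁) (r₂ := r₂) (r₃ := r₃)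
    ((hφ.contDiffAt (hΩ.mem_nhds hz)).differentiableAt (by simp)) hb
  simp only [mem_insert_iff, mem_singleton_iff, forall_eq_or_imp, forall_eq] at hind
  set Tt := fderiv ℝ (fun z => (φ z).1) z (1, 0, 0)
  set Tx := fderiv ℝ (fun z => (φ z).1) z (0, 1, 0)
  set Tv := fderiv ℝ (fun z => (φ z).1) z (0, 0, 1)
  set Xt := fderiv ℝ (fun z => (φ z).2.1) z (1, 0, 0)
  set Xx := fderiv ℝ (fun z => (φ z).2.1) z (0, 1, 0)
  set Xv := fderiv ℝ (fun z => (φ z).2.1) z (0, 0, 1)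
  replace key : ∀ a c : ℝ, (Tt + a * Tv) * (Xx + c * Xv) - (Tx + c * Tv) * (Xt + a * Xv) ≠ 0 →
      Tx + c * Tv = 0 := by
    have e1 : ∀ (f : J0 → ℝ) (a : ℝ), fderiv ℝ f z (1, 0, a)
        = fderiv ℝ f z (1, 0, 0) + a * fderiv ℝ f z (0, 0, 1) := fun f a => by
      rw [fderiv_apply_triple]; ring
    have e2 : ∀ (f : J0 → ℝ) (c : ℝ), fderiv ℝ f z (0, 1, c)
        = fderiv ℝ f z (0, 1, 0) + c * fderiv ℝ f z (0, 0, 1) := fun f c => by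
      rw [fderiv_apply_triple]; ring
    intro a c h
    have := key a c
    rw [e1 _ a, e1 (fun z => (φ z).2.1) a, e2 (fun z => (φ z).1) c,
      e2 (fun z => (φ z).2.1) c] at this
    exact this h
  have two : ∀ c c' : ℝ, c ≠ c' → Tx + c * Tv = 0 → Tx + c' * Tv = 0 → Tx = 0 ∧ Tv = 0 := by
    intro c c' hne h h'
    have hv : Tv = 0 := by
      refine (mul_eq_zero.1 ?_).resolve_left (sub_ne_zero.2 hne)
      linear_combination h - h'
    exact ⟨by rw [hv] at h; linarith, hv⟩
  -- The determinant Δ is m₀ + a m₁ + c m₂ with the minors m₀, m₁, m₂ of (dT, dX), because the terms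
  -- in ac cancel. The minors cannot all vanish, so Δ ≠ 0 is achieved for two values of c, with
  -- suitable a; that gives Tx = Tv = 0.
  by_cases m1 : Tv * Xx - Tx * Xv = 0
  · by_cases m2 : Tt * Xv - Tv * Xt = 0
    · by_cases m0 : Tt * Xx - Tx * Xt = 0
      · by_contra
        have i1 := hind Xt (-Tt) 0 ⟨by ring, by linear_combination -m0, by linear_combination -m2⟩
        have i2 := hind Xx (-Tx) 0 ⟨by linear_combination m0, by ring, by linear_combination m1⟩
        have i3 := hind Xv (-Tv) 0 ⟨by linear_combination m2, by linear_combination -m1, by ring⟩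
        have i4 := hind 1 0 0 ⟨by linarith [i1.2.1], by linarith [i2.2.1], by linarith [i3.2.1]⟩
        exact one_ne_zero i4.1
      · have h0 := key 0 0 (fun h => m0 (by linear_combination h))
        by_cases h1 : Tt * Xx - Tx * Xt + (Tt * Xv - Tv * Xt) = 0
        · exact (m0 (by rw [m2] at h1; linarith)).elim
        · exact two 0 1 (by norm_num) h0 (key 0 1 (fun h => h1 (by linear_combination h)))
    · by_cases h0 : Tt * Xx - Tx * Xt = 0
      · exact two 1 2 (by norm_num) (key 0 1 fun h => m2 (by linear_combination h - h0))
          (key 0 2 fun h => m2 (by linear_combination (h - h0) / 2))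
      · have k0 := key 0 0 (fun h => h0 (by linear_combination h))
        by_cases h1 : Tt * Xx - Tx * Xt + (Tt * Xv - Tv * Xt) = 0
        · exact two 0 2 (by norm_num) k0
            (key 0 2 fun h => h0 (by linear_combination 2 * h1 - h))
        · exact two 0 1 (by norm_num) k0 (key 0 1 fun h => h1 (by linear_combination h))
  · have : ∀ c, Tx + c * Tv = 0 := by
      intro c
      by_cases h0 : Tt * (Xx + c * Xv) - (Tx + c * Tv) * Xt = 0
      · exact key 1 c fun h => m1 (by linear_combination h - h0)
      · exact key 0 c fun h => h0 (by linear_combination h)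
    exact two 0 1 (by norm_num) (this 0) (this 1)

/-- The action on jets when the transformed time only depends on time. -/
theorem MapsEquation.exists_jet_of_time (hΩ : IsOpen Ω) (hφ : ContDiffOn ℝ ∞ φ Ω)
    (hm : MapsEquation Ω φ ε F H ε' F' H')
    (hT : ∀ y ∈ Ω, fderiv ℝ (fun z => (φ z).1) y (0, 1, 0) = 0 ∧
      fderiv ℝ (fun z => (φ z).1) y (0, 0, 1) = 0) (hz : z ∈ Ω) (a c g : ℝ) :
    let X : J0 → ℝ := fun z => (φ z).2.1
    let U : J0 → ℝ := fun z => (φ z).2.2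
    let Tt := fderiv ℝ (fun z => (φ z).1) z (1, 0, 0)
    let Xh := fderiv ℝ X z (0, 1, 0) + c * fderiv ℝ X z (0, 0, 1)
    let h : J0 := (0, 1, c)
    Tt ≠ 0 → Xh ≠ 0 → a = 2 * g + F z.2.1 * c + ε * Real.exp z.2.2 + H z.2.1 → ∃ A B C : ℝ,
      fderiv ℝ U z (1, 0, 0) + a * fderiv ℝ U z (0, 0, 1)
        = A * Tt + B * (fderiv ℝ X z (1, 0, 0) + a * fderiv ℝ X z (0, 0, 1)) ∧
      fderiv ℝ U z (0, 1, 0) + c * fderiv ℝ U z (0, 0, 1) = B * Xh ∧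
      D2 U z h h + 2 * g * fderiv ℝ U z (0, 0, 1) = C * Xh ^ 2
        + B * (D2 X z h h + 2 * g * fderiv ℝ X z (0, 0, 1)) ∧
      A = C + F' (X z) * B + ε' * Real.exp (U z) + H' (X z) := by
  intro X U Tt Xh h hTt hXh ha
  have e1 : fderiv ℝ (fun z => (φ z).1) z (1, 0, a) = Tt := by
    rw [fderiv_apply_triple, (hT z hz).1, (hT z hz).2]; simp only [Tt]; ring
  have e2 : ∀ y ∈ Ω, fderiv ℝ (fun z => (φ z).1) y h = 0 := fun y hy => by
    simp only [h]; rw [fderiv_apply_triple, (hT y hy).1, (hT y hy).2]; ring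
  have e3 : fderiv ℝ X z h = Xh := by
    simp only [h, Xh]; rw [fderiv_apply_triple]; ring
  have e4 : D2 (fun z => (φ z).1) z h h = 0 := by
    rw [D2_eq_fderiv hΩ hφ.fst hz (g := fun _ => 0) e2]; simp
  obtain ⟨A, B, C, h1, h2, h3, h4⟩ := hm.exists_jet hΩ hφ hz a c 0 g (by
    rw [e1, show fderiv ℝ (fun z => (φ z).1) z (0, 1, c) = 0 from e2 z hz]
    have : fderiv ℝ (fun z => (φ z).2.1) z (0, 1, c) = Xh := e3
    rw [this, zero_mul, sub_zero]
    exact mul_ne_zero hTt hXh)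
  have ex : fderiv ℝ (fun z => (φ z).1) z (0, 1, c) = 0 := e2 z hz
  have ey : fderiv ℝ (fun z => (φ z).2.1) z (0, 1, c) = Xh := e3
  rw [e1, ex, ey] at h3
  rw [e1, fderiv_apply_triple, fderiv_apply_triple (fun z => (φ z).2.1)] at h1
  rw [ex, ey, fderiv_apply_triple] at h2
  have hw : ((-0, Tt, a * -0 + c * Tt) : J0) = Tt • h := by
    simp [h, mul_comm]
  rw [hw] at h3
  simp only [D2_smul_left, D2_smul_right, e4, (hT z hz).2] at h3
  refine ⟨A, B, C, by linear_combination h1, by linear_combination h2, ?_, h4.1 ha⟩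
  refine mul_left_cancel₀ (pow_ne_zero 2 hTt) ?_
  linear_combination h3

/-- The transformed space variable does not depend on `v`, and the square of its `x`-derivative is
the derivative of the transformed time. -/
theorem MapsEquation.space_deriv (hΩ : IsOpen Ω) (hφ : ContDiffOn ℝ ∞ φ Ω)
    (hm : MapsEquation Ω φ ε F H ε' F' H')
    (hT : ∀ y ∈ Ω, fderiv ℝ (fun z => (φ z).1) y (0, 1, 0) = 0 ∧
      fderiv ℝ (fun z => (φ z).1) y (0, 0, 1) = 0) (hz : z ∈ Ω)
    (hb : Function.Bijective (fderiv ℝ φ z)) :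
    fderiv ℝ (fun z => (φ z).1) z (1, 0, 0) ≠ 0 ∧
    fderiv ℝ (fun z => (φ z).2.1) z (0, 0, 1) = 0 ∧
      fderiv ℝ (fun z => (φ z).2.1) z (0, 1, 0) ^ 2 = fderiv ℝ (fun z => (φ z).1) z (1, 0, 0) := by
  have hind := fun r₁ r₂ r₃ => differentials_independent (r₁ := r₁) (r₂ := r₂) (r₃ := r₃)
    ((hφ.contDiffAt (hΩ.mem_nhds hz)).differentiableAt (by simp)) hb
  simp only [mem_insert_iff, mem_singleton_iff, forall_eq_or_imp, forall_eq, (hT z hz).1,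
    (hT z hz).2] at hind
  have hTt : fderiv ℝ (fun z => (φ z).1) z (1, 0, 0) ≠ 0 := fun h =>
    one_ne_zero (hind 1 0 0 ⟨by rw [h]; ring, by ring, by ring⟩).1
  have jets := hm.exists_jet_of_time hΩ hφ hT hz
  dsimp only at jets
  set Tt := fderiv ℝ (fun z => (φ z).1) z (1, 0, 0)
  set Xt := fderiv ℝ (fun z => (φ z).2.1) z (1, 0, 0)
  set Xx := fderiv ℝ (fun z => (φ z).2.1) z (0, 1, 0)
  set Xv := fderiv ℝ (fun z => (φ z).2.1) z (0, 0, 1)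
  set Ut := fderiv ℝ (fun z => (φ z).2.2) z (1, 0, 0)
  set Ux := fderiv ℝ (fun z => (φ z).2.2) z (0, 1, 0)
  set Uv := fderiv ℝ (fun z => (φ z).2.2) z (0, 0, 1)
  -- Raising g from 0 to 1 raises v_t by 2. The change of A, computed from the first order relation,
  -- and the equal change of C, computed from the second order one, have the same nonzero numerator
  -- 2 (U_v - B X_v).
  have key : ∀ c, Xx + c * Xv ≠ 0 → (Xx + c * Xv) ^ 2 = Tt := by
    intro c hc
    obtain ⟨A, B, C, h1, h2, h3, h4⟩ := jets _ c 0 hTt hc rfl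
    obtain ⟨A', B', C', h1', h2', h3', h4'⟩ := jets _ c 1 hTt hc rfl
    obtain rfl : B = B' := mul_right_cancel₀ hc (h2.symm.trans h2')
    have hM : Uv - B * Xv ≠ 0 := by
      intro h0
      have := hind ((Ut - B * Xt) / Tt) B (-1) ⟨by field_simp; ring,
        by linear_combination c * h0 - h2, by linear_combination -h0⟩
      linarith [this.2.2]
    have k1 : (A' - A) * Tt = 2 * (Uv - B * Xv) := by linear_combination h1 - h1'
    have k2 : (A' - A) * (Xx + c * Xv) ^ 2 = 2 * (Uv - B * Xv) := by
      have : A' - A = C' - C := by linarith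
      rw [this]
      linear_combination h3 - h3'
    have hne : A' - A ≠ 0 := by
      intro h0
      rw [h0, zero_mul] at k1
      exact hM (by linarith)
    exact mul_left_cancel₀ hne (k2.trans k1.symm)
  -- If Xv ≠ 0, a choice of c makes Xx + c Xv equal to 1 or to 2, while its square must be Tt.
  have hXv : Xv = 0 := by
    by_contra hne
    have c1 : Xx + (1 - Xx) / Xv * Xv = 1 := by field_simp; ring
    have c2 : Xx + (2 - Xx) / Xv * Xv = 2 := by field_simp; ring
    have k1 := key ((1 - Xx) / Xv) (by rw [c1]; norm_num)
    have k2 := key ((2 - Xx) / Xv) (by rw [c2]; norm_num)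
    rw [c1] at k1
    rw [c2] at k2
    linarith
  refine ⟨hTt, hXv, ?_⟩
  have hXx : Xx ≠ 0 := by
    intro h0
    have := hind (Xt / Tt) (-1) 0 ⟨by field_simp; ring, by rw [h0]; ring, by rw [hXv]; ring⟩
    linarith [this.2.1]
  have := key 0 (by simpa using hXx)
  simpa using this

end Necessity

section BoxConst

variable {J I V : Set ℝ}

/-- A function with vanishing partial derivatives on a box is constant. -/
theorem eq_of_partials_eq_zero (hJ : IsOpenInterval J) (hI : IsOpenInterval I)
    (hV : IsOpenInterval V) {f : J0 → ℝ} (hf : ContDiffOn ℝ ∞ f (box J I V))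
    (ht : ∀ z ∈ box J I V, fderiv ℝ f z (1, 0, 0) = 0)
    (hx : ∀ z ∈ box J I V, fderiv ℝ f z (0, 1, 0) = 0)
    (hv : ∀ z ∈ box J I V, fderiv ℝ f z (0, 0, 1) = 0) {z z' : J0} (hz : z ∈ box J I V)
    (hz' : z' ∈ box J I V) : f z = f z' := by
  refine (isOpen_box hJ hI hV).is_const_of_fderiv_eq_zero (𝕜 := ℝ)
    (convex_box hJ hI hV).isPreconnected (hf.differentiableOn (by simp)) (fun y hy => ?_) hz hz'
  refine ContinuousLinearMap.ext fun d => ?_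
  obtain ⟨a, b, c⟩ := d
  rw [fderiv_apply_triple, ht y hy, hx y hy, hv y hy]
  simp

/-- A transformed exponential that agrees with a multiple of an exponential up to a constant. -/
theorem eq_one_of_exp_eq (hV : IsOpenInterval V) {P K L m n : ℝ} (hP : P ≠ 0)
    (h : ∀ v ∈ V, P * Real.exp v = K * Real.exp (m * v + n) + L) :
    m = 1 ∧ K * Real.exp n = P := by
  have hd : ∀ (Q M v : ℝ), HasDerivAt (fun v => Q * Real.exp (m * v + n) + M)
      (Q * m * Real.exp (m * v + n)) v := by
    intro Q M v
    have h1 : HasDerivAt (fun v : ℝ => m * v + n) m v := by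
      simpa using ((hasDerivAt_id v).const_mul m).add_const n
    exact ((h1.exp.const_mul Q).add_const M).congr_deriv (by ring)
  have step : ∀ Q M : ℝ, (∀ v ∈ V, P * Real.exp v = Q * Real.exp (m * v + n) + M) →
      ∀ v ∈ V, P * Real.exp v = Q * m * Real.exp (m * v + n) + 0 := by
    intro Q M h v hv
    have h1 : (fun v => P * Real.exp v) =ᶠ[𝓝 v] fun v => Q * Real.exp (m * v + n) + M := by
      filter_upwards [hV.1.mem_nhds hv] with w hw using h w hw
    have := ((Real.hasDerivAt_exp v).const_mul P).unique ((hd Q M v).congr_of_eventuallyEq h1)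
    rw [this, add_zero]
  -- Differentiation removes L, and a second one produces another factor m; comparing the results
  -- gives m = 1.
  have s1 := step _ _ h
  have s2 := step _ _ s1
  obtain ⟨v, hv⟩ := hV.2.1
  have e1 := s1 v hv
  have e2 := s2 v hv
  have hne : P * Real.exp v ≠ 0 := mul_ne_zero hP (Real.exp_ne_zero v)
  have hm : m = 1 := by
    refine mul_left_cancel₀ hne ?_
    linear_combination m * e1 - e2
  subst hm
  refine ⟨rfl, mul_right_cancel₀ (Real.exp_ne_zero v) ?_⟩
  rw [one_mul, Real.exp_add] at e1
  linear_combination -e1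

end BoxConst

theorem D2_comm {f : J0 → ℝ} {z : J0} (hf : ContDiffAt ℝ ∞ f z) (a b : J0) :
    D2 f z a b = D2 f z b a :=
  (hf.isSymmSndFDerivAt (by
    simp only [minSmoothness_of_isRCLikeNormedField]
    exact WithTop.coe_le_coe.2 le_top)).eq a b

/-! ### Parameters of an equivalence transformation -/

section Group

variable {J I V : Set ℝ} {φ : J0 → J0} {Θ : J0 → ℝ × ℝ × ℝ → ℝ × ℝ × ℝ}

/-- The determining equations of the equivalence group that hold for every equation. -/
theorem IsEquivalenceTransformation.coeffs (hJ : IsOpenInterval J) (hI : IsOpenInterval I)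
    (hV : IsOpenInterval V) (hE : IsEquivalenceTransformation J I V φ Θ) :
    let T : J0 → ℝ := fun z => (φ z).1
    let X : J0 → ℝ := fun z => (φ z).2.1
    let U : J0 → ℝ := fun z => (φ z).2.2
    ∀ z ∈ box J I V,
      (fderiv ℝ T z (0, 1, 0) = 0 ∧ fderiv ℝ T z (0, 0, 1) = 0) ∧
      fderiv ℝ X z (0, 0, 1) = 0 ∧ fderiv ℝ X z (0, 1, 0) ≠ 0 ∧
      fderiv ℝ X z (0, 1, 0) ^ 2 = fderiv ℝ T z (1, 0, 0) ∧ fderiv ℝ U z (0, 0, 1) ≠ 0 ∧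
      D2 X z (0, 1, 0) (0, 1, 0) = 0 ∧ D2 X z (0, 0, 1) (0, 1, 0) = 0 ∧
      ∀ (ε : ℝ) (F H : ℝ → ℝ) (ε' : ℝ) (F' H' : ℝ → ℝ),
        MapsEquation (box J I V) φ ε F H ε' F' H' →
        D2 U z (0, 0, 1) (0, 0, 1) = 0 ∧
        (F z.2.1 - fderiv ℝ X z (1, 0, 0) / fderiv ℝ X z (0, 1, 0)
            - fderiv ℝ X z (0, 1, 0) * F' (X z)) * fderiv ℝ U z (0, 0, 1)
          = D2 U z (0, 1, 0) (0, 0, 1) + D2 U z (0, 0, 1) (0, 1, 0) ∧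
        fderiv ℝ U z (1, 0, 0)
            + (ε * Real.exp z.2.2 + H z.2.1) * fderiv ℝ U z (0, 0, 1)
            - fderiv ℝ U z (0, 1, 0) / fderiv ℝ X z (0, 1, 0) * fderiv ℝ X z (1, 0, 0)
            - D2 U z (0, 1, 0) (0, 1, 0)
          = fderiv ℝ X z (0, 1, 0) * F' (X z) * fderiv ℝ U z (0, 1, 0)
            + fderiv ℝ X z (0, 1, 0) ^ 2 * (ε' * Real.exp (U z) + H' (X z)) := by
  intro T X U
  have hΩ := isOpen_box hJ hI hV
  obtain ⟨hφ, hb, hcl⟩ := hE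
  obtain ⟨_, _, _, -, -, hm₀⟩ := hcl 1 (fun _ => 0) (fun _ => 0)
    ⟨Or.inl rfl, contDiffOn_const, contDiffOn_const⟩
  have hT := fun y hy => hm₀.time_eq_zero hΩ hφ hy (hb y hy)
  have hX := fun y hy => hm₀.space_deriv hΩ hφ hT hy (hb y hy)
  have cT : ContDiffOn ℝ ∞ T (box J I V) := hφ.fst
  have cX : ContDiffOn ℝ ∞ X (box J I V) := hφ.snd.fst
  obtain ⟨x₀, hx₀⟩ := hI.2.1
  obtain ⟨v₀, hv₀⟩ := hV.2.1
  intro z hz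
  obtain ⟨hTt, hXv, hXx⟩ := hX z hz
  have hXx0 : fderiv ℝ X z (0, 1, 0) ≠ 0 := by
    intro h0
    refine hTt ?_
    rw [← hXx]
    exact (pow_eq_zero_iff two_ne_zero).2 h0
  have hind := fun r₁ r₂ r₃ => differentials_independent (r₁ := r₁) (r₂ := r₂) (r₃ := r₃)
    ((hφ.contDiffAt (hΩ.mem_nhds hz)).differentiableAt (by simp)) (hb z hz)
  simp only [mem_insert_iff, mem_singleton_iff, forall_eq_or_imp, forall_eq, (hT z hz).1,
    (hT z hz).2, hXv] at hind
  have hUv : fderiv ℝ U z (0, 0, 1) ≠ 0 := by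
    intro h0
    have := hind ((fderiv ℝ U z (1, 0, 0) - fderiv ℝ U z (0, 1, 0) / fderiv ℝ X z (0, 1, 0)
      * fderiv ℝ X z (1, 0, 0)) / fderiv ℝ T z (1, 0, 0))
      (fderiv ℝ U z (0, 1, 0) / fderiv ℝ X z (0, 1, 0)) (-1)
      ⟨by
        rw [div_mul_cancel₀ _ hTt]
        simp only [X, U]
        ring, by
        rw [div_mul_cancel₀ _ hXx0]
        simp only [U]
        ring, by
        have : fderiv ℝ (fun z => (φ z).2.2) z (0, 0, 1) = 0 := h0
        rw [this]
        ring⟩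
    linarith [this.2.2]
  have hTd : ∀ e : J0, e.1 = 0 → fderiv ℝ (fun y => fderiv ℝ T y (1, 0, 0)) z e = 0 := by
    intro e he
    set T₀ : ℝ → ℝ := fun t => T (t, x₀, v₀) with hT₀
    have cT₀ : ContDiffOn ℝ ∞ T₀ J := contDiffOn_slice cT hx₀ hv₀
    have eT : ∀ y ∈ box J I V, T y = T₀ y.1 := fun y hy => eq_of_fderiv_xv_eq_zero hI hV
      (fun w hw => cT.differentiableAt_of_isOpen hΩ hw) (fun w hw => (hT w hw).1)
      (fun w hw => (hT w hw).2) hx₀ hv₀ hy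
    have : (fun y => fderiv ℝ T y (1, 0, 0)) =ᶠ[𝓝 z] fun y => deriv T₀ y.1 := by
      filter_upwards [hΩ.mem_nhds hz] with y hy
      have : T =ᶠ[𝓝 y] fun w => T₀ w.1 := by
        filter_upwards [hΩ.mem_nhds hy] with w hw using eT w hw
      rw [this.fderiv_eq, fderiv_comp_fst _ (cT₀.differentiableAt_isOpen hJ.1 hy.1), one_mul]
    rw [this.fderiv_eq, fderiv_comp_fst _
      ((cT₀.deriv_isOpen hJ.1).differentiableAt_isOpen hJ.1 hz.1), he, zero_mul]
  -- Differentiating X_x² = T_t, whose right side depends on t only, in a direction without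
  -- t-component gives 2 X_x times the second derivative of X.
  have hXd : ∀ e : J0, e.1 = 0 → D2 X z e (0, 1, 0) = 0 := by
    intro e he
    have h1 : (fun y => fderiv ℝ X y (0, 1, 0) ^ 2) =ᶠ[𝓝 z] fun y => fderiv ℝ T y (1, 0, 0) := by
      filter_upwards [hΩ.mem_nhds hz] with y hy using (hX y hy).2.2
    have h2 := ((cX.contDiffOn_fderiv_apply hΩ (0, 1, 0)).differentiableAt_of_isOpen hΩ
      hz).hasFDerivAt.pow 2
    have h3 := hTd e he
    rw [← h1.fderiv_eq, h2.fderiv] at h3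
    simp [fderiv_fderiv_apply (cX.contDiffAt_of_isOpen hΩ hz), hXx0] at h3
    exact h3
  have hXxx : ∀ c : ℝ, D2 X z (0, 1, c) (0, 1, c) = 0 := by
    intro c
    have h1 : ∀ e, D2 X z e (0, 0, 1) = 0 := fun e => by
      rw [D2_eq_fderiv hΩ cX hz (g := fun _ => 0) (fun y hy => (hX y hy).2.1)]; simp
    rw [D2_horizontal, h1, h1, hXd _ rfl, hXd _ rfl]
    ring
  refine ⟨hT z hz, hXv, hXx0, hXx, hUv, hXd _ rfl, hXd _ rfl, fun ε F H ε' F' H' hm => ?_⟩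
  have key : ∀ c : ℝ, fderiv ℝ U z (1, 0, 0)
      + (F z.2.1 * c + ε * Real.exp z.2.2 + H z.2.1) * fderiv ℝ U z (0, 0, 1)
      - (fderiv ℝ U z (0, 1, 0) + c * fderiv ℝ U z (0, 0, 1)) / fderiv ℝ X z (0, 1, 0)
        * fderiv ℝ X z (1, 0, 0)
      - (D2 U z (0, 1, 0) (0, 1, 0)
        + c * (D2 U z (0, 1, 0) (0, 0, 1) + D2 U z (0, 0, 1) (0, 1, 0))
        + c ^ 2 * D2 U z (0, 0, 1) (0, 0, 1))
      = fderiv ℝ X z (0, 1, 0) * F' (X z)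
          * (fderiv ℝ U z (0, 1, 0) + c * fderiv ℝ U z (0, 0, 1))
        + fderiv ℝ X z (0, 1, 0) ^ 2 * (ε' * Real.exp (U z) + H' (X z)) := by
    intro c
    have eh : fderiv ℝ X z (0, 1, 0) + c * fderiv ℝ X z (0, 0, 1) = fderiv ℝ X z (0, 1, 0) := by
      have : fderiv ℝ X z (0, 0, 1) = 0 := hXv
      rw [this]; ring
    obtain ⟨A, B, C, h1, h2, h3, h4⟩ := hm.exists_jet_of_time hΩ hφ hT hz
      (2 * 0 + F z.2.1 * c + ε * Real.exp z.2.2 + H z.2.1) c 0 hTt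
      (by rw [show _ = fderiv ℝ X z (0, 1, 0) from eh]; exact hXx0) rfl
    have h5 : D2 X z (0, 1, c) (0, 1, c) = 0 := hXxx c
    have h6 : fderiv ℝ X z (0, 0, 1) = 0 := hXv
    have h7 : fderiv ℝ X z (0, 1, 0) ^ 2 = fderiv ℝ T z (1, 0, 0) := hXx
    simp only [X] at h5 h6 h7 hXx0 ⊢
    rw [h6, ← h7] at h1
    rw [h6, mul_zero, add_zero] at h2
    rw [h5, h6, D2_horizontal] at h3
    have hB : (fderiv ℝ U z (0, 1, 0) + c * fderiv ℝ U z (0, 0, 1))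
        / fderiv ℝ (fun z => (φ z).2.1) z (0, 1, 0) = B := by
      rw [div_eq_iff hXx0]; exact h2
    rw [hB]
    have h2' : fderiv ℝ U z (0, 1, 0) + c * fderiv ℝ U z (0, 0, 1)
      = B * fderiv ℝ (fun z => (φ z).2.1) z (0, 1, 0) := h2
    rw [h2']
    simp only [U]
    linear_combination h1 - h3 + fderiv ℝ (fun z => (φ z).2.1) z (0, 1, 0) ^ 2 * h4
  -- The identity is quadratic in v_x; its values at 0, 1, -1 yield the three coefficients.
  have k0 := key 0
  have k1 := key 1
  have k2 := key (-1)
  refine ⟨?_, ?_, ?_⟩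
  · linear_combination k0 - k1 / 2 - k2 / 2
  · linear_combination (k1 - k2) / 2
  · linear_combination k0

theorem constPair_inClass {I : Set ℝ} {ε : ℝ} (hε : ε = 1 ∨ ε = -1) (p q : ℝ) :
    InClass I ε (fun _ => p) (fun _ => q) := ⟨hε, contDiffOn_const, contDiffOn_const⟩

/-- The transformation of the dependent variable. -/
theorem IsEquivalenceTransformation.dependent_eq (hJ : IsOpenInterval J) (hI : IsOpenInterval I)
    (hV : IsOpenInterval V) (hE : IsEquivalenceTransformation J I V φ Θ) {z : J0}
    (hz : z ∈ box J I V) :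
    (φ z).2.2 = z.2.2 - Real.log (fderiv ℝ (fun z => (φ z).1) z (1, 0, 0)) := by
  have hΩ := isOpen_box hJ hI hV
  have hco := hE.coeffs hJ hI hV
  dsimp only at hco
  obtain ⟨hφ, hb, hcl⟩ := hE
  obtain ⟨ε₁, F₁, H₁, hc₁, -, hm₁⟩ := hcl 1 _ _ (constPair_inClass (Or.inl rfl) 0 0)
  obtain ⟨ε₂, F₂, H₂, hc₂, -, hm₂⟩ := hcl (-1) _ _ (constPair_inClass (Or.inr rfl) 0 0)
  set T : J0 → ℝ := fun z => (φ z).1 with hT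
  set X : J0 → ℝ := fun z => (φ z).2.1 with hX
  set U : J0 → ℝ := fun z => (φ z).2.2 with hU
  have cT : ContDiffOn ℝ ∞ T (box J I V) := hφ.fst
  have cX : ContDiffOn ℝ ∞ X (box J I V) := hφ.snd.fst
  have cU : ContDiffOn ℝ ∞ U (box J I V) := hφ.snd.snd
  obtain ⟨t, x, v⟩ := z
  obtain ⟨ht, hx, hv⟩ : t ∈ J ∧ x ∈ I ∧ v ∈ V := hz
  obtain ⟨m, n, hmn⟩ := affine_of_D2_vv_eq_zero hJ hI hV cU
    (fun y hy => ((hco y hy).2.2.2.2.2.2.2 _ _ _ _ _ _ hm₁).1) ht hx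
  have Tt_eq : ∀ w ∈ V, fderiv ℝ T (t, x, w) (1, 0, 0) = fderiv ℝ T (t, x, v) (1, 0, 0) := by
    intro w hw
    refine eq_of_fderiv_v_eq_zero (J := J) (I := I) (f := fun z => fderiv ℝ T z (1, 0, 0)) hV
      (fun y hy => (cT.contDiffOn_fderiv_apply hΩ _).differentiableAt_of_isOpen hΩ hy)
      (fun y hy => ?_) ht hx hw hv
    rw [fderiv_fderiv_apply (cT.contDiffAt_of_isOpen hΩ hy),
      D2_comm (cT.contDiffAt_of_isOpen hΩ hy),
      D2_eq_fderiv hΩ cT hy (g := fun _ => 0) (fun y hy => (hco y hy).1.2)]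
    simp
  have X_eq : ∀ w ∈ V, X (t, x, w) = X (t, x, v) := fun w hw =>
    eq_of_fderiv_v_eq_zero hV (fun y hy => cX.differentiableAt_of_isOpen hΩ hy)
      (fun y hy => (hco y hy).2.1) ht hx hw hv
  set k := fderiv ℝ T (t, x, v) (1, 0, 0) with hk
  obtain ⟨-, -, hXx0, hXx, hUv, -⟩ := hco _ (mem_box ht hx hv)
  have hk0 : 0 < k := by rw [hk, ← hXx]; positivity
  have hm0 : m ≠ 0 := by rw [← (hmn v hv).2]; exact hUv
  -- Two source equations that differ only in the sign of ε are subtracted. The unknown F₁ and F₂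
  -- agree at the image point, so the terms with them cancel.
  have key : ∀ w ∈ V, 2 * m * Real.exp w = k * (ε₁ - ε₂) * Real.exp (m * w + n)
      + k * (H₁ (X (t, x, v)) - H₂ (X (t, x, v))) := by
    intro w hw
    obtain ⟨-, -, hXx0, hXx, hUv, -, -, hmaps⟩ := hco _ (mem_box ht hx hw)
    obtain ⟨-, a2, a3⟩ := hmaps _ _ _ _ _ _ hm₁
    obtain ⟨-, b2, b3⟩ := hmaps _ _ _ _ _ _ hm₂
    rw [show (φ (t, x, w)).2.1 = X (t, x, v) from X_eq w hw] at a2 a3 b2 b3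
    rw [show (φ (t, x, w)).2.2 = m * w + n from (hmn w hw).1] at a3 b3
    have hF : F₁ (X (t, x, v)) = F₂ (X (t, x, v)) := by
      refine mul_left_cancel₀ (mul_ne_zero hXx0 hUv) ?_
      linear_combination b2 - a2
    rw [hF, hXx, Tt_eq w hw, (hmn w hw).2] at a3
    rw [hXx, Tt_eq w hw, (hmn w hw).2] at b3
    linear_combination a3 - b3
  obtain ⟨hm1, hK⟩ := eq_one_of_exp_eq hV (mul_ne_zero two_ne_zero hm0) key
  subst hm1
  -- Positivity of k and of the exponential makes ε₁ - ε₂ positive, and both are ±1.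
  have hε : ε₁ - ε₂ = 2 := by
    have hpos : 0 < ε₁ - ε₂ := by
      have h1 : 0 < k * Real.exp n := by positivity
      by_contra hneg
      nlinarith
    rcases hc₁.1 with h1 | h1 <;> rcases hc₂.1 with h2 | h2 <;> rw [h1, h2] at hpos ⊢ <;>
      norm_num at hpos; norm_num
  rw [hε] at hK
  have hn : Real.exp n = k⁻¹ := by
    field_simp
    linarith
  have hn' : n = -Real.log k := by rw [← Real.log_exp n, hn, Real.log_inv]
  rw [show (φ (t, x, v)).2.2 = 1 * v + n from (hmn v hv).1, hn']
  ring

/-- The transformed space variable does not depend on time. -/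
theorem IsEquivalenceTransformation.space_time_eq_zero (hJ : IsOpenInterval J)
    (hI : IsOpenInterval I) (hV : IsOpenInterval V) (hE : IsEquivalenceTransformation J I V φ Θ)
    (hU : ∀ y ∈ box J I V, fderiv ℝ (fun z => (φ z).2.2) y (0, 0, 1) = 1 ∧
      D2 (fun z => (φ z).2.2) y (0, 1, 0) (0, 0, 1)
        + D2 (fun z => (φ z).2.2) y (0, 0, 1) (0, 1, 0) = 0) {z : J0}
    (hz : z ∈ box J I V) : fderiv ℝ (fun z => (φ z).2.1) z (1, 0, 0) = 0 := by
  have hΩ := isOpen_box hJ hI hV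
  have hco := hE.coeffs hJ hI hV
  dsimp only at hco
  obtain ⟨hφ, hb, hcl⟩ := hE
  obtain ⟨ε₀, F₀, H₀, hc₀, -, hm₀⟩ := hcl 1 _ _ (constPair_inClass (Or.inl rfl) 0 0)
  obtain ⟨ε₁, F₁, H₁, hc₁, -, hm₁⟩ := hcl 1 _ _ (constPair_inClass (Or.inl rfl) 1 0)
  obtain ⟨ε₂, F₂, H₂, hc₂, -, hm₂⟩ := hcl 1 (fun x => x) (fun _ => 0)
    ⟨Or.inl rfl, contDiffOn_id, contDiffOn_const⟩
  set X : J0 → ℝ := fun z => (φ z).2.1 with hX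
  have cX : ContDiffOn ℝ ∞ X (box J I V) := hφ.snd.fst
  have hXx0 := (hco z hz).2.2.1
  -- The image equations are smooth only on the image of X, which must be a neighbourhood for F₀,
  -- F₁, F₂ to be differentiable there.
  have himg : X '' box J I V ∈ 𝓝 (X z) := by
    have hs := (cX.contDiffAt_of_isOpen hΩ hz).hasStrictFDerivAt (by simp)
    rw [← hs.map_nhds_eq_of_surj]
    · exact image_mem_map (hΩ.mem_nhds hz)
    · refine LinearMap.range_eq_top.2 fun r => ⟨(r / fderiv ℝ X z (0, 1, 0)) • (0, 1, 0), ?_⟩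
      rw [ContinuousLinearMap.coe_coe, map_smul, smul_eq_mul, div_mul_cancel₀ _ hXx0]
  have d₀ := (hc₀.2.1.contDiffAt himg).differentiableAt (by simp)
  have d₁ := (hc₁.2.1.contDiffAt himg).differentiableAt (by simp)
  have d₂ := (hc₂.2.1.contDiffAt himg).differentiableAt (by simp)
  have e₁ : ∀ y ∈ box J I V, fderiv ℝ X y (0, 1, 0) * (F₁ (X y) - F₀ (X y)) = 1 := by
    intro y hy
    obtain ⟨-, -, -, -, -, -, -, hmaps⟩ := hco y hy
    have a := (hmaps _ _ _ _ _ _ hm₀).2.1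
    have b := (hmaps _ _ _ _ _ _ hm₁).2.1
    rw [(hU y hy).1, (hU y hy).2] at a b
    linear_combination a - b
  have e₂ : ∀ y ∈ box J I V, fderiv ℝ X y (0, 1, 0) * (F₂ (X y) - F₀ (X y)) = y.2.1 := by
    intro y hy
    obtain ⟨-, -, -, -, -, -, -, hmaps⟩ := hco y hy
    have a := (hmaps _ _ _ _ _ _ hm₀).2.1
    have b := (hmaps _ _ _ _ _ _ hm₂).2.1
    rw [(hU y hy).1, (hU y hy).2] at a b
    linear_combination a - b
  have hne : ∀ y ∈ box J I V, F₁ (X y) - F₀ (X y) ≠ 0 := fun y hy h => by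
    have := e₁ y hy
    rw [h, mul_zero] at this
    exact zero_ne_one this
  -- The sources F = 0, 1, x give X_x (F₁ - F₀) = 1 and X_x (F₂ - F₀) = x, so x = G(X).
  -- Differentiation in x shows G' ≠ 0 and then, in t, X_t = 0.
  set G : ℝ → ℝ := fun s => (F₂ s - F₀ s) / (F₁ s - F₀ s) with hG
  have dG : DifferentiableAt ℝ G (X z) := (d₂.sub d₀).div (d₁.sub d₀) (hne z hz)
  have hGX : (fun y => G (X y)) =ᶠ[𝓝 z] fun y => y.2.1 := by
    filter_upwards [hΩ.mem_nhds hz] with y hy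
    rw [hG]
    dsimp only
    rw [div_eq_iff (hne y hy)]
    refine mul_left_cancel₀ (hco y hy).2.2.1 ?_
    linear_combination e₂ y hy - y.2.1 * e₁ y hy
  have i1 : HasFDerivAt (fun y : J0 => y) (ContinuousLinearMap.id ℝ J0) z := hasFDerivAt_id z
  have u := (dG.hasDerivAt.comp_hasFDerivAt z
    (cX.differentiableAt_of_isOpen hΩ hz).hasFDerivAt).unique
    (i1.snd.fst.congr_of_eventuallyEq hGX)
  have ux := DFunLike.congr_fun u (0, 1, 0)
  have ut := DFunLike.congr_fun u (1, 0, 0)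
  simp at ux ut
  rcases ut with h | h
  · rw [h, zero_mul] at ux
    exact absurd ux zero_ne_one
  · exact h

/-- From X_t = 0 and symmetry of second derivatives X_xt = 0; as X_xx and X_vx vanish too, X_x is a
constant δ. Then T_t = δ² and all components integrate at once. -/
theorem IsEquivalenceTransformation.exists_params (hJ : IsOpenInterval J) (hI : IsOpenInterval I)
    (hV : IsOpenInterval V) (hE : IsEquivalenceTransformation J I V φ Θ) :
    ∃ δ₁ δ₂ δ₃ : ℝ, δ₁ ≠ 0 ∧ ∀ z ∈ box J I V,
      φ z = (δ₁ ^ 2 * z.1 + δ₂, δ₁ * z.2.1 + δ₃, z.2.2 - Real.log (δ₁ ^ 2)) ∧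
      ∀ ε p q : ℝ, (ε = 1 ∨ ε = -1) →
        Θ z (ε, p, q) = (ε, δ₁⁻¹ * p, (δ₁ ^ 2)⁻¹ * q) := by
  have hΩ := isOpen_box hJ hI hV
  have hco := hE.coeffs hJ hI hV
  have hUeq : ∀ z ∈ box J I V, _ := fun z hz => hE.dependent_eq hJ hI hV hz
  have hst := hE.space_time_eq_zero hJ hI hV
  dsimp only at hco
  obtain ⟨hφ, hb, hcl⟩ := hE
  set T : J0 → ℝ := fun z => (φ z).1 with hT
  set X : J0 → ℝ := fun z => (φ z).2.1 with hX
  set U : J0 → ℝ := fun z => (φ z).2.2 with hU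
  have cT : ContDiffOn ℝ ∞ T (box J I V) := hφ.fst
  have cX : ContDiffOn ℝ ∞ X (box J I V) := hφ.snd.fst
  have cU : ContDiffOn ℝ ∞ U (box J I V) := hφ.snd.snd
  have hTt : ∀ z ∈ box J I V, fderiv ℝ T z (1, 0, 0) ≠ 0 := fun z hz => by
    rw [← (hco z hz).2.2.2.1]
    exact pow_ne_zero 2 (hco z hz).2.2.1
  have dU : ∀ z ∈ box J I V, ∀ e : J0, fderiv ℝ U z e
      = e.2.2 - D2 T z e (1, 0, 0) / fderiv ℝ T z (1, 0, 0) := by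
    intro z hz e
    have h1 : U =ᶠ[𝓝 z] fun y => y.2.2 - Real.log (fderiv ℝ T y (1, 0, 0)) := by
      filter_upwards [hΩ.mem_nhds hz] with y hy using hUeq y hy
    have i1 : HasFDerivAt (fun y : J0 => y) (ContinuousLinearMap.id ℝ J0) z := hasFDerivAt_id z
    have h2 := i1.snd.snd.sub (((cT.contDiffOn_fderiv_apply hΩ
      (1, 0, 0)).differentiableAt_of_isOpen hΩ hz).hasFDerivAt.log (hTt z hz))
    have h3 : fderiv ℝ (fun y : J0 => y.2.2 - Real.log (fderiv ℝ T y (1, 0, 0))) z = _ := h2.fderiv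
    rw [h1.fderiv_eq, h3]
    simp [fderiv_fderiv_apply (cT.contDiffAt_of_isOpen hΩ hz)]
    field_simp
  have dT : ∀ z ∈ box J I V, D2 T z (0, 1, 0) (1, 0, 0) = 0 ∧ D2 T z (0, 0, 1) (1, 0, 0) = 0 := by
    intro z hz
    rw [D2_comm (cT.contDiffAt_of_isOpen hΩ hz), D2_comm (cT.contDiffAt_of_isOpen hΩ hz) (0, 0, 1),
      D2_eq_fderiv hΩ cT hz (g := fun _ => 0) (fun y hy => (hco y hy).1.1),
      D2_eq_fderiv hΩ cT hz (g := fun _ => 0) (fun y hy => (hco y hy).1.2)]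
    simp
  have Ux : ∀ z ∈ box J I V, fderiv ℝ U z (0, 1, 0) = 0 := fun z hz => by
    rw [dU z hz, (dT z hz).1]; simp
  have Uv : ∀ z ∈ box J I V, fderiv ℝ U z (0, 0, 1) = 1 := fun z hz => by
    rw [dU z hz, (dT z hz).2]; simp
  have Uex : ∀ z ∈ box J I V, ∀ e, D2 U z e (0, 1, 0) = 0 := fun z hz e => by
    rw [D2_eq_fderiv hΩ cU hz Ux]; simp
  have Uev : ∀ z ∈ box J I V, ∀ e, D2 U z e (0, 0, 1) = 0 := fun z hz e => by
    rw [D2_eq_fderiv hΩ cU hz Uv]; simp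
  have Xt : ∀ z ∈ box J I V, fderiv ℝ X z (1, 0, 0) = 0 := fun z hz =>
    hst (fun y hy => ⟨Uv y hy, by rw [Uev y hy, Uex y hy, add_zero]⟩) hz
  obtain ⟨t₀, ht₀⟩ := hJ.2.1
  obtain ⟨x₀, hx₀⟩ := hI.2.1
  obtain ⟨v₀, hv₀⟩ := hV.2.1
  have hz₀ := mem_box ht₀ hx₀ hv₀
  set z₀ : J0 := (t₀, x₀, v₀) with hz₀'
  set δ := fderiv ℝ X z₀ (0, 1, 0) with hδ
  have hδ0 : δ ≠ 0 := (hco z₀ hz₀).2.2.1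
  have Xx : ∀ z ∈ box J I V, fderiv ℝ X z (0, 1, 0) = δ := by
    intro z hz
    refine eq_of_partials_eq_zero hJ hI hV (f := fun y => fderiv ℝ X y (0, 1, 0))
      (cX.contDiffOn_fderiv_apply hΩ _) (fun y hy => ?_) (fun y hy => ?_) (fun y hy => ?_) hz hz₀
    · rw [fderiv_fderiv_apply (cX.contDiffAt_of_isOpen hΩ hy),
        D2_comm (cX.contDiffAt_of_isOpen hΩ hy), D2_eq_fderiv hΩ cX hy Xt]
      simp
    · rw [fderiv_fderiv_apply (cX.contDiffAt_of_isOpen hΩ hy), (hco y hy).2.2.2.2.2.1]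
    · rw [fderiv_fderiv_apply (cX.contDiffAt_of_isOpen hΩ hy), (hco y hy).2.2.2.2.2.2.1]
  have Tt : ∀ z ∈ box J I V, fderiv ℝ T z (1, 0, 0) = δ ^ 2 := fun z hz => by
    rw [← (hco z hz).2.2.2.1, Xx z hz]
  have affine : ∀ (f : J0 → ℝ) (r s : ℝ), ContDiffOn ℝ ∞ f (box J I V) →
      (∀ z ∈ box J I V, fderiv ℝ f z (1, 0, 0) = r ∧ fderiv ℝ f z (0, 1, 0) = s ∧
        fderiv ℝ f z (0, 0, 1) = 0) →
      ∀ z ∈ box J I V, f z = r * z.1 + s * z.2.1 + (f z₀ - r * t₀ - s * x₀) := by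
    intro f r s hf hd z hz
    have hl : ∀ y ∈ box J I V, ∀ e, fderiv ℝ (fun y : J0 => f y - (r * y.1 + s * y.2.1)) y e
        = fderiv ℝ f y e - (r * e.1 + s * e.2.1) := by
      intro y hy e
      have i1 : HasFDerivAt (fun y : J0 => y) (ContinuousLinearMap.id ℝ J0) y := hasFDerivAt_id y
      have h3 : fderiv ℝ (fun y : J0 => f y - (r * y.1 + s * y.2.1)) y = _ :=
        ((hf.differentiableAt_of_isOpen hΩ hy).hasFDerivAt.sub
          ((i1.fst.const_mul r).add (i1.snd.fst.const_mul s))).fderiv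
      rw [h3]
      simp
    have := eq_of_partials_eq_zero hJ hI hV (f := fun y : J0 => f y - (r * y.1 + s * y.2.1))
      (hf.sub (ContDiff.contDiffOn (by fun_prop)))
      (fun y hy => by rw [hl y hy, (hd y hy).1]; simp)
      (fun y hy => by rw [hl y hy, (hd y hy).2.1]; simp)
      (fun y hy => by rw [hl y hy, (hd y hy).2.2]; simp) hz hz₀
    simp only [hz₀'] at this ⊢
    linarith
  have eT := affine T (δ ^ 2) 0 cT fun z hz => ⟨Tt z hz, (hco z hz).1⟩
  have eX := affine X 0 δ cX fun z hz => ⟨Xt z hz, Xx z hz, (hco z hz).2.1⟩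
  have eU : ∀ z ∈ box J I V, U z = z.2.2 - Real.log (δ ^ 2) := fun z hz => by
    rw [← Tt z hz]; exact hUeq z hz
  have Ut : ∀ z ∈ box J I V, fderiv ℝ U z (1, 0, 0) = 0 := fun z hz => by
    rw [dU z hz, D2_eq_fderiv hΩ cT hz Tt]; simp
  refine ⟨δ, T z₀ - δ ^ 2 * t₀ - 0 * x₀, X z₀ - 0 * t₀ - δ * x₀, hδ0, fun z hz => ⟨?_, ?_⟩⟩
  · refine Prod.ext ?_ (Prod.ext ?_ (eU z hz))
    · exact (eT z hz).trans (by ring)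
    · exact (eX z hz).trans (by ring)
  · intro ε p q hε
    -- Constant arbitrary elements realize every value (ε, p, q), so they determine Θ.
    obtain ⟨ε', F', H', -, hΘ, hm⟩ := hcl ε _ _ (constPair_inClass hε p q)
    obtain ⟨t, x, v⟩ := z
    obtain ⟨ht, hx, hv⟩ : t ∈ J ∧ x ∈ I ∧ v ∈ V := hz
    have hexp : δ ^ 2 * Real.exp (-Real.log (δ ^ 2)) = 1 := by
      rw [Real.exp_neg, Real.exp_log (by positivity)]
      field_simp
    have key : ∀ w ∈ V, p = δ * F' (X (t, x, w)) ∧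
        (ε - ε') * Real.exp w = δ ^ 2 * H' (X (t, x, w)) - q := by
      intro w hw
      have hw' := mem_box ht hx hw
      obtain ⟨-, a2, a3⟩ := (hco _ hw').2.2.2.2.2.2.2 _ _ _ _ _ _ hm
      rw [Xt _ hw', Xx _ hw', Uv _ hw', Uex _ hw', Uev _ hw'] at a2
      rw [Ut _ hw', Xt _ hw', Xx _ hw', Uv _ hw', Ux _ hw', Uex _ hw',
        show (φ (t, x, w)).2.2 = w - Real.log (δ ^ 2) from eU _ hw', sub_eq_add_neg w,
        Real.exp_add] at a3
      exact ⟨by linear_combination a2, by linear_combination a3 + ε' * Real.exp w * hexp⟩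
    have hXc : ∀ w ∈ V, X (t, x, w) = X (t, x, v) := fun w hw => by
      rw [eX _ (mem_box ht hx hw), eX _ (mem_box ht hx hv)]
    -- The difference ε - ε' multiplies e^w in an identity whose other side does not depend on w,
    -- and V has more than one point.
    have hee : ε' = ε := by
      obtain ⟨w, hw, hne⟩ : ∃ w ∈ V, w ≠ v := by
        have := (infinite_of_mem_nhds v (hV.1.mem_nhds hv)).sdiff (finite_singleton v)
        obtain ⟨w, hw, hw'⟩ := this.nonempty
        exact ⟨w, hw, hw'⟩
      have k1 := (key w hw).2
      have k2 := (key v hv).2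
      rw [hXc w hw] at k1
      by_contra hne'
      refine hne (Real.exp_injective (mul_left_cancel₀ (sub_ne_zero.2 (Ne.symm hne')) ?_))
      exact k1.trans k2.symm
    obtain ⟨k1, k2⟩ := key v hv
    rw [hΘ _ (mem_box ht hx hv), hee]
    rw [hee, sub_self, zero_mul] at k2
    refine Prod.ext rfl (Prod.ext ?_ ?_)
    · change F' (X (t, x, v)) = δ⁻¹ * p
      rw [k1]
      field_simp
    · change H' (X (t, x, v)) = (δ ^ 2)⁻¹ * q
      have : q = δ ^ 2 * H' (X (t, x, v)) := by linarith
      rw [this]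
      field_simp

end Group

/-! ### The usual equivalence group: sufficiency -/

/-- The chain rule for dilations and translations of the independent variables. -/
theorem eventually_deriv_comp_affine {W : ℝ × ℝ → ℝ} {p : ℝ × ℝ} {r s r₀ s₀ : ℝ}
    (hW : ContDiffAt ℝ ∞ W (r * p.1 + r₀, s * p.2 + s₀)) (k : ℝ) :
    ∀ᶠ q : ℝ × ℝ in 𝓝 p,
      pdt (fun q => W (r * q.1 + r₀, s * q.2 + s₀) + k) q = r * pdt W (r * q.1 + r₀, s * q.2 + s₀) ∧
      pdx (fun q => W (r * q.1 + r₀, s * q.2 + s₀) + k) q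
        = s * pdx W (r * q.1 + r₀, s * q.2 + s₀) := by
  have hB : Continuous fun q : ℝ × ℝ => (r * q.1 + r₀, s * q.2 + s₀) := by fun_prop
  filter_upwards [hB.continuousAt.eventually hW.eventually_differentiableAt] with q hq
  have i1 : HasFDerivAt (fun y : ℝ × ℝ => y) (ContinuousLinearMap.id ℝ (ℝ × ℝ)) q := hasFDerivAt_id q
  have h1 : HasFDerivAt (fun q : ℝ × ℝ => (r * q.1 + r₀, s * q.2 + s₀)) _ q :=
    ((i1.fst.const_mul r).add_const r₀).prodMk ((i1.snd.const_mul s).add_const s₀)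
  have h2 : HasFDerivAt (fun q => W (r * q.1 + r₀, s * q.2 + s₀) + k) _ q :=
    (hq.hasFDerivAt.comp q h1).add_const k
  constructor
  · rw [pdt, h2.fderiv]
    simp [fderiv_pair, mul_comm]
  · rw [pdx, h2.fderiv]
    simp [fderiv_pair, mul_comm]

/-- With u = u' + ln δ₁² in the new variables, e^u = δ₁² e^{u'} and every other term of the equation
also acquires the factor δ₁². -/
theorem mapsEquation_of_params {J I V : Set ℝ} (hΩ : IsOpen (box J I V)) {φ : J0 → J0}
    {δ₁ δ₂ δ₃ : ℝ} (hδ : δ₁ ≠ 0)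
    (hφ : ∀ z ∈ box J I V,
      φ z = (δ₁ ^ 2 * z.1 + δ₂, δ₁ * z.2.1 + δ₃, z.2.2 - Real.log (δ₁ ^ 2)))
    {ε : ℝ} {F H F' H' : ℝ → ℝ} (hF : ∀ x ∈ I, F' (δ₁ * x + δ₃) = δ₁⁻¹ * F x)
    (hH : ∀ x ∈ I, H' (δ₁ * x + δ₃) = (δ₁ ^ 2)⁻¹ * H x) :
    MapsEquation (box J I V) φ ε F H ε F' H' := by
  intro u u' b p hp hu hb _ hu' hev
  have hmem : ∀ᶠ q : ℝ × ℝ in 𝓝 p, (q.1, q.2, u q) ∈ box J I V :=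
    (continuousAt_fst.prodMk (continuousAt_snd.prodMk hu.continuousAt)).eventually
      (hΩ.mem_nhds hp)
  have hbp : b p = (δ₁ ^ 2 * p.1 + δ₂, δ₁ * p.2 + δ₃) := by rw [hb, hφ _ hp]
  rw [hbp] at hu' ⊢
  have hueq : u =ᶠ[𝓝 p]
      fun q => u' (δ₁ ^ 2 * q.1 + δ₂, δ₁ * q.2 + δ₃) + Real.log (δ₁ ^ 2) := by
    filter_upwards [hmem, hev] with q hq hq'
    rw [hb, hφ _ hq] at hq'
    simp only at hq'
    rw [hq']
    ring
  have hd := eventually_deriv_comp_affine hu' (Real.log (δ₁ ^ 2))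
  have hd2 := eventually_deriv_comp_affine hu'.pdx 0
  have hut : pdt u p = δ₁ ^ 2 * pdt u' (δ₁ ^ 2 * p.1 + δ₂, δ₁ * p.2 + δ₃) := by
    rw [← hd.self_of_nhds.1, pdt, hueq.fderiv_eq, pdt]
  have hux : pdx u =ᶠ[𝓝 p] fun q => δ₁ * (pdx u' (δ₁ ^ 2 * q.1 + δ₂, δ₁ * q.2 + δ₃) + 0) := by
    filter_upwards [hueq.eventuallyEq_nhds, hd] with q hq hq'
    rw [add_zero, ← hq'.2, pdx, hq.fderiv_eq, pdx]
  have huxx : pdx (pdx u) p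
      = δ₁ * (δ₁ * pdx (pdx u') (δ₁ ^ 2 * p.1 + δ₂, δ₁ * p.2 + δ₃)) := by
    rw [← hd2.self_of_nhds.2, pdx, hux.fderiv_eq]
    change fderiv ℝ (δ₁ • fun q : ℝ × ℝ => pdx u' (δ₁ ^ 2 * q.1 + δ₂, δ₁ * q.2 + δ₃) + 0) p (0, 1) = _
    rw [fderiv_const_smul_field]
    rfl
  have hupx := hux.self_of_nhds
  have hexp : Real.exp (u p)
      = Real.exp (u' (δ₁ ^ 2 * p.1 + δ₂, δ₁ * p.2 + δ₃)) * δ₁ ^ 2 := by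
    rw [hueq.self_of_nhds, Real.exp_add, Real.exp_log (by positivity)]
  have hF' : F p.2 = δ₁ * F' (δ₁ * p.2 + δ₃) := by rw [hF p.2 hp.2.1]; field_simp
  have hH' : H p.2 = δ₁ ^ 2 * H' (δ₁ * p.2 + δ₃) := by rw [hH p.2 hp.2.1]; field_simp
  simp only [eqn, jet2, hut, hupx, huxx, hexp, hF', hH']
  constructor
  · intro h
    refine mul_left_cancel₀ (pow_ne_zero 2 hδ) ?_
    linear_combination h
  · intro h
    linear_combination δ₁ ^ 2 * h

theorem isEquivalenceTransformation_of_params {J I V : Set ℝ} (hJ : IsOpenInterval J)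
    (hI : IsOpenInterval I) (hV : IsOpenInterval V) {φ : J0 → J0}
    {Θ : J0 → ℝ × ℝ × ℝ → ℝ × ℝ × ℝ} {δ₁ δ₂ δ₃ : ℝ} (hδ : δ₁ ≠ 0)
    (h : ∀ z ∈ box J I V,
      φ z = (δ₁ ^ 2 * z.1 + δ₂, δ₁ * z.2.1 + δ₃, z.2.2 - Real.log (δ₁ ^ 2)) ∧
      ∀ ε p q : ℝ, (ε = 1 ∨ ε = -1) → Θ z (ε, p, q) = (ε, δ₁⁻¹ * p, (δ₁ ^ 2)⁻¹ * q)) :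
    IsEquivalenceTransformation J I V φ Θ := by
  have hΩ := isOpen_box hJ hI hV
  have hφ : ∀ z ∈ box J I V,
      φ z = (δ₁ ^ 2 * z.1 + δ₂, δ₁ * z.2.1 + δ₃, z.2.2 - Real.log (δ₁ ^ 2)) := fun z hz => (h z hz).1
  refine ⟨ContDiffOn.congr (ContDiff.contDiffOn (by fun_prop)) hφ, fun z hz => ?_,
    fun ε F H hc => ?_⟩
  · have hev : φ =ᶠ[𝓝 z] fun z : J0 =>
        (δ₁ ^ 2 * z.1 + δ₂, δ₁ * z.2.1 + δ₃, z.2.2 - Real.log (δ₁ ^ 2)) := by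
      filter_upwards [hΩ.mem_nhds hz] with y hy using hφ y hy
    have i1 : HasFDerivAt (fun y : J0 => y) (ContinuousLinearMap.id ℝ J0) z := hasFDerivAt_id z
    have h1 : HasFDerivAt (fun z : J0 =>
        (δ₁ ^ 2 * z.1 + δ₂, δ₁ * z.2.1 + δ₃, z.2.2 - Real.log (δ₁ ^ 2))) _ z :=
      ((i1.fst.const_mul (δ₁ ^ 2)).add_const δ₂).prodMk
        (((i1.snd.fst.const_mul δ₁).add_const δ₃).prodMk (i1.snd.snd.sub_const _))
    have hd : ∀ d : J0, fderiv ℝ φ z d = (δ₁ ^ 2 * d.1, δ₁ * d.2.1, d.2.2) := fun d => by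
      rw [hev.fderiv_eq, h1.fderiv]; simp
    constructor
    · intro d d' hdd
      rw [hd, hd] at hdd
      simp only [Prod.mk.injEq] at hdd
      exact Prod.ext (mul_left_cancel₀ (pow_ne_zero 2 hδ) hdd.1)
        (Prod.ext (mul_left_cancel₀ hδ hdd.2.1) hdd.2.2)
    · intro d
      refine ⟨(d.1 / δ₁ ^ 2, d.2.1 / δ₁, d.2.2), ?_⟩
      rw [hd]
      refine Prod.ext ?_ (Prod.ext ?_ rfl)
      · simp only; field_simp
      · simp only; field_simp
  · have hinv : ∀ x, (δ₁ * x + δ₃ - δ₃) / δ₁ = x := fun x => by field_simp; ring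
    have hm : MapsTo (fun y => (y - δ₃) / δ₁) ((fun z => (φ z).2.1) '' box J I V) I := by
      rintro _ ⟨z, hz, rfl⟩
      simp only [hφ z hz, hinv]
      exact hz.2.1
    have ha : ContDiff ℝ ∞ fun y : ℝ => (y - δ₃) / δ₁ := by fun_prop
    refine ⟨ε, fun y => δ₁⁻¹ * F ((y - δ₃) / δ₁), fun y => (δ₁ ^ 2)⁻¹ * H ((y - δ₃) / δ₁),
      ⟨hc.1, ?_, ?_⟩, fun z hz => ?_, ?_⟩
    · exact contDiffOn_const.mul (hc.2.1.comp ha.contDiffOn hm)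
    · exact contDiffOn_const.mul (hc.2.2.comp ha.contDiffOn hm)
    · rw [(h z hz).2 ε _ _ hc.1, hφ z hz]
      simp only [hinv]
    · exact mapsEquation_of_params hΩ hδ hφ (fun x _ => by simp only [hinv])
        fun x _ => by simp only [hinv]

theorem mainTheorem3 (J I V : Set ℝ) (hJ : IsOpenInterval J) (hI : IsOpenInterval I)
    (hV : IsOpenInterval V) :
    -- the usual equivalence group
    (∀ (φ : J0 → J0) (Θ : J0 → ℝ × ℝ × ℝ → ℝ × ℝ × ℝ),
      IsEquivalenceTransformation J I V φ Θ ↔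
        ∃ δ₁ δ₂ δ₃ : ℝ, δ₁ ≠ 0 ∧ ∀ z ∈ box J I V,
          φ z = (δ₁ ^ 2 * z.1 + δ₂, δ₁ * z.2.1 + δ₃, z.2.2 - Real.log (δ₁ ^ 2)) ∧
          ∀ ε p q : ℝ, (ε = 1 ∨ ε = -1) →
            Θ z (ε, p, q) = (ε, δ₁⁻¹ * p, (δ₁ ^ 2)⁻¹ * q)) ∧
    -- the kernel
    kernelAlg J I V = spanOn (box J I V) [TableRow.vecT] ∧
    -- the maximal Lie invariance algebras in the six cases
    (∀ (r : TableRow) (ε : ℝ), r.Valid → InClass I ε r.F r.H →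
      IsBasisOn (box J I V) r.basis (maxAlg (box J I V) ε r.F r.H)) ∧
    -- the six cases exhaust the extensions of the kernel up to equivalence
    (∀ (ε : ℝ) (F H : ℝ → ℝ), InClass I ε F H →
      (maxAlg (box J I V) ε F H ≠ kernelAlg J I V ↔
        ∃ (r : TableRow) (I' : Set ℝ), r.Valid ∧ InClass I' ε r.F r.H ∧
          GEquiv I F H I' r.F r.H)) ∧
    -- the cases are inequivalent
    (∀ (r r' : TableRow) (ε : ℝ) (I' : Set ℝ), r.Valid → r'.Valid →
      InClass I ε r.F r.H → InClass I' ε r'.F r'.H → GEquiv I r.F r.H I' r'.F r'.H →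
        r.number = r'.number ∧ r.normalized = r'.normalized) := by
  refine ⟨fun φ Θ => ⟨fun hE => hE.exists_params hJ hI hV, ?_⟩, kernelAlg_eq hJ hI hV,
    TableRow.isBasisOn_maxAlg hJ hI hV,
    fun ε F H hc => maxAlg_ne_kernelAlg_iff_isClassified hJ hI hV hc,
    fun r r' ε I' hr hr' _ _ h => TableRow.number_eq_of_gEquiv hI hr hr' h⟩
  rintro ⟨δ₁, δ₂, δ₃, hδ, h⟩
  exact isEquivalenceTransformation_of_params hJ hI hV hδ h
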